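/- Let $\mathbb{D}=\{z\in\mathbb{C}:|z|<1\}$. Let $\mathcal{K}_H^0$ be the class of complex-valued harmonic functions $f$ in $\mathbb{D}$ with $f(0)=0$, $f_z(0)=1$, $f_{\bar z}(0)=0$, that are univalent (injective) and sense-preserving ($|f_{\bar z}|<|f_z|$) in $\mathbb{D}$ and for which $f(\mathbb{D})$ is convex. Such functions have a unique representation $$f(z)=z+\sum_{n\ge 2}a_nz^n+\overline{\sum_{n\ge 1}b_nz^n}$$ in $\mathbb{D}$ (with $b_1=0$), and the harmonic convolution of $f$ with $g(z)=z+\sum_{n\ge2}A_nz^n+\overline{\sum_{n\ge1}B_nz^n}$ is $$(f*g)(z)=z+\sum_{n\ge 2}a_nA_nz^n+\overline{\sum_{n\ge 1}b_nB_nz^n}.$$ For $0\le\alpha<1$, a harmonic function $F$ in the disk $|z|<R$ is called fully convex of order $\alpha$ in $|z|<R$ if for every $0<r<R$ it maps the circle $|z|=r$ in a one-to-one manner onto a convex curve (the boundary of a nonempty bounded convex domain) and, for all $\theta$, $\frac{\partial}{\partial\theta}F(re^{i\theta})\ne0$ and $$\frac{\partial}{\partial\theta}\Bigl(\arg\Bigl\{\frac{\partial}{\partial\theta}F(re^{i\theta})\Bigr\}\Bigr)>\alpha,$$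 where $\arg$ denotes a differentiable branch of the argument along the circle; fully convex means fully convex of order $0$. **Corollary.** For every $0\le\alpha<1$ the equation $$2(1-\alpha)(1-r)^5+\alpha(1+r)(1-r)^2-(1+r)(r^2+4r+1)=0$$ has exactly one root $r=s_0(\alpha)$ in $(0,1)$, and for all $f,g\in\mathcal{K}_H^0$ the convolution $f*g$ is univalent and fully convex of order $\alpha$ in $|z|<s_0(\alpha)$. In particular, for all $f,g\in\mathcal{K}_H^0$, $f*g$ is univalent and fully convex in $|z|<s_0(0)$, where $s_0(0)\approx0.0712543$; precisely, $0.0712543<s_0(0)<0.07125435$. -/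

import Mathlib

open Metric

noncomputable section

namespace HarmonicMapping

/-- The Wirtinger derivative `f_z = (f_x - i f_y) / 2`. -/
def dz (f : ℂ → ℂ) (z : ℂ) : ℂ :=
  (fderiv ℝ f z 1 - Complex.I * fderiv ℝ f z Complex.I) / 2

/-- The Wirtinger derivative `f_{z̄} = (f_x + i f_y) / 2`. -/
def dzbar (f : ℂ → ℂ) (z : ℂ) : ℂ :=
  (fderiv ℝ f z 1 + Complex.I * fderiv ℝ f z Complex.I) / 2

/-- The class `S_H`: complex-valued harmonic functions `f` in the unit disk with
`f(0) = 0 = f_z(0) - 1` that are univalent and sense-preserving. For `f = h + conj g` with `h`, `g`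
analytic one has `f_z = h'` and `f_{z̄} = conj g'`, so that sense-preserving means
`|g'| < |h'|` in the disk. -/
structure IsSH (f : ℂ → ℂ) : Prop where
  harmonic : InnerProductSpace.HarmonicOnNhd f (ball 0 1)
  map_zero : f 0 = 0
  dz_zero : dz f 0 = 1
  univalent : Set.InjOn f (ball 0 1)
  sense_preserving : ∀ z ∈ ball (0 : ℂ) 1, ‖dzbar f z‖ < ‖dz f z‖

/-- The class `K_H^0`: functions of `S_H` that map the unit disk onto a convex domain
and satisfy `f_{z̄}(0) = 0`. -/
structure IsKH0 (f : ℂ → ℂ) : Prop extends IsSH f where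
  convex_image : Convex ℝ (f '' ball 0 1)
  dzbar_zero : dzbar f 0 = 0

/-- The Taylor coefficient `a_n` at the origin of the analytic part `h` of a harmonic function
`f = h + conj g`. Near the origin the `n`-th iterate of `∂/∂z` (for `n ≥ 1`) turns `f` into the
`n`-th derivative of `h`. -/
def analyticCoeff (f : ℂ → ℂ) (n : ℕ) : ℂ :=
  (dz^[n] f) 0 / (n.factorial : ℂ)

/-- The Taylor coefficient `b_n` at the origin of the function `g` in `f = h + conj g`. Near the
origin the `n`-th iterate of `∂/∂z̄` (for `n ≥ 1`) turns `f` into the complex conjugate of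
the `n`-th derivative of `g`. -/
def coanalyticCoeff (f : ℂ → ℂ) (n : ℕ) : ℂ :=
  starRingEnd ℂ ((dzbar^[n] f) 0) / (n.factorial : ℂ)

/-- The harmonic convolution of two harmonic functions vanishing at the origin,
`(f * F)(z) = ∑_{n ≥ 1} a_n A_n z^n + conj (∑_{n ≥ 1} b_n B_n z^n)`. -/
def conv (f F : ℂ → ℂ) (z : ℂ) : ℂ :=
  (∑' n : ℕ, analyticCoeff f (n + 1) * analyticCoeff F (n + 1) * z ^ (n + 1)) +
    starRingEnd ℂ
      (∑' n : ℕ, coanalyticCoeff f (n + 1) * coanalyticCoeff F (n + 1) * z ^ (n + 1))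

/-- A convex curve in the plane: the boundary of a nonempty bounded convex domain. -/
def IsConvexCurve (C : Set ℂ) : Prop :=
  ∃ U : Set ℂ, IsOpen U ∧ U.Nonempty ∧ Bornology.IsBounded U ∧ Convex ℝ U ∧ frontier U = C

/-- The curve `γ` is differentiable with nowhere vanishing derivative, and the argument `Ψ` of its
tangent vector `γ'` (a differentiable branch of it) satisfies `Ψ' > α` everywhere. -/
def TangentArgDerivGT (γ : ℝ → ℂ) (α : ℝ) : Prop :=
  Differentiable ℝ γ ∧ (∀ θ, deriv γ θ ≠ 0) ∧
    ∃ Ψ : ℝ → ℝ, Differentiable ℝ Ψ ∧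
      (∀ θ, deriv γ θ = (‖deriv γ θ‖ : ℂ) * Complex.exp (Complex.I * (Ψ θ : ℂ))) ∧
      ∀ θ, α < deriv Ψ θ

/-- The harmonic mapping `f` is fully convex of order `α` in the disk `|z| < R`: it maps every
circle `|z| = r`, `0 < r < R`, in a one-to-one manner onto a convex curve with
`∂/∂θ arg (∂/∂θ f(r e^{iθ})) > α`. -/
def FullyConvexOfOrder (f : ℂ → ℂ) (α R : ℝ) : Prop :=
  InnerProductSpace.HarmonicOnNhd f (ball 0 R) ∧
    ∀ r : ℝ, 0 < r → r < R →
      Set.InjOn f (sphere 0 r) ∧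
      IsConvexCurve (f '' sphere 0 r) ∧
      TangentArgDerivGT (fun θ : ℝ => f ((r : ℂ) * Complex.exp (Complex.I * (θ : ℂ)))) α

/-- Fully convex means fully convex of order `0`. -/
def FullyConvex (f : ℂ → ℂ) (R : ℝ) : Prop :=
  FullyConvexOfOrder f 0 R

end HarmonicMapping

end

/-! Write `f = h + conj g`. Everything rests on the Clunie–Sheil-Small bounds |a_n| ≤ (n+1)/2 and
|b_n| ≤ (n-1)/2 for the class `IsKH0` (`IsKH0.norm_coeff_le`). The coefficients A_n, B_n of a
convolution are then at most the squares of these bounds. A normalized harmonic series is univalent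
and fully convex of order α in |z| < R as soon as the sum of n((n-α)|A_n| + (n+α)|B_n|) r^(n-1),
without the leading term z, is below 1-α for all 0 < r < R (`ConvexSeries`). With the squared bounds
inserted, the sum has the closed form (1-α) - p(r)/(1-r)^5, where p is `radiusPoly α`. So the
criterion holds where p > 0, and p decreases strictly on [0,1] from 1-α > 0 to a negative value.

The coefficient bounds follow from a half-plane inequality (`IsKH0.Parts.exists_halfplane`): there
are unimodular a, b with Re((a h' + conj a g')(b - conj b z²)) ≥ 0 in the disk. Put F = h' + (conj
a)² g'. Carathéodory's bound applied to F(1 - (conj b)² z²) makes the n-th coefficient of F at most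
n+1 in modulus. Since |g'| < |h'|, the function 2h'/F - 1 has positive real part, so h'/F has
coefficients of modulus at most 1. Multiplying the two series bounds those of h' and g'.

For the half-plane inequality, suppose first that the image is bounded with a continuous field of
outer normals, and that the map extends continuously to the closed disk. Comparing the normals at
antipodal points of the circle gives a direction a and a point b such that Re(a f) has its boundary
maximum at b and its minimum at -b. By convexity, high and low boundary values of Re(a f) cannot
interlace, so Re(a f) is monotone on both arcs from -b to b. The hyperbolic Möbius maps with fixed
points ±b push boundary points towards b, hence do not decrease Re(a f) on the circle, and by the
Poisson formula not inside either. The derivative at time 0 is the inequality.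

In general, exhaust the image by parallel bodies Ω of compact convex subsets. The preimage of Ω is
simply connected; let φ be its Riemann map from the disk. Then f ∘ φ is a homeomorphism onto Ω whose
gradient is bounded by C|φ'|, and a length–area argument gives the continuous extension. As Ω grows,
φ'(0) → 1, so φ tends to the identity and the inequality passes to the limit. -/

noncomputable section

namespace HarmonicMapping

open Complex ComplexConjugate Filter Topology InnerProductSpace

/-! ### Harmonic maps as `h + conj g` -/

/-- A harmonic function in the unit disk, decomposed as `h + conj g`. -/
structure Decomp (f h g : ℂ → ℂ) : Prop where
  h_diff : DifferentiableOn ℂ h (ball 0 1)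
  g_diff : DifferentiableOn ℂ g (ball 0 1)
  eq : ∀ z ∈ ball (0 : ℂ) 1, f z = h z + conj (g z)

lemma dz_congr {f k : ℂ → ℂ} {z : ℂ} (h : f =ᶠ[nhds z] k) : dz f z = dz k z := by
  simp only [dz, h.fderiv_eq]

lemma dzbar_congr {f k : ℂ → ℂ} {z : ℂ} (h : f =ᶠ[nhds z] k) : dzbar f z = dzbar k z := by
  simp only [dzbar, h.fderiv_eq]

lemma hasFDerivAt_add_conj {h g : ℂ → ℂ} {h' g' z : ℂ} (hh : HasDerivAt h h' z)
    (hg : HasDerivAt g g' z) :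
    HasFDerivAt (fun w => h w + conj (g w))
      (((ContinuousLinearMap.toSpanSingleton ℂ h').restrictScalars ℝ) +
        (conjCLE : ℂ →L[ℝ] ℂ).comp
          ((ContinuousLinearMap.toSpanSingleton ℂ g').restrictScalars ℝ)) z := by
  have h1 := hh.hasFDerivAt.restrictScalars ℝ
  have h2 := hg.hasFDerivAt.restrictScalars ℝ
  have h3 := (conjCLE : ℂ →L[ℝ] ℂ).hasFDerivAt.comp z h2
  exact h1.add h3

lemma dz_add_conj {h g : ℂ → ℂ} {h' g' z : ℂ} (hh : HasDerivAt h h' z)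
    (hg : HasDerivAt g g' z) : dz (fun w => h w + conj (g w)) z = h' := by
  rw [dz, (hasFDerivAt_add_conj hh hg).fderiv]
  simp
  linear_combination (-h' / 2 + conj g' / 2) * I_mul_I

lemma dzbar_add_conj {h g : ℂ → ℂ} {h' g' z : ℂ} (hh : HasDerivAt h h' z)
    (hg : HasDerivAt g g' z) : dzbar (fun w => h w + conj (g w)) z = conj g' := by
  rw [dzbar, (hasFDerivAt_add_conj hh hg).fderiv]
  simp
  linear_combination (h' / 2 - conj g' / 2) * I_mul_I

lemma differentiableOn_iteratedDeriv {h : ℂ → ℂ} {s : Set ℂ} (hs : IsOpen s)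
    (hh : DifferentiableOn ℂ h s) (n : ℕ) : DifferentiableOn ℂ (iteratedDeriv n h) s := by
  induction n with
  | zero => simpa using hh
  | succ n ih => rw [iteratedDeriv_succ]; exact ih.deriv hs

namespace Decomp

variable {f h g : ℂ → ℂ}

lemma eventuallyEq (D : Decomp f h g) {z : ℂ} (hz : z ∈ ball (0 : ℂ) 1) :
    f =ᶠ[nhds z] fun w => h w + conj (g w) :=
  Filter.eventuallyEq_of_mem (isOpen_ball.mem_nhds hz) D.eq

lemma hasDerivAt_h (D : Decomp f h g) {z : ℂ} (hz : z ∈ ball (0 : ℂ) 1) :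
    HasDerivAt h (deriv h z) z :=
  (D.h_diff.differentiableAt (isOpen_ball.mem_nhds hz)).hasDerivAt

lemma hasDerivAt_g (D : Decomp f h g) {z : ℂ} (hz : z ∈ ball (0 : ℂ) 1) :
    HasDerivAt g (deriv g z) z :=
  (D.g_diff.differentiableAt (isOpen_ball.mem_nhds hz)).hasDerivAt

lemma dz_eq (D : Decomp f h g) {z : ℂ} (hz : z ∈ ball (0 : ℂ) 1) : dz f z = deriv h z := by
  rw [dz_congr (D.eventuallyEq hz), dz_add_conj (D.hasDerivAt_h hz) (D.hasDerivAt_g hz)]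

lemma dzbar_eq (D : Decomp f h g) {z : ℂ} (hz : z ∈ ball (0 : ℂ) 1) :
    dzbar f z = conj (deriv g z) := by
  rw [dzbar_congr (D.eventuallyEq hz), dzbar_add_conj (D.hasDerivAt_h hz) (D.hasDerivAt_g hz)]

/-- One application of ∂/∂z kills the co-analytic part, leaving an analytic function. The index
starts at `n + 1` because `f` itself still carries `conj g`. -/
lemma iterate_dz (D : Decomp f h g) (n : ℕ) :
    ∀ z ∈ ball (0 : ℂ) 1, dz^[n + 1] f z = iteratedDeriv (n + 1) h z := by
  induction n with
  | zero => intro z hz; simpa using D.dz_eq hz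
  | succ n ih =>
    intro z hz
    have h0 : Decomp (dz^[n + 1] f) (iteratedDeriv (n + 1) h) 0 :=
      ⟨differentiableOn_iteratedDeriv isOpen_ball D.h_diff _, differentiableOn_const 0,
        fun w hw => by simpa using ih w hw⟩
    rw [Function.iterate_succ_apply', h0.dz_eq hz, ← iteratedDeriv_succ]

lemma iterate_dzbar (D : Decomp f h g) (n : ℕ) :
    ∀ z ∈ ball (0 : ℂ) 1, dzbar^[n + 1] f z = conj (iteratedDeriv (n + 1) g z) := by
  induction n with
  | zero => intro z hz; simpa using D.dzbar_eq hz
  | succ n ih =>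
    intro z hz
    have h0 : Decomp (dzbar^[n + 1] f) 0 (iteratedDeriv (n + 1) g) :=
      ⟨differentiableOn_const 0, differentiableOn_iteratedDeriv isOpen_ball D.g_diff _,
        fun w hw => by simpa using ih w hw⟩
    rw [Function.iterate_succ_apply', h0.dzbar_eq hz, ← iteratedDeriv_succ]

lemma analyticCoeff_eq (D : Decomp f h g) (n : ℕ) :
    analyticCoeff f (n + 1) = iteratedDeriv (n + 1) h 0 / ((n + 1).factorial : ℂ) := by
  rw [analyticCoeff, D.iterate_dz n 0 (by simp)]

lemma coanalyticCoeff_eq (D : Decomp f h g) (n : ℕ) :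
    coanalyticCoeff f (n + 1) = iteratedDeriv (n + 1) g 0 / ((n + 1).factorial : ℂ) := by
  rw [coanalyticCoeff, D.iterate_dzbar n 0 (by simp), Complex.conj_conj]

end Decomp

/-- With Re f = Re A and Im f = Re B for analytic A, B, one has f = Re A + i Re B. Hence h = (A +
iB)/2 and g = (A - iB)/2 up to constants, which are normalized away at 0. -/
lemma exists_decomp {f : ℂ → ℂ} (hf : HarmonicOnNhd f (ball 0 1)) (h0 : f 0 = 0) :
    ∃ h g, Decomp f h g ∧ h 0 = 0 ∧ g 0 = 0 := by
  obtain ⟨A, hA, hA'⟩ := (hf.comp_CLM reCLM).exists_analyticOnNhd_ball_re_eq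
  obtain ⟨B, hB, hB'⟩ := (hf.comp_CLM imCLM).exists_analyticOnNhd_ball_re_eq
  have hA0 := hA.differentiableOn
  have hB0 := hB.differentiableOn
  refine ⟨fun z => ((A z + I * B z) - (A 0 + I * B 0)) * ((1 / 2 : ℝ) : ℂ),
    fun z => ((A z - I * B z) - (A 0 - I * B 0)) * ((1 / 2 : ℝ) : ℂ), ⟨by fun_prop, by fun_prop, ?_⟩,
    by simp, by simp⟩
  intro z hz
  have e1 := hA' hz
  have e2 := hB' hz
  have e3 := hA' (show (0 : ℂ) ∈ ball 0 1 by simp)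
  have e4 := hB' (show (0 : ℂ) ∈ ball 0 1 by simp)
  simp [h0] at e1 e2 e3 e4
  apply Complex.ext
  · simp only [map_mul, conj_ofReal, add_re, re_mul_ofReal]
    simp only [conj_re, sub_re, add_re, mul_re, I_re, I_im]
    linarith
  · simp only [map_mul, conj_ofReal, add_im, im_mul_ofReal]
    simp only [conj_im, sub_im, add_im, mul_im, I_re, I_im]
    linarith

/-- The analytic and co-analytic parts of a function of class `K_H^0`. -/
structure IsKH0.Parts (f h g : ℂ → ℂ) : Prop extends Decomp f h g where
  deriv_h_zero : deriv h 0 = 1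
  deriv_g_zero : deriv g 0 = 0
  dilatation : ∀ z ∈ ball (0 : ℂ) 1, ‖deriv g z‖ < ‖deriv h z‖

lemma IsKH0.exists_parts {f : ℂ → ℂ} (hf : IsKH0 f) : ∃ h g, IsKH0.Parts f h g := by
  obtain ⟨h, g, D, -, -⟩ := exists_decomp hf.harmonic hf.map_zero
  have hm : (0 : ℂ) ∈ ball (0 : ℂ) 1 := by simp
  refine ⟨h, g, D, ?_, ?_, ?_⟩
  · rw [← D.dz_eq hm, hf.dz_zero]
  · have := hf.dzbar_zero
    rw [D.dzbar_eq hm] at this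
    simpa using this
  · intro z hz
    have := hf.sense_preserving z hz
    rwa [D.dz_eq hz, D.dzbar_eq hz, Complex.norm_conj] at this

/-! ### Taylor coefficients and Carathéodory's bound -/

/-- The `n`-th Taylor coefficient at the origin. -/
def taylorCoeff (f : ℂ → ℂ) (n : ℕ) : ℂ := iteratedDeriv n f 0 / (n.factorial : ℂ)

lemma taylorCoeff_zero (f : ℂ → ℂ) : taylorCoeff f 0 = f 0 := by simp [taylorCoeff]

lemma taylorCoeff_deriv (f : ℂ → ℂ) (n : ℕ) :
    taylorCoeff (deriv f) n = (n + 1) * taylorCoeff f (n + 1) := by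
  have h : (n.factorial : ℂ) ≠ 0 := by exact_mod_cast n.factorial_ne_zero
  have h' : (n : ℂ) + 1 ≠ 0 := by exact_mod_cast n.succ_ne_zero
  rw [taylorCoeff, taylorCoeff, iteratedDeriv_succ', Nat.factorial_succ]
  push_cast
  field_simp

lemma taylorCoeff_congr {f g : ℂ → ℂ} (h : Set.EqOn f g (ball 0 1)) (n : ℕ) :
    taylorCoeff f n = taylorCoeff g n := by
  have : f =ᶠ[nhds 0] g := Filter.eventuallyEq_of_mem (ball_mem_nhds 0 one_pos) h
  rw [taylorCoeff, taylorCoeff, this.iteratedDeriv_eq]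

lemma contDiffAt_of_ball {f : ℂ → ℂ} (hf : DifferentiableOn ℂ f (ball 0 1)) (n : ℕ) :
    ContDiffAt ℂ n f 0 :=
  (hf.analyticAt (ball_mem_nhds 0 one_pos)).contDiffAt

lemma taylorCoeff_add {f g : ℂ → ℂ} (hf : DifferentiableOn ℂ f (ball 0 1))
    (hg : DifferentiableOn ℂ g (ball 0 1)) (n : ℕ) :
    taylorCoeff (fun z => f z + g z) n = taylorCoeff f n + taylorCoeff g n := by
  simp only [taylorCoeff]
  rw [iteratedDeriv_fun_add (contDiffAt_of_ball hf n) (contDiffAt_of_ball hg n), add_div]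

lemma taylorCoeff_const_mul (c : ℂ) (f : ℂ → ℂ) (n : ℕ) :
    taylorCoeff (fun z => c * f z) n = c * taylorCoeff f n := by
  simp only [taylorCoeff]
  rw [iteratedDeriv_const_mul_field, mul_div_assoc]

lemma taylorCoeff_const (c : ℂ) (n : ℕ) :
    taylorCoeff (fun _ => c) n = if n = 0 then c else 0 := by
  rw [taylorCoeff, iteratedDeriv_const]
  split_ifs with h
  · simp [h]
  · simp

lemma taylorCoeff_mul {f g : ℂ → ℂ} (hf : DifferentiableOn ℂ f (ball 0 1))
    (hg : DifferentiableOn ℂ g (ball 0 1)) (n : ℕ) :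
    taylorCoeff (fun z => f z * g z) n =
      ∑ i ∈ Finset.range (n + 1), taylorCoeff f i * taylorCoeff g (n - i) := by
  rw [taylorCoeff, iteratedDeriv_fun_mul (contDiffAt_of_ball hf n) (contDiffAt_of_ball hg n),
    Finset.sum_div]
  refine Finset.sum_congr rfl fun i hi => ?_
  have hi' : i ≤ n := Nat.lt_succ_iff.mp (Finset.mem_range.mp hi)
  have h1 : (n.factorial : ℂ) ≠ 0 := by exact_mod_cast n.factorial_ne_zero
  have h2 : (i.factorial : ℂ) ≠ 0 := by exact_mod_cast i.factorial_ne_zero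
  have h3 : ((n - i).factorial : ℂ) ≠ 0 := by exact_mod_cast (n - i).factorial_ne_zero
  have h4 : (n.choose i : ℂ) * i.factorial * (n - i).factorial = n.factorial := by
    exact_mod_cast Nat.choose_mul_factorial_mul_factorial hi'
  simp only [taylorCoeff]
  field_simp
  linear_combination iteratedDeriv i f 0 * iteratedDeriv (n - i) g 0 * h4

lemma taylorCoeff_id_mul {f : ℂ → ℂ} (hf : DifferentiableOn ℂ f (ball 0 1)) (n : ℕ) :
    taylorCoeff (fun z => z * f z) (n + 1) = taylorCoeff f n := by
  have hid : DifferentiableOn ℂ (fun z : ℂ => z) (ball 0 1) := differentiableOn_id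
  rw [taylorCoeff_mul hid hf, Finset.sum_eq_single 1]
  · have : taylorCoeff (fun z : ℂ => z) 1 = 1 := by
      simp [taylorCoeff]
    simp [this]
  · intro i _ hi
    have : taylorCoeff (fun z : ℂ => z) i = 0 := by
      rcases i with _ | _ | i
      · simp [taylorCoeff]
      · exact absurd rfl hi
      · have : deriv (fun z : ℂ => z) = fun _ => 1 := by funext z; simp
        rw [taylorCoeff, iteratedDeriv_succ', this, iteratedDeriv_const]
        simp
    simp [this]
  · simp

lemma taylorCoeff_eq_circleAverage {f : ℂ → ℂ} {r : ℝ} (hr : 0 < r)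
    (hf : DiffContOnCl ℂ f (ball 0 r)) (n : ℕ) :
    taylorCoeff f n = Real.circleAverage (fun z => (z ^ n)⁻¹ * f z) 0 r := by
  have h := DiffContOnCl.circleIntegral_one_div_sub_center_pow_smul hr n hf
  rw [Real.circleAverage_eq_circleIntegral hr.ne']
  have h1 : (∮ z in C(0, r), (z - 0)⁻¹ • ((z ^ n)⁻¹ * f z)) =
      ∮ z in C(0, r), (1 / (z - 0) ^ (n + 1)) • f z := by
    congr 1
    funext z
    simp only [sub_zero, smul_eq_mul, pow_succ, one_div, mul_inv]
    ring
  have h0 : (n.factorial : ℂ) ≠ 0 := by exact_mod_cast n.factorial_ne_zero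
  rw [h1, h, taylorCoeff]
  simp only [smul_eq_mul]
  field_simp [Real.pi_ne_zero, I_ne_zero]

/-- Carathéodory's coefficient bound for functions with nonnegative real part. -/
lemma norm_taylorCoeff_le_of_re_nonneg {f : ℂ → ℂ} (hf : DifferentiableOn ℂ f (ball 0 1))
    (hre : ∀ z ∈ ball (0 : ℂ) 1, 0 ≤ (f z).re) {n : ℕ} (hn : n ≠ 0) :
    ‖taylorCoeff f n‖ ≤ 2 * (f 0).re := by
  have key : ∀ r : ℝ, 0 < r → r < 1 → ‖taylorCoeff f n‖ * r ^ n ≤ 2 * (f 0).re := by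
    intro r hr hr1
    have hsub : closedBall (0 : ℂ) r ⊆ ball 0 1 := closedBall_subset_ball hr1
    have hfc : DiffContOnCl ℂ f (ball 0 r) := by
      apply DifferentiableOn.diffContOnCl
      rw [closure_ball _ hr.ne']
      exact hf.mono hsub
    have hcont : ContinuousOn f (sphere 0 r) :=
      hf.continuousOn.mono (sphere_subset_closedBall.trans hsub)
    have hne : ∀ z ∈ sphere (0 : ℂ) r, z ^ n ≠ 0 := by
      intro z hz
      apply pow_ne_zero
      rintro rfl
      simp [eq_comm] at hz
      exact hr.ne' hz
    have hinv : ContinuousOn (fun z : ℂ => (z ^ n)⁻¹) (sphere 0 r) :=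
      (continuousOn_id.pow n).inv₀ hne
    have hc1 : ContinuousOn (fun z => (z ^ n)⁻¹ * f z) (sphere 0 r) := hinv.mul hcont
    have hcc : ContinuousOn (fun z => conj (f z)) (sphere 0 r) :=
      continuous_conj.comp_continuousOn hcont
    have hc2 : ContinuousOn (fun z => (z ^ n)⁻¹ * conj (f z)) (sphere 0 r) := hinv.mul hcc
    -- On |z| = r the integrand is the conjugate of r^(-2n) z^n f(z), which is analytic and vanishes
    -- at 0 because n ≠ 0.
    have hz0 : Real.circleAverage (fun z => (z ^ n)⁻¹ * conj (f z)) 0 r = 0 := by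
      have e1 : Real.circleAverage (fun z => (z ^ n)⁻¹ * conj (f z)) 0 r =
          Real.circleAverage ((conjCLE : ℂ →L[ℝ] ℂ) ∘
            fun z => ((r ^ (2 * n) : ℝ) : ℂ)⁻¹ * (z ^ n * f z)) 0 r := by
        apply Real.circleAverage_congr_sphere
        intro z hz
        rw [abs_of_pos hr] at hz
        have h1 : z * conj z = ((r ^ 2 : ℝ) : ℂ) := by
          rw [mul_conj, normSq_eq_norm_sq]
          simp at hz
          rw [hz]
        have h2 := hne z hz
        have h3 : conj z ^ n * z ^ n = ((r ^ (2 * n) : ℝ) : ℂ) := by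
          rw [← mul_pow, mul_comm, h1, pow_mul]; push_cast; ring
        have h4 : ((r ^ (2 * n) : ℝ) : ℂ) ≠ 0 := by
          exact_mod_cast (pow_pos hr _).ne'
        simp only [Function.comp_apply]
        show _ = conj _
        simp only [map_mul, map_inv₀, conj_ofReal, map_pow]
        field_simp
        rw [← h3]
        ring
      rw [e1, ContinuousLinearMap.circleAverage_comp_comm]
      · have : Real.circleAverage (fun z => ((r ^ (2 * n) : ℝ) : ℂ)⁻¹ * (z ^ n * f z)) 0 r = 0 := by
          have hd : DiffContOnCl ℂ (fun z => ((r ^ (2 * n) : ℝ) : ℂ)⁻¹ * (z ^ n * f z))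
              (ball 0 |r|) := by
            rw [abs_of_pos hr]
            apply DifferentiableOn.diffContOnCl
            rw [closure_ball _ hr.ne']
            have := hf.mono hsub
            fun_prop
          rw [hd.circleAverage]
          simp [hn]
        rw [this]; simp
      · apply ContinuousOn.circleIntegrable hr.le
        fun_prop
    -- Adding the zero average replaces f by 2 Re f, whose modulus integrates exactly by the mean
    -- value property.
    have e2 : taylorCoeff f n = Real.circleAverage (fun z => (z ^ n)⁻¹ * ((2 * (f z).re : ℝ) : ℂ)) 0 r := by
      have hadd := Real.circleAverage_add (hc1.circleIntegrable hr.le) (hc2.circleIntegrable hr.le)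
      rw [hz0, add_zero] at hadd
      rw [taylorCoeff_eq_circleAverage hr hfc n, ← hadd]
      apply Real.circleAverage_congr_sphere
      intro z _
      simp only [Pi.add_apply]
      rw [← mul_add, add_conj]
    have e3 : Real.circleAverage (fun z => 2 * (f z).re) 0 r = 2 * (f 0).re := by
      have hd : DiffContOnCl ℂ f (ball 0 |r|) := by rwa [abs_of_pos hr]
      have h1 := reCLM.circleAverage_comp_comm (hcont.circleIntegrable hr.le)
      rw [hd.circleAverage] at h1
      have h2 : Real.circleAverage (fun z => (2 : ℝ) • (reCLM ∘ f) z) 0 r = _ :=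
        Real.circleAverage_fun_smul
      rw [h1] at h2
      simpa using h2
    have e4 : ‖taylorCoeff f n‖ ≤ (r ^ n)⁻¹ * (2 * (f 0).re) := by
      rw [e2, ← e3, Real.circleAverage_def, Real.circleAverage_def, norm_smul, smul_eq_mul,
        mul_left_comm, Real.norm_of_nonneg (by positivity), ← intervalIntegral.integral_const_mul]
      refine mul_le_mul_of_nonneg_left ?_ (by positivity)
      refine (intervalIntegral.norm_integral_le_integral_norm (by positivity)).trans_eq ?_
      apply intervalIntegral.integral_congr
      intro θ _
      have hm : circleMap 0 r θ ∈ ball (0 : ℂ) 1 :=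
        hsub (sphere_subset_closedBall (circleMap_mem_sphere 0 hr.le θ))
      have h5 := hre _ hm
      simp only [norm_mul, norm_inv, norm_pow, norm_circleMap_zero, abs_of_pos hr, norm_real]
      rw [Real.norm_of_nonneg h5, Real.norm_of_nonneg zero_le_two]
    have hp : 0 < r ^ n := pow_pos hr n
    calc ‖taylorCoeff f n‖ * r ^ n ≤ (r ^ n)⁻¹ * (2 * (f 0).re) * r ^ n := by gcongr
      _ = 2 * (f 0).re := by field_simp
  have ht : Filter.Tendsto (fun r : ℝ => ‖taylorCoeff f n‖ * r ^ n) (nhdsWithin 1 (Set.Iio 1))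
      (nhds (‖taylorCoeff f n‖ * 1 ^ n)) :=
    ((continuous_const.mul (continuous_pow n)).tendsto 1).mono_left nhdsWithin_le_nhds
  rw [one_pow, mul_one] at ht
  refine le_of_tendsto ht ?_
  filter_upwards [Ioo_mem_nhdsLT (zero_lt_one' ℝ)] with r hr using key r hr.1 hr.2

/-! ### Coefficient bounds from the half-plane inequality -/

lemma taylorCoeff_mul_one_sub_sq {F : ℂ → ℂ} (hF : DifferentiableOn ℂ F (ball 0 1)) (μ : ℂ)
    (n : ℕ) : taylorCoeff (fun z => F z * (1 - μ * z ^ 2)) (n + 2) =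
      taylorCoeff F (n + 2) - μ * taylorCoeff F n := by
  have e : (fun z => F z * (1 - μ * z ^ 2)) = fun z => F z + -μ * (z * (z * F z)) := by
    funext z; ring
  have h1 : DifferentiableOn ℂ (fun z => z * F z) (ball 0 1) := by fun_prop
  rw [e, taylorCoeff_add hF (by fun_prop), taylorCoeff_const_mul, taylorCoeff_id_mul h1,
    taylorCoeff_id_mul hF]
  ring

/-- If `F (1 - μ z²)`, with `F 0 = 1`, takes values in a half-plane having `0` on its
boundary, then the coefficients of `F` are dominated by those of `1 / (1 - z)²`. -/
lemma norm_taylorCoeff_le_succ {F : ℂ → ℂ} (hF : DifferentiableOn ℂ F (ball 0 1)) (hF0 : F 0 = 1)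
    {c μ : ℂ} (hc : ‖c‖ = 1) (hμ : ‖μ‖ = 1)
    (hre : ∀ z ∈ ball (0 : ℂ) 1, 0 ≤ (c * (F z * (1 - μ * z ^ 2))).re) (n : ℕ) :
    ‖taylorCoeff F n‖ ≤ n + 1 := by
  have hP : ∀ n ≠ 0, ‖taylorCoeff (fun z => F z * (1 - μ * z ^ 2)) n‖ ≤ 2 := by
    intro n hn
    have h1 := norm_taylorCoeff_le_of_re_nonneg
      (f := fun z => c * (F z * (1 - μ * z ^ 2))) (by fun_prop) hre hn
    rw [taylorCoeff_const_mul, norm_mul, hc, one_mul] at h1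
    have h2 : c.re ≤ 1 := hc ▸ re_le_norm c
    simp [hF0] at h1
    linarith
  -- The coefficients satisfy F_{n+2} = P_{n+2} + μ F_n with |P_{n+2}| ≤ 2, so the bound grows by 2
  -- every two steps.
  induction n using Nat.twoStepInduction with
  | zero => simp [taylorCoeff_zero, hF0]
  | one =>
    have h1 := hP 1 one_ne_zero
    have e : (fun z => F z * (1 - μ * z ^ 2)) = fun z => F z + -μ * (z * (z * F z)) := by
      funext z; ring
    have h2 : DifferentiableOn ℂ (fun z => z * F z) (ball 0 1) := by fun_prop
    have h3 := taylorCoeff_id_mul h2 0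
    rw [e, taylorCoeff_add hF (by fun_prop), taylorCoeff_const_mul, h3, taylorCoeff_zero] at h1
    norm_num at h1 ⊢
    exact h1
  | more n ih _ =>
    have h1 := hP (n + 2) (by omega)
    have h2 := taylorCoeff_mul_one_sub_sq hF μ n
    have h3 : taylorCoeff F (n + 2) =
        taylorCoeff (fun z => F z * (1 - μ * z ^ 2)) (n + 2) + μ * taylorCoeff F n := by
      rw [h2]; ring
    rw [h3]
    refine (norm_add_le _ _).trans ?_
    rw [norm_mul, hμ, one_mul]
    push_cast
    linarith

lemma sum_range_succ_cast (n : ℕ) :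
    ∑ i ∈ Finset.range n, ((i : ℝ) + 1) = n * (n + 1) / 2 := by
  induction n with
  | zero => simp
  | succ n ih => rw [Finset.sum_range_succ, ih]; push_cast; ring

lemma norm_conj_sq {a : ℂ} (ha : ‖a‖ = 1) : ‖conj a ^ 2‖ = 1 := by simp [ha]

lemma mul_conj_sq {a : ℂ} (ha : ‖a‖ = 1) : a * conj a ^ 2 = conj a := by
  have : a * conj a = 1 := by rw [mul_conj, normSq_eq_norm_sq, ha]; simp
  linear_combination conj a * this

/-- The coefficient bounds follow from the Clunie–Sheil-Small half-plane inequality. -/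
lemma IsKH0.Parts.norm_taylorCoeff_le {f h g : ℂ → ℂ} (D : IsKH0.Parts f h g) {a b : ℂ}
    (ha : ‖a‖ = 1) (hb : ‖b‖ = 1)
    (hre : ∀ z ∈ ball (0 : ℂ) 1,
      0 ≤ ((a * deriv h z + conj a * deriv g z) * (b - conj b * z ^ 2)).re) (n : ℕ) :
    ‖taylorCoeff h (n + 1)‖ ≤ (n + 2) / 2 ∧ ‖taylorCoeff g (n + 1)‖ ≤ n / 2 := by
  have hh' : DifferentiableOn ℂ (deriv h) (ball 0 1) := D.h_diff.deriv isOpen_ball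
  have hg' : DifferentiableOn ℂ (deriv g) (ball 0 1) := D.g_diff.deriv isOpen_ball
  set l : ℂ := conj a ^ 2 with hl
  have hl1 : ‖l‖ = 1 := norm_conj_sq ha
  -- The factor l = (conj a)² is chosen so that a F = a h' + conj a g'.
  set F : ℂ → ℂ := fun z => deriv h z + l * deriv g z with hFdef
  have hF : DifferentiableOn ℂ F (ball 0 1) := by fun_prop
  have hlt : ∀ z ∈ ball (0 : ℂ) 1, ‖l * deriv g z‖ < ‖deriv h z‖ := by
    intro z hz
    rw [norm_mul, hl1, one_mul]
    exact D.dilatation z hz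
  have hFne : ∀ z ∈ ball (0 : ℂ) 1, F z ≠ 0 := by
    intro z hz h0
    have h1 := hlt z hz
    have h2 : deriv h z = -(l * deriv g z) := eq_neg_of_add_eq_zero_left h0
    rw [h2, norm_neg] at h1
    exact lt_irrefl _ h1
  have hF0 : F 0 = 1 := by simp [hFdef, D.deriv_h_zero, D.deriv_g_zero]
  have hFb := norm_taylorCoeff_le_succ hF hF0 (c := a * b) (μ := conj b ^ 2)
    (by simp [ha, hb]) (norm_conj_sq hb) (by
      intro z hz
      convert hre z hz using 2
      rw [hFdef]
      linear_combination (b - conj b * z ^ 2) * deriv g z * mul_conj_sq ha -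
        z ^ 2 * a * (deriv h z + l * deriv g z) * mul_conj_sq hb)
  -- 2s - 1 = (h' - l g')/(h' + l g') has nonnegative real part since |l g'| < |h'|, and its value
  -- at 0 is 1. Thus h' = F s and l g' = F (1 - s), with the coefficients of s bounded by 1.
  set s : ℂ → ℂ := fun z => deriv h z / F z with hs
  have hsd : DifferentiableOn ℂ s (ball 0 1) := hh'.div hF hFne
  have hs0 : s 0 = 1 := by simp [hs, hF0, D.deriv_h_zero]
  have hq : ∀ z ∈ ball (0 : ℂ) 1, 0 ≤ (2 * s z + -1).re := by
    intro z hz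
    have h1 : 2 * s z + -1 = (deriv h z - l * deriv g z) / F z := by
      rw [hs, eq_div_iff (hFne z hz)]
      field_simp [hFne z hz]
      rw [hFdef]; ring
    have hlt' := hlt z hz
    rw [h1, div_re, ← add_div]
    refine div_nonneg ?_ (normSq_nonneg _)
    have h2 : normSq (l * deriv g z) ≤ normSq (deriv h z) := by
      rw [normSq_eq_norm_sq, normSq_eq_norm_sq]
      gcongr
    rw [normSq_apply, normSq_apply] at h2
    simp only [hFdef, sub_re, sub_im, add_re, add_im]
    nlinarith
  have hsb : ∀ k ≠ 0, ‖taylorCoeff s k‖ ≤ 1 := by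
    intro k hk
    have h1 := norm_taylorCoeff_le_of_re_nonneg (f := fun z => 2 * s z + -1) (by fun_prop) hq hk
    rw [taylorCoeff_add (by fun_prop) (by fun_prop), taylorCoeff_const_mul, taylorCoeff_const,
      if_neg hk, add_zero, norm_mul] at h1
    norm_num [hs0] at h1
    exact h1
  have hsb' : ∀ k, ‖taylorCoeff s k‖ ≤ 1 := by
    intro k
    rcases eq_or_ne k 0 with rfl | hk
    · simp [taylorCoeff_zero, hs0]
    · exact hsb k hk
  have hn : (0 : ℝ) < n + 1 := by positivity
  have hnn : ‖(n : ℂ) + 1‖ = n + 1 := by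
    rw [show (n : ℂ) + 1 = ((n + 1 : ℕ) : ℂ) by push_cast; ring, Complex.norm_natCast]
    push_cast; ring
  constructor
  · have e : Set.EqOn (deriv h) (fun z => F z * s z) (ball 0 1) := by
      intro z hz
      simp only [hs]
      field_simp [hFne z hz]
    have h1 := taylorCoeff_deriv h n
    rw [taylorCoeff_congr e, taylorCoeff_mul hF hsd] at h1
    have h2 : ‖((n : ℂ) + 1) * taylorCoeff h (n + 1)‖ ≤ (n + 1) * (n + 2) / 2 := by
      rw [← h1]
      refine (norm_sum_le _ _).trans ?_
      have : ∑ i ∈ Finset.range (n + 1), ((i : ℝ) + 1) = (n + 1) * (n + 2) / 2 := by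
        rw [sum_range_succ_cast]; push_cast; ring
      rw [← this]
      refine Finset.sum_le_sum fun i _ => ?_
      rw [norm_mul]
      calc _ ≤ ((i : ℝ) + 1) * 1 := by
            gcongr
            · exact hFb i
            · exact hsb' _
        _ = _ := mul_one _
    rw [norm_mul, hnn, mul_div_assoc] at h2
    exact le_of_mul_le_mul_left h2 hn
  -- Since 1 - s has no constant term, the Cauchy product loses its last summand. This turns the
  -- bound (n+2)/2 for h into n/2 for g.
  · have e : Set.EqOn (fun z => l * deriv g z) (fun z => F z * (1 + -1 * s z)) (ball 0 1) := by
      intro z hz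
      simp only [hs]
      field_simp [hFne z hz]
      rw [hFdef]; ring
    have h1 := taylorCoeff_deriv g n
    have h1' := taylorCoeff_const_mul l (deriv g) n
    rw [h1, taylorCoeff_congr e, taylorCoeff_mul hF (by fun_prop)] at h1'
    have h2 : ‖l * (((n : ℂ) + 1) * taylorCoeff g (n + 1))‖ ≤ (n + 1) * n / 2 := by
      rw [← h1', Finset.sum_range_succ]
      have hk : ∀ k, taylorCoeff (fun z => 1 + -1 * s z) k =
          (if k = 0 then 1 else 0) + -1 * taylorCoeff s k := by
        intro k
        rw [taylorCoeff_add (by fun_prop) (by fun_prop), taylorCoeff_const_mul, taylorCoeff_const]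
      rw [Nat.sub_self, hk 0, taylorCoeff_zero, hs0]
      norm_num
      refine (norm_sum_le _ _).trans ?_
      have : ∑ i ∈ Finset.range n, ((i : ℝ) + 1) = (n + 1) * n / 2 := by
        rw [sum_range_succ_cast]; ring
      rw [← this]
      refine Finset.sum_le_sum fun i hi => ?_
      have hi' : n - i ≠ 0 := by have := Finset.mem_range.mp hi; omega
      have hk' := hk (n - i)
      simp only [neg_mul, one_mul, if_neg hi', zero_add] at hk'
      rw [norm_mul, hk', norm_neg]
      calc _ ≤ ((i : ℝ) + 1) * 1 := by
            gcongr
            · exact hFb i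
            · exact hsb' _
        _ = _ := mul_one _
    rw [norm_mul, norm_mul, hl1, one_mul, hnn, mul_div_assoc] at h2
    exact le_of_mul_le_mul_left h2 hn

/-! ### Normal families and Hurwitz's theorem -/

/-- Montel's theorem along an ultrafilter. -/
lemma exists_tendstoLocallyUniformlyOn {ι : Type*} (U : Ultrafilter ι) {V : Set ℂ}
    (hV : IsOpen V) {F : ι → ℂ → ℂ} (hd : ∀ᶠ i in (U : Filter ι), DifferentiableOn ℂ (F i) V)
    (hb : ∀ᶠ i in (U : Filter ι), ∀ z ∈ V, ‖F i z‖ ≤ 1) :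
    ∃ G : ℂ → ℂ, TendstoLocallyUniformlyOn F G U V := by
  -- Along an ultrafilter, compactness gives pointwise limits at once. The Lipschitz bound from
  -- Schwarz's lemma then makes the convergence locally uniform.
  have hlim : ∀ z ∈ V, ∃ w, Tendsto (fun i => F i z) U (𝓝 w) := by
    intro z hz
    have hK : IsCompact (closedBall (0 : ℂ) 1) := isCompact_closedBall 0 1
    have hm : (U.map fun i => F i z : Filter ℂ) ≤ 𝓟 (closedBall (0 : ℂ) 1) := by
      rw [le_principal_iff, Ultrafilter.coe_map, mem_map]
      filter_upwards [hb] with i hi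
      simpa using hi z hz
    obtain ⟨w, -, hw⟩ := hK.ultrafilter_le_nhds (U.map fun i => F i z) hm
    exact ⟨w, hw⟩
  classical
  choose! G hG using hlim
  refine ⟨G, ?_⟩
  rw [Metric.tendstoLocallyUniformlyOn_iff]
  intro ε hε x hx
  obtain ⟨ρ, hρ, hρV⟩ := Metric.isOpen_iff.mp hV x hx
  have hlip : ∀ᶠ i in (U : Filter ι), ∀ y ∈ ball x ρ, dist (F i y) (F i x) ≤ 2 / ρ * dist y x := by
    filter_upwards [hd, hb] with i hi hi'
    intro y hy
    refine Complex.dist_le_div_mul_dist_of_mapsTo_ball (hi.mono hρV) ?_ hy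
    intro w hw
    rw [mem_closedBall, dist_eq_norm]
    linarith [norm_sub_le (F i w) (F i x), hi' w (hρV hw), hi' x hx]
  have hlipG : ∀ y ∈ ball x ρ, dist (G y) (G x) ≤ 2 / ρ * dist y x := by
    intro y hy
    have h1 : Tendsto (fun i => dist (F i y) (F i x)) U (𝓝 (dist (G y) (G x))) :=
      (hG y (hρV hy)).dist (hG x hx)
    refine le_of_tendsto h1 ?_
    filter_upwards [hlip] with i hi using hi y hy
  refine ⟨ball x (min ρ (ρ * ε / 6)), mem_nhdsWithin_of_mem_nhds
    (ball_mem_nhds _ (by positivity)), ?_⟩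
  filter_upwards [hlip, (hG x hx).eventually (ball_mem_nhds _ (show 0 < ε / 3 by positivity))]
    with i hi hi' y hy
  have hy1 : y ∈ ball x ρ := ball_subset_ball (min_le_left _ _) hy
  have hy2 : dist y x < ρ * ε / 6 := lt_of_lt_of_le (mem_ball.mp hy) (min_le_right _ _)
  have e1 := hi y hy1
  have e2 := hlipG y hy1
  have e3 : 2 / ρ * dist y x < ε / 3 := by
    calc 2 / ρ * dist y x < 2 / ρ * (ρ * ε / 6) := by gcongr
      _ = ε / 3 := by field_simp; norm_num
  have hi'' : dist (F i x) (G x) < ε / 3 := hi'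
  have h1 := dist_triangle4 (G y) (G x) (F i x) (F i y)
  rw [dist_comm (G x), dist_comm (F i x) (F i y)] at h1
  linarith

/-- Hurwitz's theorem at a point: a locally uniform limit of nonvanishing holomorphic functions
which vanishes at a point vanishes near that point. -/
lemma eventually_eq_zero_of_tendsto {ι : Type*} {l : Filter ι} [l.NeBot] {V : Set ℂ}
    (hV : IsOpen V) {F : ι → ℂ → ℂ} {G : ℂ → ℂ} (hFG : TendstoLocallyUniformlyOn F G l V)
    (hd : ∀ᶠ i in l, DifferentiableOn ℂ (F i) V) (hne : ∀ᶠ i in l, ∀ z ∈ V, F i z ≠ 0) {a : ℂ}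
    (ha : a ∈ V) (hGa : G a = 0) : ∀ᶠ z in 𝓝 a, G z = 0 := by
  have hG : DifferentiableOn ℂ G V := hFG.differentiableOn hd hV
  rcases (hG.analyticAt (hV.mem_nhds ha)).eventually_eq_zero_or_eventually_ne_zero with h | h
  · exact h
  exfalso
  obtain ⟨ρ, hρ, hρ'⟩ : ∃ ρ > 0, closedBall a ρ ⊆ V ∩ {z | z ≠ a → G z ≠ 0} :=
    nhds_basis_closedBall.mem_iff.mp
      (inter_mem (hV.mem_nhds ha) (eventually_nhdsWithin_iff.mp h))
  have hsph : IsCompact (sphere a ρ) := isCompact_sphere a ρ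
  have hcb : closedBall a ρ ⊆ V := fun z hz => (hρ' hz).1
  have hne0 : ∀ z ∈ sphere a ρ, G z ≠ 0 := fun z hz =>
    (hρ' (sphere_subset_closedBall hz)).2 (ne_of_mem_sphere hz hρ.ne')
  obtain ⟨x, hx, hmin⟩ := hsph.exists_isMinOn (NormedSpace.sphere_nonempty.mpr hρ.le)
    ((hG.continuousOn.mono (sphere_subset_closedBall.trans hcb)).norm)
  set m := ‖G x‖ with hm
  have hm0 : 0 < m := norm_pos_iff.mpr (hne0 x hx)
  have hunif : TendstoUniformlyOn F G l (closedBall a ρ) :=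
    (tendstoLocallyUniformlyOn_iff_forall_isCompact hV).mp hFG _ hcb (isCompact_closedBall a ρ)
  have h1 := Metric.tendstoUniformlyOn_iff.mp hunif (m / 2) (by positivity)
  -- For such an i, the maximum principle for 1/F_i gives |F_i(a)| ≥ m/2, while |F_i(a) - G(a)| <
  -- m/2 and G(a) = 0.
  obtain ⟨i, hi, hi1, hi2⟩ := (h1.and (hd.and hne)).exists
  have hlow : ∀ z ∈ frontier (ball a ρ), ‖(F i z)⁻¹‖ ≤ (m / 2)⁻¹ := by
    intro z hz
    rw [frontier_ball a hρ.ne'] at hz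
    rw [norm_inv]
    have e1 := hi z (sphere_subset_closedBall hz)
    have e2 : m ≤ ‖G z‖ := hmin hz
    have e3 : ‖G z‖ ≤ ‖G z - F i z‖ + ‖F i z‖ := by
      simpa using norm_add_le (G z - F i z) (F i z)
    rw [dist_eq_norm] at e1
    gcongr
    linarith
  have hdc : DiffContOnCl ℂ (fun z => (F i z)⁻¹) (ball a ρ) := by
    apply DifferentiableOn.diffContOnCl
    rw [closure_ball a hρ.ne']
    exact (hi1.mono hcb).inv fun z hz => hi2 z (hcb hz)
  have h2 := Complex.norm_le_of_forall_mem_frontier_norm_le isBounded_ball hdc hlow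
    (subset_closure (mem_ball_self hρ))
  have h3 := hi a (mem_closedBall_self hρ.le)
  rw [hGa, dist_zero_left] at h3
  rw [norm_inv] at h2
  have h4 := (inv_le_inv₀ (norm_pos_iff.mpr (hi2 a ha)) (by positivity)).mp h2
  linarith

/-! ### Möbius maps and the Riemann mapping theorem -/

/-- The Möbius automorphism of the disk sending `c` to `0`. -/
def mobius (c z : ℂ) : ℂ := (z - c) / (1 - conj c * z)

lemma one_sub_conj_mul_ne_zero {c z : ℂ} (hc : ‖c‖ < 1) (hz : ‖z‖ ≤ 1) : 1 - conj c * z ≠ 0 := by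
  intro h
  have h1 : ‖conj c * z‖ = 1 := by rw [← sub_eq_zero.mp h]; simp
  rw [norm_mul, Complex.norm_conj] at h1
  nlinarith [norm_nonneg c, norm_nonneg z]

lemma normSq_one_sub_conj_mul (c z : ℂ) :
    ‖1 - conj c * z‖ ^ 2 - ‖z - c‖ ^ 2 = (1 - ‖c‖ ^ 2) * (1 - ‖z‖ ^ 2) := by
  simp only [← normSq_eq_norm_sq, normSq_apply]
  simp
  ring

lemma norm_mobius_lt {c z : ℂ} (hc : ‖c‖ < 1) (hz : ‖z‖ < 1) : ‖mobius c z‖ < 1 := by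
  rw [mobius, norm_div, div_lt_one (norm_pos_iff.mpr (one_sub_conj_mul_ne_zero hc hz.le))]
  have h1 := normSq_one_sub_conj_mul c z
  have h2 : 0 < (1 - ‖c‖ ^ 2) * (1 - ‖z‖ ^ 2) := by
    apply mul_pos <;> nlinarith [norm_nonneg c, norm_nonneg z]
  nlinarith [norm_nonneg (1 - conj c * z), norm_nonneg (z - c)]

lemma hasDerivAt_mobius {c z : ℂ} (hc : ‖c‖ < 1) (hz : ‖z‖ ≤ 1) :
    HasDerivAt (mobius c) ((1 - (‖c‖ : ℂ) ^ 2) / (1 - conj c * z) ^ 2) z := by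
  have h0 := one_sub_conj_mul_ne_zero hc hz
  have h1 : HasDerivAt (fun z : ℂ => z - c) 1 z := (hasDerivAt_id z).sub_const c
  have h2 : HasDerivAt (fun z : ℂ => 1 - conj c * z) (-conj c) z := by
    simpa using ((hasDerivAt_id z).const_mul (conj c)).const_sub 1
  convert! h1.div h2 h0 using 1
  have h3 : conj c * c = (‖c‖ : ℂ) ^ 2 := by rw [mul_comm, mul_conj, normSq_eq_norm_sq]; simp
  rw [← h3]
  ring

lemma mobius_injOn {c : ℂ} (hc : ‖c‖ < 1) : Set.InjOn (mobius c) (closedBall 0 1) := by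
  intro z hz w hw h
  simp only [mem_closedBall, dist_zero_right] at hz hw
  rw [mobius, mobius, div_eq_div_iff (one_sub_conj_mul_ne_zero hc hz)
    (one_sub_conj_mul_ne_zero hc hw)] at h
  have h3 : conj c * c = (‖c‖ : ℂ) ^ 2 := by rw [mul_comm, mul_conj, normSq_eq_norm_sq]; simp
  have h4 : (z - w) * (1 - (‖c‖ : ℂ) ^ 2) = 0 := by
    rw [← h3]; linear_combination h
  have h5 : (1 - (‖c‖ : ℂ) ^ 2) ≠ 0 := by
    have : (1 - ‖c‖ ^ 2) ≠ 0 := by nlinarith [norm_nonneg c]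
    exact_mod_cast this
  exact sub_eq_zero.mp ((mul_eq_zero.mp h4).resolve_right h5)

lemma mobius_self (c : ℂ) : mobius c c = 0 := by simp [mobius]

lemma mobius_zero (c : ℂ) : mobius c 0 = -c := by simp [mobius]

lemma mobius_ne_zero {c z : ℂ} (hc : ‖c‖ < 1) (hz : ‖z‖ ≤ 1) (h : z ≠ c) : mobius c z ≠ 0 :=
  div_ne_zero (sub_ne_zero.mpr h) (one_sub_conj_mul_ne_zero hc hz)

/-- The difference quotient of q is that of k = q² divided by q(w) + q(z), which tends to 2q(z) ≠ 0.
So a merely continuous square root is already holomorphic. -/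
lemma hasDerivAt_of_sq_eq {V : Set ℂ} (hV : IsOpen V) {q k : ℂ → ℂ} (hq : ContinuousOn q V)
    (hk : DifferentiableOn ℂ k V) (hqk : ∀ z ∈ V, q z ^ 2 = k z) (hk0 : ∀ z ∈ V, k z ≠ 0)
    {z : ℂ} (hz : z ∈ V) : HasDerivAt q (deriv k z / (2 * q z)) z := by
  have hkz := (hk.differentiableAt (hV.mem_nhds hz)).hasDerivAt
  have hq0 : q z ≠ 0 := by
    intro h
    apply hk0 z hz
    rw [← hqk z hz, h]; ring
  have hqc : ContinuousAt q z := hq.continuousAt (hV.mem_nhds hz)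
  rw [hasDerivAt_iff_tendsto_slope] at hkz ⊢
  have h1 : Tendsto (fun w => q w + q z) (𝓝[≠] z) (𝓝 (2 * q z)) := by
    rw [two_mul]
    exact (hqc.tendsto.mono_left nhdsWithin_le_nhds).add_const _
  have h20 : 2 * q z ≠ 0 := mul_ne_zero two_ne_zero hq0
  refine (hkz.div h1 h20).congr' ?_
  filter_upwards [h1.eventually_ne h20, mem_nhdsWithin_of_mem_nhds (hV.mem_nhds hz)] with w hw hwV
  rw [Pi.div_apply, slope_def_field, slope_def_field, ← hqk w hwV, ← hqk z hz, sq_sub_sq,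
    mul_comm, mul_div_right_comm, mul_div_cancel_right₀ _ hw]

/-- Injective holomorphic self-maps into the disk fixing the origin, with nonvanishing derivative. -/
structure KoebeFamily (V : Set ℂ) (ψ : ℂ → ℂ) : Prop where
  diff : DifferentiableOn ℂ ψ V
  maps : Set.MapsTo ψ V (ball 0 1)
  inj : Set.InjOn ψ V
  deriv_ne : ∀ z ∈ V, deriv ψ z ≠ 0
  map_zero : ψ 0 = 0

/-- Koebe's square-root trick. Move the omitted value w to 0, take a square root q on the simply
connected domain, and move c = q(0) back to 0. Since |c|² = |w|, the derivative at 0 grows by the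
factor (1 + |c|²)/(2|c|) > 1. -/
lemma KoebeFamily.exists_larger {V : Set ℂ} (hV : IsOpen V) (hsc : IsSimplyConnected V)
    (h0 : 0 ∈ V) {ψ : ℂ → ℂ} (hψ : KoebeFamily V ψ) {w : ℂ} (hw : ‖w‖ < 1) (hwV : w ∉ ψ '' V) :
    ∃ χ, KoebeFamily V χ ∧ ‖deriv ψ 0‖ < ‖deriv χ 0‖ := by
  have hlt : ∀ z ∈ V, ‖ψ z‖ < 1 := fun z hz => by simpa using hψ.maps hz
  set k : ℂ → ℂ := fun z => mobius w (ψ z) with hk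
  have hkd : ∀ z ∈ V, HasDerivAt k ((1 - (‖w‖ : ℂ) ^ 2) / (1 - conj w * ψ z) ^ 2 * deriv ψ z) z :=
    fun z hz => (hasDerivAt_mobius hw (hlt z hz).le).comp z
      (hψ.diff.differentiableAt (hV.mem_nhds hz)).hasDerivAt
  have hkdiff : DifferentiableOn ℂ k V := fun z hz =>
    (hkd z hz).differentiableAt.differentiableWithinAt
  have hk0 : ∀ z ∈ V, k z ≠ 0 := fun z hz =>
    mobius_ne_zero hw (hlt z hz).le fun h => hwV ⟨z, hz, h⟩
  obtain ⟨q, hqc, hqk⟩ := Complex.exists_continuousOn_pow_eq hsc hV hkdiff.continuousOn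
    (by rintro ⟨z, hz, h⟩; exact hk0 z hz h) two_ne_zero
  have hqd := fun z hz => hasDerivAt_of_sq_eq hV hqc hkdiff (fun z _ => hqk z) hk0 (z := z) hz
  have hqlt : ∀ z ∈ V, ‖q z‖ < 1 := by
    intro z hz
    have h1 : ‖q z‖ ^ 2 < 1 := by
      rw [← norm_pow, hqk]
      exact norm_mobius_lt hw (hlt z hz)
    nlinarith [norm_nonneg (q z)]
  have hq0 : ∀ z ∈ V, q z ≠ 0 := by
    intro z hz h
    apply hk0 z hz
    rw [← hqk z, h]; ring
  set c := q 0 with hc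
  have hc1 : ‖c‖ < 1 := hqlt 0 h0
  have hχd : ∀ z ∈ V, HasDerivAt (fun z => mobius c (q z))
      ((1 - (‖c‖ : ℂ) ^ 2) / (1 - conj c * q z) ^ 2 * (deriv k z / (2 * q z))) z := fun z hz =>
    (hasDerivAt_mobius hc1 (hqlt z hz).le).comp z (hqd z hz)
  have hsq : ∀ {u : ℂ}, ‖u‖ < 1 → (1 - (‖u‖ : ℂ) ^ 2) ≠ 0 := by
    intro u hu
    have : (1 - ‖u‖ ^ 2) ≠ 0 := by nlinarith [norm_nonneg u]
    exact_mod_cast this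
  refine ⟨fun z => mobius c (q z), ⟨fun z hz => (hχd z hz).differentiableAt.differentiableWithinAt,
    fun z hz => by simpa using norm_mobius_lt hc1 (hqlt z hz), ?_, ?_, mobius_self c⟩, ?_⟩
  · intro x hx y hy h
    have h1 := mobius_injOn hc1 (by simpa using (hqlt x hx).le) (by simpa using (hqlt y hy).le) h
    have h2 : k x = k y := by rw [← hqk x, ← hqk y, h1]
    exact hψ.inj hx hy
      (mobius_injOn hw (by simpa using (hlt x hx).le) (by simpa using (hlt y hy).le) h2)
  · intro z hz
    rw [(hχd z hz).deriv, (hkd z hz).deriv]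
    have e1 := one_sub_conj_mul_ne_zero hc1 (hqlt z hz).le
    have e2 := one_sub_conj_mul_ne_zero hw (hlt z hz).le
    have e3 := hψ.deriv_ne z hz
    have e4 := hq0 z hz
    have e5 := hsq hc1
    have e6 := hsq hw
    exact mul_ne_zero (div_ne_zero e5 (pow_ne_zero 2 e1))
      (div_ne_zero (mul_ne_zero (div_ne_zero e6 (pow_ne_zero 2 e2)) e3)
        (mul_ne_zero two_ne_zero e4))
  · rw [(hχd 0 h0).deriv, (hkd 0 h0).deriv, hψ.map_zero]
    have hcw : ‖c‖ ^ 2 = ‖w‖ := by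
      rw [← norm_pow, hc, hqk, hk]
      simp [hψ.map_zero, mobius_zero]
    have hc0 : 0 < ‖c‖ := norm_pos_iff.mpr (hq0 0 h0)
    have hcc : 1 - conj c * c = ((1 - ‖c‖ ^ 2 : ℝ) : ℂ) := by
      rw [mul_comm, mul_conj, normSq_eq_norm_sq]; push_cast; ring
    have hpos : 0 < 1 - ‖c‖ ^ 2 := by nlinarith
    have hw2 : (1 - (‖w‖ : ℂ) ^ 2) = ((1 - ‖c‖ ^ 4 : ℝ) : ℂ) := by
      rw [← hcw]; push_cast; ring
    have hc2 : (1 - (‖c‖ : ℂ) ^ 2) = ((1 - ‖c‖ ^ 2 : ℝ) : ℂ) := by push_cast; ring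
    have hp4 : 0 < 1 - ‖c‖ ^ 4 := by nlinarith
    rw [← hc, hcc, hw2, hc2]
    simp only [mul_zero, sub_zero, one_pow, div_one, norm_mul, norm_div, norm_pow,
      Complex.norm_real, Real.norm_of_nonneg hpos.le, Real.norm_of_nonneg hp4.le, Complex.norm_ofNat]
    have hd0 : 0 < ‖deriv ψ 0‖ := norm_pos_iff.mpr (hψ.deriv_ne 0 h0)
    have e : (1 - ‖c‖ ^ 2) / (1 - ‖c‖ ^ 2) ^ 2 * ((1 - ‖c‖ ^ 4) * ‖deriv ψ 0‖ / (2 * ‖c‖)) =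
        (1 + ‖c‖ ^ 2) / (2 * ‖c‖) * ‖deriv ψ 0‖ := by
      field_simp
      ring
    rw [e]
    have h1 : 1 < (1 + ‖c‖ ^ 2) / (2 * ‖c‖) := by
      rw [one_lt_div (by positivity)]
      nlinarith [sq_pos_of_pos (sub_pos.mpr hc1)]
    nlinarith

lemma KoebeFamily.norm_deriv_le {V : Set ℂ} {ψ : ℂ → ℂ} (hψ : KoebeFamily V ψ) {r : ℝ}
    (hr : 0 < r) (hrV : ball 0 r ⊆ V) : ‖deriv ψ 0‖ ≤ 1 / r := by
  refine Complex.norm_deriv_le_div_of_mapsTo_ball (hψ.diff.mono hrV) ?_ hr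
  rw [hψ.map_zero]
  exact (hψ.maps.mono_left hrV).mono_right ball_subset_closedBall

/-- A maximizing sequence converges along an ultrafilter. As V lies in the disk, the identity
competes, so the limit has derivative at least 1 at 0 and is not constant. Hurwitz's theorem then
preserves injectivity and the nonvanishing of the derivative, and the open mapping theorem keeps the
values in the open disk. -/
lemma exists_extremal {V : Set ℂ} (hV : IsOpen V) (hpc : IsPreconnected V) (h0 : 0 ∈ V)
    (hsub : V ⊆ ball 0 1) :
    ∃ ψ, KoebeFamily V ψ ∧ ∀ χ, KoebeFamily V χ → ‖deriv χ 0‖ ≤ ‖deriv ψ 0‖ := by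
  obtain ⟨r, hr, hrV⟩ := Metric.isOpen_iff.mp hV 0 h0
  set S : Set ℝ := {x | ∃ χ, KoebeFamily V χ ∧ x = ‖deriv χ 0‖} with hS
  have hid : KoebeFamily V (fun z => z) :=
    ⟨differentiableOn_id, hsub, Set.injOn_id V, fun z _ => by simp, rfl⟩
  have h1S : (1 : ℝ) ∈ S := ⟨_, hid, by simp⟩
  have hbdd : BddAbove S := ⟨1 / r, by rintro _ ⟨χ, hχ, rfl⟩; exact hχ.norm_deriv_le hr hrV⟩
  obtain ⟨u, -, hu, huS⟩ := exists_seq_tendsto_sSup ⟨1, h1S⟩ hbdd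
  choose F hF hFu using huS
  set U : Ultrafilter ℕ := hyperfilter ℕ with hU
  have hUat : (U : Filter ℕ) ≤ atTop := Nat.hyperfilter_le_atTop
  have hd : ∀ᶠ i in (U : Filter ℕ), DifferentiableOn ℂ (F i) V := .of_forall fun i => (hF i).diff
  obtain ⟨G, hG⟩ := exists_tendstoLocallyUniformlyOn U hV hd
    (.of_forall fun i z hz => by simpa using (mem_ball_zero_iff.mp ((hF i).maps hz)).le)
  have hGd : DifferentiableOn ℂ G V := hG.differentiableOn hd hV
  have hG' := hG.deriv hd hV
  have hder : ‖deriv G 0‖ = sSup S := by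
    refine tendsto_nhds_unique (hG'.tendsto_at h0).norm ?_
    refine (hu.mono_left hUat).congr fun i => ?_
    rw [hFu]; rfl
  have hder1 : 1 ≤ ‖deriv G 0‖ := hder ▸ le_csSup hbdd h1S
  have hGan : AnalyticOnNhd ℂ G V := hGd.analyticOnNhd hV
  have hnc : ∀ a ∈ V, ∀ c, ¬ ∀ᶠ z in 𝓝 a, G z = c := by
    intro a ha c h
    have h1 : Set.EqOn G (fun _ => c) V :=
      hGan.eqOn_of_preconnected_of_eventuallyEq analyticOnNhd_const hpc ha h
    have h2 : G =ᶠ[𝓝 0] fun _ => c := eventuallyEq_of_mem (hV.mem_nhds h0) h1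
    rw [h2.deriv_eq] at hder1
    norm_num at hder1
  have hle : ∀ z ∈ V, ‖G z‖ ≤ 1 := fun z hz => le_of_tendsto (hG.tendsto_at hz).norm
    (.of_forall fun i => (mem_ball_zero_iff.mp ((hF i).maps hz)).le)
  have hinj : Set.InjOn G V := by
    intro a ha b hb hab
    by_contra hne
    obtain ⟨W, W', hWo, hW'o, haW, hbW', hdisj⟩ := t2_separation hne
    have hloc : TendstoLocallyUniformlyOn (fun i z => F i z - F i b) (fun z => G z - G b) U
        (V ∩ W) := by
      have h1 : TendstoLocallyUniformlyOn (fun i (_ : ℂ) => F i b) (fun _ => G b) U (V ∩ W) := by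
        rw [Metric.tendstoLocallyUniformlyOn_iff]
        intro ε hε x hx
        refine ⟨Set.univ, univ_mem, ?_⟩
        filter_upwards [(hG.tendsto_at hb).eventually (ball_mem_nhds _ hε)] with i hi y _
        rw [dist_comm]; exact hi
      exact (hG.mono Set.inter_subset_left).sub h1
    have h2 := eventually_eq_zero_of_tendsto (hV.inter hWo) hloc
      (.of_forall fun i => ((hF i).diff.mono Set.inter_subset_left).sub_const _)
      (.of_forall fun i z hz => sub_ne_zero.mpr fun h => by
        have := (hF i).inj hz.1 hb h
        subst this
        exact Set.disjoint_left.mp hdisj hz.2 hbW')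
      ⟨ha, haW⟩ (by simp [hab])
    exact hnc a ha (G b) (h2.mono fun z hz => sub_eq_zero.mp hz)
  have hdne : ∀ z ∈ V, deriv G z ≠ 0 := by
    intro a ha h
    have h1 := eventually_eq_zero_of_tendsto hV hG'
      (.of_forall fun i => (hF i).diff.deriv hV) (.of_forall fun i => (hF i).deriv_ne) ha h
    have h2 : Set.EqOn (deriv G) 0 V :=
      (hGd.deriv hV |>.analyticOnNhd hV).eqOn_of_preconnected_of_eventuallyEq
        analyticOnNhd_const hpc ha h1
    rw [h2 h0] at hder1
    norm_num at hder1
  have hmaps : Set.MapsTo G V (ball 0 1) := by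
    rcases hGan.is_constant_or_isOpen hpc with ⟨c, hc⟩ | hop
    · exact absurd (eventually_of_mem (hV.mem_nhds h0) hc) (hnc 0 h0 c)
    · have h1 : G '' V ⊆ interior (closedBall 0 1) :=
        interior_maximal (by rintro _ ⟨z, hz, rfl⟩; simpa using hle z hz) (hop V subset_rfl hV)
      rw [interior_closedBall _ one_ne_zero] at h1
      exact fun z hz => h1 ⟨z, hz, rfl⟩
  refine ⟨G, ⟨hGd, hmaps, hinj, hdne, ?_⟩, fun χ hχ => hder ▸ le_csSup hbdd ⟨χ, hχ, rfl⟩⟩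
  refine tendsto_nhds_unique (hG.tendsto_at h0) ?_
  simp [(hF _).map_zero]

/-- The Riemann mapping theorem for simply connected subdomains of the disk, with a
lower bound for the derivative at the origin. -/
theorem exists_riemann_map {V : Set ℂ} (hV : IsOpen V) (hsc : IsSimplyConnected V) (h0 : 0 ∈ V)
    (hsub : V ⊆ ball 0 1) : ∃ φ ψ : ℂ → ℂ, DifferentiableOn ℂ φ (ball 0 1) ∧
      Set.MapsTo φ (ball 0 1) V ∧ Set.MapsTo ψ V (ball 0 1) ∧ ContinuousOn ψ V ∧
      (∀ z ∈ ball 0 1, ψ (φ z) = z) ∧ (∀ z ∈ V, φ (ψ z) = z) ∧ φ 0 = 0 ∧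
      ∃ d : ℝ, deriv φ 0 = d ∧ ∀ r > 0, ball 0 r ⊆ V → r ≤ d := by
  obtain ⟨G, hG, hmax⟩ := exists_extremal hV hsc.isPathConnected.isConnected.isPreconnected h0 hsub
  have hsurj : Set.SurjOn G V (ball 0 1) := by
    intro w hw
    by_contra h
    obtain ⟨χ, hχ, hlt⟩ := hG.exists_larger hV hsc h0 (by simpa using hw) h
    exact absurd hlt (not_lt.mpr (hmax χ hχ))
  have hbij : Set.BijOn G V (ball 0 1) := ⟨hG.maps, hG.inj, hsurj⟩
  set d : ℂ := deriv G 0 with hd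
  have hd0 : d ≠ 0 := hG.deriv_ne 0 h0
  have hdn : (‖d‖ : ℂ) ≠ 0 := by exact_mod_cast (norm_pos_iff.mpr hd0).ne'
  -- Rotating by t makes the derivative of the inverse map at 0 equal to the positive number 1/‖d‖.
  set t : ℂ := d / ‖d‖ with ht
  have ht1 : ‖t‖ = 1 := by rw [ht]; simp [hd0]
  have ht0 : t ≠ 0 := by rintro h; rw [h] at ht1; simp at ht1
  set inv := Function.invFunOn G V with hinv
  have hmapinv : Set.MapsTo inv (ball 0 1) V := hsurj.mapsTo_invFunOn
  have hright : ∀ w ∈ ball (0 : ℂ) 1, G (inv w) = w := fun w hw => hsurj.rightInvOn_invFunOn hw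
  have hleft : ∀ z ∈ V, inv (G z) = z := fun z hz => hG.inj.leftInvOn_invFunOn hz
  have hopen : ∀ s ⊆ V, IsOpen s → IsOpen (G '' s) := by
    rcases (hG.diff.analyticOnNhd hV).is_constant_or_isOpen
      hsc.isPathConnected.isConnected.isPreconnected with ⟨c, hc⟩ | hop
    · exfalso
      have h2 : G =ᶠ[𝓝 0] fun _ => c := eventuallyEq_of_mem (hV.mem_nhds h0) hc
      apply hd0
      rw [hd, h2.deriv_eq]; simp
    · exact hop
  have hcont : ∀ w ∈ ball (0 : ℂ) 1, ContinuousAt inv w := by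
    intro w hw
    rw [ContinuousAt, tendsto_def]
    intro s hs
    obtain ⟨o, hos, ho, hwo⟩ := _root_.mem_nhds_iff.mp hs
    have h1 : IsOpen (G '' (V ∩ o)) := hopen _ Set.inter_subset_left (hV.inter ho)
    refine mem_of_superset (h1.mem_nhds ⟨inv w, ⟨hmapinv hw, hwo⟩, hright w hw⟩) ?_
    rintro _ ⟨z, hz, rfl⟩
    rw [Set.mem_preimage, hleft z hz.1]
    exact hos hz.2
  have hinvd : ∀ w ∈ ball (0 : ℂ) 1, HasDerivAt inv (deriv G (inv w))⁻¹ w := by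
    intro w hw
    refine HasDerivAt.of_local_left_inverse (hcont w hw)
      (hG.diff.differentiableAt (hV.mem_nhds (hmapinv hw))).hasDerivAt
      (hG.deriv_ne _ (hmapinv hw)) ?_
    filter_upwards [isOpen_ball.mem_nhds hw] with y hy using hright y hy
  have hrot : ∀ z ∈ ball (0 : ℂ) 1, t * z ∈ ball (0 : ℂ) 1 := by
    intro z hz
    simpa [ht1] using hz
  have hinv0 : inv 0 = 0 := by
    have := hleft 0 h0
    rwa [hG.map_zero] at this
  have hφd : ∀ z ∈ ball (0 : ℂ) 1,
      HasDerivAt (fun z => inv (t * z)) ((deriv G (inv (t * z)))⁻¹ * t) z := by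
    intro z hz
    have h1 : HasDerivAt (fun z : ℂ => t * z) t z := by
      simpa using (hasDerivAt_id z).const_mul t
    exact (hinvd _ (hrot z hz)).comp z h1
  refine ⟨fun z => inv (t * z), fun z => t⁻¹ * G z,
    fun z hz => (hφd z hz).differentiableAt.differentiableWithinAt,
    fun z hz => hmapinv (hrot z hz), ?_, hG.diff.continuousOn.const_mul _, ?_, ?_,
    by simp [hinv0], ‖d‖⁻¹, ?_, ?_⟩
  · intro z hz
    have := hG.maps hz
    simpa [ht1] using this
  · intro z hz
    simp only [hright _ (hrot z hz)]
    field_simp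
  · intro z hz
    have : t * (t⁻¹ * G z) = G z := by field_simp
    simp only [this, hleft z hz]
  · rw [(hφd 0 (by simp)).deriv]
    simp only [mul_zero, hinv0, ← hd, ht]
    push_cast
    field_simp
  · intro r hr hrV
    have h1 := hG.norm_deriv_le hr hrV
    rw [← hd] at h1
    have h2 : 0 < ‖d‖ := norm_pos_iff.mpr hd0
    rw [le_inv_comm₀ hr h2]
    simpa using h1

/-! ### Length–area estimates and continuous extension to the closed disk -/

section Energy

open MeasureTheory
open scoped ENNReal

lemma abs_det_toSpanSingleton (c : ℂ) :
    |((ContinuousLinearMap.toSpanSingleton ℂ c).restrictScalars ℝ : ℂ →L[ℝ] ℂ).det| = ‖c‖ ^ 2 := by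
  have h : ((ContinuousLinearMap.toSpanSingleton ℂ c).restrictScalars ℝ : ℂ →L[ℝ] ℂ).det =
      Algebra.norm ℝ c := by
    rw [Algebra.norm_apply, ContinuousLinearMap.det]
    congr 1
    ext z
    all_goals simp [mul_comm]
  rw [h, Algebra.norm_complex_apply, normSq_eq_norm_sq, abs_of_nonneg (by positivity)]

/-- An injective holomorphic map into the unit disk has a vertical slice of small energy. -/
lemma exists_slice_energy_le {G : Set ℂ} (hG : IsOpen G) {Φ : ℂ → ℂ}
    (hd : DifferentiableOn ℂ Φ G) (hinj : Set.InjOn Φ G) (hmaps : Set.MapsTo Φ G (ball 0 1))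
    (x₀ : ℝ) {L : ℝ} (hL : 0 < L) :
    ∃ x < x₀, ∫⁻ y : ℝ, G.indicator (fun w => ENNReal.ofReal (‖deriv Φ w‖ ^ 2)) ⟨x, y⟩ ≤
      ENNReal.ofReal (4 / L) := by
  set e : ℂ → ℝ≥0∞ := G.indicator fun w => ENNReal.ofReal (‖deriv Φ w‖ ^ 2) with he
  have hcont : ContinuousOn (fun w => ENNReal.ofReal (‖deriv Φ w‖ ^ 2)) G :=
    ENNReal.continuous_ofReal.comp_continuousOn ((hd.deriv hG).continuousOn.norm.pow 2)
  have hmeas : Measurable e := by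
    classical
    rw [he, ← Set.piecewise_eq_indicator]
    exact hcont.measurable_piecewise continuousOn_const hG.measurableSet
  -- The Jacobian of Φ is |Φ'|², so the total energy is the area of the injective image, at most π.
  have harea : ∫⁻ w, e w ≤ ENNReal.ofReal Real.pi := by
    have h1 := lintegral_abs_det_fderiv_eq_addHaar_image volume hG.measurableSet
      (f := Φ) (f' := fun w => (ContinuousLinearMap.toSpanSingleton ℂ (deriv Φ w)).restrictScalars ℝ)
      (fun w hw => ((hd.differentiableAt
        (hG.mem_nhds hw)).hasDerivAt.hasFDerivAt.restrictScalars ℝ).hasFDerivWithinAt) hinj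
    simp only [abs_det_toSpanSingleton] at h1
    rw [he, lintegral_indicator hG.measurableSet, h1]
    calc volume (Φ '' G) ≤ volume (ball (0 : ℂ) 1) := measure_mono hmaps.image_subset
      _ = ENNReal.ofReal Real.pi := by
        rw [Complex.volume_ball]
        simp [ENNReal.ofReal, NNReal.pi, Real.toNNReal_of_nonneg Real.pi_pos.le]
        rfl
  have hprod : ∫⁻ x : ℝ, ∫⁻ y : ℝ, e ⟨x, y⟩ ≤ ENNReal.ofReal Real.pi := by
    refine le_trans (le_of_eq ?_) harea
    rw [← (Complex.volume_preserving_equiv_real_prod.symm).lintegral_comp hmeas,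
      Measure.volume_eq_prod, lintegral_prod]
    · rfl
    · exact (hmeas.comp Complex.measurableEquivRealProd.symm.measurable).aemeasurable
  -- If every slice over an interval of length L had energy above 4/L, the total would be at least 4
  -- > π.
  by_contra! hcon
  have h2 : ENNReal.ofReal (4 / L) * ENNReal.ofReal L ≤ ENNReal.ofReal Real.pi := by
    calc ENNReal.ofReal (4 / L) * ENNReal.ofReal L
        = ∫⁻ _ in Set.Ioo (x₀ - L) x₀, ENNReal.ofReal (4 / L) := by
          rw [setLIntegral_const, Real.volume_Ioo]; simp
      _ ≤ ∫⁻ x in Set.Ioo (x₀ - L) x₀, ∫⁻ y : ℝ, e ⟨x, y⟩ := by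
          refine setLIntegral_mono' measurableSet_Ioo fun x hx => (hcon x hx.2).le
      _ ≤ ∫⁻ x : ℝ, ∫⁻ y : ℝ, e ⟨x, y⟩ := setLIntegral_le_lintegral _ _
      _ ≤ _ := hprod
  rw [← ENNReal.ofReal_mul (by positivity), ENNReal.ofReal_le_ofReal_iff Real.pi_pos.le,
    div_mul_cancel₀ _ hL.ne'] at h2
  linarith [Real.pi_lt_four]

/-- Along a vertical segment where `Φ` has small energy, a function whose gradient is
controlled by `Φ'` has small oscillation. -/
lemma dist_le_of_energy_le {G : Set ℂ} (hG : IsOpen G) {Φ H K : ℂ → ℂ}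
    (hd : DifferentiableOn ℂ Φ G) (hH : DifferentiableOn ℂ H G) (hK : DifferentiableOn ℂ K G)
    {C : ℝ} (hC : ∀ w ∈ G, ‖deriv H w‖ + ‖deriv K w‖ ≤ C * ‖deriv Φ w‖) {x : ℝ} {M κ : ℝ}
    (hM : 0 ≤ M) (hκ : 0 < κ) (hC0 : 0 ≤ C)
    (hE : ∫⁻ y : ℝ, G.indicator (fun w => ENNReal.ofReal (‖deriv Φ w‖ ^ 2)) ⟨x, y⟩ ≤
      ENNReal.ofReal M) {y₁ y₂ : ℝ} (h12 : y₁ ≤ y₂)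
    (hseg : ∀ y ∈ Set.Icc y₁ y₂, (⟨x, y⟩ : ℂ) ∈ G) :
    ‖(H ⟨x, y₂⟩ + conj (K ⟨x, y₂⟩)) - (H ⟨x, y₁⟩ + conj (K ⟨x, y₁⟩))‖ ≤
      C * (κ * (y₂ - y₁) + M / κ) / 2 := by
  have hline : ∀ y : ℝ, HasDerivAt (fun y : ℝ => (⟨x, y⟩ : ℂ)) I y := by
    intro y
    have e : (fun y : ℝ => (⟨x, y⟩ : ℂ)) = fun y : ℝ => (x : ℂ) + (y : ℂ) * I := by
      funext y; exact mk_eq_add_mul_I x y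
    rw [e]
    simpa using ((Complex.ofRealCLM.hasDerivAt (x := y)).mul_const I).const_add (x : ℂ)
  have hlc : Continuous fun y : ℝ => (⟨x, y⟩ : ℂ) :=
    continuous_iff_continuousAt.mpr fun y => (hline y).continuousAt
  have hmaps : Set.MapsTo (fun y : ℝ => (⟨x, y⟩ : ℂ)) (Set.Icc y₁ y₂) G := hseg
  have hder : ∀ y ∈ Set.uIcc y₁ y₂, HasDerivAt
      (fun y : ℝ => H ⟨x, y⟩ + conj (K ⟨x, y⟩))
      (deriv H ⟨x, y⟩ * I + conj (deriv K ⟨x, y⟩ * I)) y := by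
    intro y hy
    rw [Set.uIcc_of_le h12] at hy
    have h1 := ((hH.differentiableAt (hG.mem_nhds (hseg y hy))).hasDerivAt).comp_of_eq y (hline y) rfl
    have h2 := ((hK.differentiableAt (hG.mem_nhds (hseg y hy))).hasDerivAt).comp_of_eq y (hline y) rfl
    exact h1.add ((conjCLE : ℂ →L[ℝ] ℂ).hasFDerivAt.comp_hasDerivAt y h2)
  have hcH : ContinuousOn (fun y : ℝ => deriv H ⟨x, y⟩) (Set.Icc y₁ y₂) :=
    (hH.deriv hG).continuousOn.comp hlc.continuousOn hmaps
  have hcK : ContinuousOn (fun y : ℝ => deriv K ⟨x, y⟩) (Set.Icc y₁ y₂) :=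
    (hK.deriv hG).continuousOn.comp hlc.continuousOn hmaps
  have hcΦ : ContinuousOn (fun y : ℝ => deriv Φ ⟨x, y⟩) (Set.Icc y₁ y₂) :=
    (hd.deriv hG).continuousOn.comp hlc.continuousOn hmaps
  have hcd : ContinuousOn (fun y : ℝ => deriv H ⟨x, y⟩ * I + conj (deriv K ⟨x, y⟩ * I))
      (Set.Icc y₁ y₂) :=
    (hcH.mul continuousOn_const).add (continuous_conj.comp_continuousOn (hcK.mul continuousOn_const))
  have hint := intervalIntegral.integral_eq_sub_of_hasDerivAt hder
    (hcd.intervalIntegrable_of_Icc h12)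
  rw [← hint]
  refine (intervalIntegral.norm_integral_le_integral_norm h12).trans ?_
  have hsq : ContinuousOn (fun y : ℝ => ‖deriv Φ ⟨x, y⟩‖ ^ 2) (Set.Icc y₁ y₂) := hcΦ.norm.pow 2
  have hpt : ∀ y ∈ Set.Icc y₁ y₂, ‖deriv H ⟨x, y⟩ * I + conj (deriv K ⟨x, y⟩ * I)‖ ≤
      C / 2 * (κ + κ⁻¹ * ‖deriv Φ ⟨x, y⟩‖ ^ 2) := by
    intro y hy
    have h1 : ‖deriv H ⟨x, y⟩ * I + conj (deriv K ⟨x, y⟩ * I)‖ ≤ C * ‖deriv Φ ⟨x, y⟩‖ := by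
      refine (norm_add_le _ _).trans ?_
      rw [Complex.norm_conj, norm_mul, norm_mul, norm_I, mul_one, mul_one]
      exact hC _ (hseg y hy)
    refine h1.trans ?_
    -- The arithmetic–geometric mean inequality with weight κ plays the role of Cauchy–Schwarz; κ is
    -- chosen later.
    have h2 : ‖deriv Φ ⟨x, y⟩‖ ≤ (κ + κ⁻¹ * ‖deriv Φ ⟨x, y⟩‖ ^ 2) / 2 := by
      have h3 : κ + κ⁻¹ * ‖deriv Φ ⟨x, y⟩‖ ^ 2 - 2 * ‖deriv Φ ⟨x, y⟩‖ =
          κ⁻¹ * (κ - ‖deriv Φ ⟨x, y⟩‖) ^ 2 := by field_simp; ring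
      have h4 : 0 ≤ κ⁻¹ * (κ - ‖deriv Φ ⟨x, y⟩‖) ^ 2 := by positivity
      linarith
    calc C * ‖deriv Φ ⟨x, y⟩‖ ≤ C * ((κ + κ⁻¹ * ‖deriv Φ ⟨x, y⟩‖ ^ 2) / 2) := by gcongr
      _ = _ := by ring
  have hEreal : ∫ y in y₁..y₂, ‖deriv Φ ⟨x, y⟩‖ ^ 2 ≤ M := by
    rw [intervalIntegral.integral_of_le h12, ← integral_Icc_eq_integral_Ioc]
    rw [← ENNReal.ofReal_le_ofReal_iff hM]
    rw [ofReal_integral_eq_lintegral_ofReal (hsq.integrableOn_Icc)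
      (.of_forall fun y => by positivity)]
    refine le_trans ?_ hE
    rw [← lintegral_indicator measurableSet_Icc]
    refine lintegral_mono fun y => ?_
    by_cases hy : y ∈ Set.Icc y₁ y₂
    · rw [Set.indicator_of_mem hy, Set.indicator_of_mem (hseg y hy)]
    · rw [Set.indicator_of_notMem hy]; exact zero_le
  have hsqi : IntervalIntegrable (fun y : ℝ => ‖deriv Φ ⟨x, y⟩‖ ^ 2) volume y₁ y₂ :=
    hsq.intervalIntegrable_of_Icc h12
  calc ∫ y in y₁..y₂, ‖deriv H ⟨x, y⟩ * I + conj (deriv K ⟨x, y⟩ * I)‖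
      ≤ ∫ y in y₁..y₂, C / 2 * (κ + κ⁻¹ * ‖deriv Φ ⟨x, y⟩‖ ^ 2) := by
        refine intervalIntegral.integral_mono_on h12 (hcd.norm.intervalIntegrable_of_Icc h12) ?_ hpt
        exact (intervalIntegrable_const.add (hsqi.const_mul _)).const_mul _
    _ = C / 2 * (κ * (y₂ - y₁) + κ⁻¹ * ∫ y in y₁..y₂, ‖deriv Φ ⟨x, y⟩‖ ^ 2) := by
        rw [intervalIntegral.integral_const_mul, intervalIntegral.integral_add
          (intervalIntegrable_const) (hsqi.const_mul _), intervalIntegral.integral_const_mul,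
          intervalIntegral.integral_const]
        simp only [smul_eq_mul]; ring
    _ ≤ C / 2 * (κ * (y₂ - y₁) + κ⁻¹ * M) := by gcongr
    _ = _ := by rw [div_eq_mul_inv M]; ring

/-- A homeomorphism of the unit disk, fixing the origin, onto a bounded convex domain. -/
structure ConvexHomeo (F Ψ : ℂ → ℂ) (Ω : Set ℂ) : Prop where
  isOpen : IsOpen Ω
  convex : Convex ℝ Ω
  bounded : Bornology.IsBounded Ω
  zero_mem : 0 ∈ Ω
  map_zero : F 0 = 0
  maps : Set.MapsTo F (ball 0 1) Ω
  cont : ContinuousOn F (ball 0 1)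
  maps_inv : Set.MapsTo Ψ Ω (ball 0 1)
  cont_inv : ContinuousOn Ψ Ω
  left_inv : ∀ z ∈ ball (0 : ℂ) 1, Ψ (F z) = z
  right_inv : ∀ p ∈ Ω, F (Ψ p) = p

namespace ConvexHomeo

variable {F Ψ : ℂ → ℂ} {Ω : Set ℂ}

lemma continuous_gauge (T : ConvexHomeo F Ψ Ω) : Continuous (gauge Ω) :=
  _root_.continuous_gauge T.convex (T.isOpen.mem_nhds T.zero_mem)

lemma gauge_lt_one_iff (T : ConvexHomeo F Ψ Ω) {p : ℂ} : gauge Ω p < 1 ↔ p ∈ Ω := by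
  rw [← Set.ext_iff.mp (setOfPred_gauge_lt_one_eq_self_of_isOpen T.convex T.zero_mem T.isOpen) p]
  rfl

lemma exists_norm_bound (T : ConvexHomeo F Ψ Ω) : ∃ R > 0, ∀ p ∈ Ω, ‖p‖ ≤ R := by
  obtain ⟨R, hR, h⟩ := T.bounded.exists_pos_norm_le
  exact ⟨R, hR, h⟩

/-- `F` is proper. -/
lemma exists_norm_le_of_gauge_le (T : ConvexHomeo F Ψ Ω) {τ : ℝ} (hτ : τ < 1) :
    ∃ r < 1, ∀ z ∈ ball (0 : ℂ) 1, gauge Ω (F z) ≤ τ → ‖z‖ ≤ r := by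
  have hsub : {p | gauge Ω p ≤ τ} ⊆ Ω := fun p hp => T.gauge_lt_one_iff.mp (lt_of_le_of_lt hp hτ)
  have hK : IsCompact {p | gauge Ω p ≤ τ} :=
    Metric.isCompact_of_isClosed_isBounded (isClosed_le T.continuous_gauge continuous_const)
      (T.bounded.subset hsub)
  have hK' : IsCompact (Ψ '' {p | gauge Ω p ≤ τ}) := hK.image_of_continuousOn (T.cont_inv.mono hsub)
  have hsub' : Ψ '' {p | gauge Ω p ≤ τ} ⊆ ball 0 1 := by
    rintro _ ⟨p, hp, rfl⟩; exact T.maps_inv (hsub hp)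
  rcases (Ψ '' {p | gauge Ω p ≤ τ}).eq_empty_or_nonempty with he | hne
  · refine ⟨0, zero_lt_one, fun z hz h => ?_⟩
    have : Ψ (F z) ∈ Ψ '' {p | gauge Ω p ≤ τ} := ⟨F z, h, rfl⟩
    rw [he] at this
    exact this.elim
  · obtain ⟨x, hx, hmax⟩ := hK'.exists_isMaxOn hne continuous_norm.continuousOn
    refine ⟨‖x‖, by simpa using hsub' hx, fun z hz h => ?_⟩
    have : Ψ (F z) ∈ Ψ '' {p | gauge Ω p ≤ τ} := ⟨F z, h, rfl⟩
    have h2 := hmax this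
    rwa [Set.mem_ofPred_eq, T.left_inv z hz] at h2

/-- Compact subsets of the disk are mapped away from the boundary. -/
lemma exists_gauge_le_of_norm_le (T : ConvexHomeo F Ψ Ω) {r : ℝ} (hr : r < 1) :
    ∃ τ < 1, ∀ z : ℂ, ‖z‖ ≤ r → gauge Ω (F z) ≤ τ := by
  have hsub : closedBall (0 : ℂ) r ⊆ ball 0 1 := closedBall_subset_ball hr
  rcases (closedBall (0 : ℂ) r).eq_empty_or_nonempty with he | hne
  · refine ⟨0, zero_lt_one, fun z hz => ?_⟩
    have : z ∈ closedBall (0 : ℂ) r := by simpa using hz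
    rw [he] at this
    exact this.elim
  · obtain ⟨x, hx, hmax⟩ := (isCompact_closedBall (0 : ℂ) r).exists_isMaxOn hne
      (T.continuous_gauge.comp_continuousOn (T.cont.mono hsub))
    refine ⟨gauge Ω (F x), T.gauge_lt_one_iff.mpr (T.maps (hsub hx)), fun z hz => ?_⟩
    exact hmax (show z ∈ closedBall (0 : ℂ) r by simpa using hz)

end ConvexHomeo

/-- A point of a convex set seen from `0` through a small ball around an exterior point `q` is
close to `q`. -/
lemma norm_sub_le_of_convex {Ω : Set ℂ} (hconv : Convex ℝ Ω) {ρ R : ℝ} (hρ : 0 < ρ)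
    (hball : ball 0 ρ ⊆ Ω) (hR : ∀ p ∈ Ω, ‖p‖ ≤ R) {p q : ℂ} (hp : p ∈ Ω) (hq : q ∉ Ω)
    {s δ : ℝ} (hs0 : 0 ≤ s) (hs1 : s ≤ 1) (h : ‖((1 - s : ℝ) : ℂ) * p - q‖ ≤ δ) :
    ‖p - q‖ ≤ δ * (1 + R / ρ) := by
  -- If sρ > δ, then (q - (1-s)p)/s lies in the ball of radius ρ, and q would be a convex
  -- combination of points of Ω.
  have h1 : s * ρ ≤ δ := by
    by_contra! hlt
    apply hq
    have hspos : 0 < s := by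
      rcases hs0.eq_or_lt with rfl | h'
      · have := (norm_nonneg _).trans h
        linarith
      · exact h'
    have hb : ((s⁻¹ : ℝ) : ℂ) * (q - ((1 - s : ℝ) : ℂ) * p) ∈ Ω := by
      apply hball
      rw [mem_ball_zero_iff, norm_mul, norm_real, norm_inv, Real.norm_of_nonneg hs0, norm_sub_rev,
        inv_mul_lt_iff₀ hspos]
      linarith
    have := hconv hp hb (show 0 ≤ 1 - s by linarith) hs0 (by ring)
    convert this using 1
    rw [real_smul, real_smul, ← mul_assoc, ← ofReal_mul, mul_inv_cancel₀ hspos.ne']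
    simp
  have hRp := hR p hp
  have h2 : s ≤ δ / ρ := (le_div_iff₀ hρ).mpr h1
  calc ‖p - q‖ = ‖(s : ℂ) * p + (((1 - s : ℝ) : ℂ) * p - q)‖ := by
        congr 1; push_cast; ring
    _ ≤ s * ‖p‖ + δ := by
        refine (norm_add_le _ _).trans ?_
        rw [norm_mul, norm_real, Real.norm_of_nonneg hs0]
        linarith
    _ ≤ δ / ρ * R + δ := by gcongr; exact hs0.trans h2
    _ = _ := by ring

/-- In logarithmic coordinates at a boundary point, this shows that for |y| < π/2 each vertical
slice of the disk is a symmetric interval, so segments between its points stay inside. -/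
lemma norm_one_sub_exp_lt_one_iff (x y : ℝ) :
    ‖1 - cexp ⟨x, y⟩‖ < 1 ↔ Real.exp x < 2 * Real.cos y := by
  have h1 : ‖1 - cexp ⟨x, y⟩‖ ^ 2 = 1 + Real.exp x * (Real.exp x - 2 * Real.cos y) := by
    rw [← normSq_eq_norm_sq, normSq_apply]
    simp only [sub_re, sub_im, one_re, one_im, exp_re, exp_im]
    have := Real.sin_sq_add_cos_sq y
    linear_combination (Real.exp x) ^ 2 * this
  have h2 := Real.exp_pos x
  rw [← sq_lt_one_iff₀ (norm_nonneg _), h1]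
  constructor
  · intro h
    by_contra! h'
    nlinarith [mul_nonneg h2.le (sub_nonneg.mpr h')]
  · intro h
    nlinarith [mul_pos h2 (sub_pos.mpr h)]

/-- Near each boundary point of the disk there is a crosscut, a circular arc, on which the
oscillation of `F` is small. -/
lemma exists_crosscut {φ F H K : ℂ → ℂ} (hφ : DifferentiableOn ℂ φ (ball 0 1))
    (hinj : Set.InjOn φ (ball 0 1)) (hmaps : Set.MapsTo φ (ball 0 1) (ball 0 1))
    (D : Decomp F H K) {C : ℝ} (hC0 : 0 ≤ C)
    (hC : ∀ z ∈ ball (0 : ℂ) 1, ‖deriv H z‖ + ‖deriv K z‖ ≤ C * ‖deriv φ z‖) {ζ : ℂ} (hζ : ‖ζ‖ = 1)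
    {ε : ℝ} (hε : 0 < ε) :
    ∃ ρ, 0 < ρ ∧ ρ < 1 ∧ ∀ z₁ ∈ ball (0 : ℂ) 1, ∀ z₂ ∈ ball (0 : ℂ) 1, ‖z₁ - ζ‖ = ρ → ‖z₂ - ζ‖ = ρ →
      ‖F z₂ - F z₁‖ ≤ ε := by
  -- The vertical line Re w = x goes to the circle of radius e^x about ζ; the strip |Im w| < π makes
  -- E injective.
  set E : ℂ → ℂ := fun w => ζ * (1 - cexp w) with hE
  have hEc : Continuous E := by fun_prop
  set G : Set ℂ := {w | ‖1 - cexp w‖ < 1} ∩ {w | |w.im| < Real.pi} with hG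
  have hGo : IsOpen G :=
    (isOpen_lt (by fun_prop) continuous_const).inter (isOpen_lt (by fun_prop) continuous_const)
  have hEG : Set.MapsTo E G (ball 0 1) := by
    intro w hw
    simpa [hE, hζ] using hw.1
  have hζ0 : ζ ≠ 0 := by rintro rfl; simp at hζ
  have hEd : ∀ w, HasDerivAt E (-(ζ * cexp w)) w := by
    intro w
    simpa using ((Complex.hasDerivAt_exp w).const_sub 1).const_mul ζ
  have hcomp : ∀ {k : ℂ → ℂ}, DifferentiableOn ℂ k (ball 0 1) → ∀ w ∈ G,
      HasDerivAt (fun w => k (E w)) (deriv k (E w) * -(ζ * cexp w)) w := by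
    intro k hk w hw
    exact (hk.differentiableAt (isOpen_ball.mem_nhds (hEG hw))).hasDerivAt.comp w (hEd w)
  have hcompd : ∀ {k : ℂ → ℂ}, DifferentiableOn ℂ k (ball 0 1) →
      DifferentiableOn ℂ (fun w => k (E w)) G := fun hk w hw =>
    (hcomp hk w hw).differentiableAt.differentiableWithinAt
  have hEinj : Set.InjOn E G := by
    intro w₁ h₁ w₂ h₂ h
    have h3 : cexp w₁ = cexp w₂ := by
      have := mul_left_cancel₀ hζ0 h
      linear_combination -this
    have a1 := abs_lt.mp (show |w₁.im| < Real.pi from h₁.2)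
    have a2 := abs_lt.mp (show |w₂.im| < Real.pi from h₂.2)
    exact Complex.exp_inj_of_neg_pi_lt_of_le_pi a1.1 a1.2.le a2.1 a2.2.le h3
  -- With energy 4/N² and weight κ = 1/N, the oscillation is at most 4C/N, which is below ε.
  obtain ⟨N, hN⟩ := exists_nat_gt (6 * C / ε)
  have hNpos : 0 < (N : ℝ) := lt_of_le_of_lt (by positivity) hN
  obtain ⟨x, hx, hxE⟩ := exists_slice_energy_le hGo (hcompd hφ)
    (fun w₁ h₁ w₂ h₂ h => hEinj h₁ h₂ (hinj (hEG h₁) (hEG h₂) h))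
    (fun w hw => hmaps (hEG hw)) 0 (L := (N : ℝ) ^ 2) (by positivity)
  refine ⟨Real.exp x, Real.exp_pos x, by simpa using hx, ?_⟩
  have hlift : ∀ z ∈ ball (0 : ℂ) 1, ‖z - ζ‖ = Real.exp x →
      ∃ y : ℝ, |y| < Real.pi / 2 ∧ (⟨x, y⟩ : ℂ) ∈ G ∧ E ⟨x, y⟩ = z := by
    intro z hz hzρ
    have hz1 : ‖z / ζ‖ < 1 := by simpa [hζ] using hz
    set u : ℂ := 1 - z / ζ with hu
    have hure : 0 < u.re := by
      rw [hu, sub_re, one_re]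
      linarith [re_le_norm (z / ζ)]
    have hu0 : u ≠ 0 := by rintro h; rw [h] at hure; simp at hure
    have hun : ‖u‖ = Real.exp x := by
      have : u = -(z - ζ) / ζ := by rw [hu]; field_simp; ring
      rw [this, norm_div, norm_neg, hζ, hzρ, div_one]
    have harg := Complex.abs_arg_lt_pi_div_two_iff.mpr (Or.inl hure)
    have hlog : (⟨x, u.arg⟩ : ℂ) = log u := by
      apply Complex.ext
      · rw [log_re, hun, Real.log_exp]
      · rw [log_im]
    have hexp : cexp ⟨x, u.arg⟩ = u := by rw [hlog, exp_log hu0]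
    have hEz : E ⟨x, u.arg⟩ = z := by
      have h1 : E ⟨x, u.arg⟩ = ζ * (1 - u) := by simp only [hE, hexp]
      rw [h1, hu, sub_sub_cancel, mul_div_cancel₀ _ hζ0]
    refine ⟨u.arg, harg, ⟨?_, ?_⟩, hEz⟩
    · simp only [Set.mem_ofPred_eq]
      rw [hexp, hu]
      simpa using hz1
    · simp only [Set.mem_ofPred_eq]
      linarith [Real.pi_pos]
  have hmain : ∀ y₁ y₂ : ℝ, y₁ ≤ y₂ → |y₁| < Real.pi / 2 → |y₂| < Real.pi / 2 →
      (⟨x, y₁⟩ : ℂ) ∈ G → (⟨x, y₂⟩ : ℂ) ∈ G → ‖F (E ⟨x, y₂⟩) - F (E ⟨x, y₁⟩)‖ ≤ ε := by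
    intro y₁ y₂ h12 hy1 hy2 hG1 hG2
    have hseg : ∀ y ∈ Set.Icc y₁ y₂, (⟨x, y⟩ : ℂ) ∈ G := by
      intro y hy
      have hmax : |y| ≤ max |y₁| |y₂| := abs_le_max_abs_abs hy.1 hy.2
      have hmaxlt : max |y₁| |y₂| < Real.pi / 2 := max_lt hy1 hy2
      refine ⟨?_, ?_⟩
      · have e1 := (norm_one_sub_exp_lt_one_iff x y₁).mp hG1.1
        have e2 := (norm_one_sub_exp_lt_one_iff x y₂).mp hG2.1
        refine (norm_one_sub_exp_lt_one_iff x y).mpr ?_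
        have e3 : Real.cos (max |y₁| |y₂|) ≤ Real.cos |y| :=
          Real.cos_le_cos_of_nonneg_of_le_pi (abs_nonneg _) (by linarith [Real.pi_pos]) hmax
        rw [Real.cos_abs] at e3
        rcases max_choice |y₁| |y₂| with h | h <;> rw [h, Real.cos_abs] at e3 <;> linarith
      · simp only [Set.mem_ofPred_eq]
        linarith [Real.pi_pos]
    have h1 := dist_le_of_energy_le hGo (hcompd hφ) (hcompd D.h_diff) (hcompd D.g_diff) (C := C)
      (by
        intro w hw
        rw [(hcomp hφ w hw).deriv, (hcomp D.h_diff w hw).deriv, (hcomp D.g_diff w hw).deriv,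
          norm_mul, norm_mul, norm_mul, ← add_mul, ← mul_assoc]
        gcongr
        exact hC _ (hEG hw)) (M := 4 / (N : ℝ) ^ 2) (κ := 1 / N) (by positivity) (by positivity) hC0
      hxE h12 hseg
    rw [D.eq _ (hEG hG1), D.eq _ (hEG hG2)]
    refine h1.trans ?_
    have h3 : y₂ - y₁ ≤ 4 := by
      linarith [(abs_lt.mp hy1).1, (abs_lt.mp hy2).2, Real.pi_lt_four]
    calc C * (1 / N * (y₂ - y₁) + 4 / (N : ℝ) ^ 2 / (1 / N)) / 2
        ≤ C * (1 / N * 4 + 4 / (N : ℝ) ^ 2 / (1 / N)) / 2 := by gcongr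
      _ = 4 * C / N := by field_simp; ring
      _ ≤ ε := by
        rw [div_le_iff₀ hNpos]
        rw [div_lt_iff₀ hε] at hN
        linarith
  intro z₁ hz₁ z₂ hz₂ h₁ h₂
  obtain ⟨y₁, b1, g1, rfl⟩ := hlift z₁ hz₁ h₁
  obtain ⟨y₂, b2, g2, rfl⟩ := hlift z₂ hz₂ h₂
  rcases le_total y₁ y₂ with h | h
  · exact hmain y₁ y₂ h b1 b2 g1 g2
  · rw [norm_sub_rev]; exact hmain y₂ y₁ h b2 b1 g2 g1

/-- The homeomorphism `F = f ∘ φ` has a limit at each boundary point of the disk. -/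
theorem ConvexHomeo.exists_tendsto {φ F Ψ H K : ℂ → ℂ} {Ω : Set ℂ} (T : ConvexHomeo F Ψ Ω)
    (hφ : DifferentiableOn ℂ φ (ball 0 1))
    (hinj : Set.InjOn φ (ball 0 1)) (hmaps : Set.MapsTo φ (ball 0 1) (ball 0 1))
    (D : Decomp F H K) {C : ℝ} (hC0 : 0 ≤ C)
    (hC : ∀ z ∈ ball (0 : ℂ) 1, ‖deriv H z‖ + ‖deriv K z‖ ≤ C * ‖deriv φ z‖) {ζ : ℂ}
    (hζ : ‖ζ‖ = 1) : ∃ p, Tendsto F (𝓝[ball 0 1] ζ) (𝓝 p) := by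
  obtain ⟨R, hR, hRΩ⟩ := T.exists_norm_bound
  obtain ⟨ρ₀, hρ₀, hball⟩ := Metric.isOpen_iff.mp T.isOpen 0 T.zero_mem
  have hcl : ζ ∈ closure (ball (0 : ℂ) 1) := by
    rw [closure_ball 0 one_ne_zero]; simp [hζ]
  have hne : (𝓝[ball 0 1] ζ).NeBot := mem_closure_iff_nhdsWithin_neBot.mp hcl
  have hcauchy : Cauchy (map F (𝓝[ball 0 1] ζ)) := by
    rw [Metric.cauchy_iff]
    refine ⟨inferInstance, fun η hη => ?_⟩
    set k : ℝ := 1 + R / ρ₀ with hk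
    have hkpos : 0 < k := by positivity
    set ε : ℝ := η / (8 * k) with hε
    have hεpos : 0 < ε := by positivity
    obtain ⟨ρ, hρ0, hρ1, hosc⟩ := exists_crosscut hφ hinj hmaps D hC0 hC hζ hεpos
    -- a point of the crosscut whose image is close to the complement of `Ω`
    have hcut : ∀ r < 1, ∃ z ∈ ball (0 : ℂ) 1, ‖z - ζ‖ = ρ ∧ r < ‖z‖ := by
      intro r hr
      set m : ℝ → ℂ := fun y => ζ * (1 - ρ * cexp (y * I)) with hm
      have hmc : Continuous fun y => ‖m y‖ := by fun_prop
      have h0 : ‖m 0‖ = 1 - ρ := by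
        have : (1 : ℂ) - ρ = ((1 - ρ : ℝ) : ℂ) := by push_cast; ring
        simp only [hm, norm_mul, hζ, one_mul, ofReal_zero, zero_mul, exp_zero, mul_one]
        rw [this, norm_real, Real.norm_of_nonneg (by linarith)]
      have h1 : ‖m Real.pi‖ = 1 + ρ := by
        have : (1 : ℂ) - ρ * -1 = ((1 + ρ : ℝ) : ℂ) := by push_cast; ring
        simp only [hm, norm_mul, hζ, one_mul, exp_pi_mul_I]
        rw [this, norm_real, Real.norm_of_nonneg (by linarith)]
      obtain ⟨v, hv1, hv2⟩ := exists_between (max_lt hr (show 1 - ρ < 1 by linarith))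
      have hv := intermediate_value_Icc Real.pi_pos.le hmc.continuousOn
      obtain ⟨y, -, hy⟩ := hv (show v ∈ Set.Icc ‖m 0‖ ‖m Real.pi‖ by
        rw [h0, h1]
        exact ⟨((le_max_right _ _).trans_lt hv1).le, by linarith⟩)
      simp only at hy
      refine ⟨m y, by simpa [hy] using hv2, ?_, by rw [hy]; exact (le_max_left _ _).trans_lt hv1⟩
      have : m y - ζ = -(ζ * (ρ * cexp (y * I))) := by simp only [hm]; ring
      rw [this, norm_neg, norm_mul, norm_mul, hζ, norm_exp_ofReal_mul_I, norm_real,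
        Real.norm_of_nonneg hρ0.le]
      ring
    obtain ⟨q, hqΩ, z₀, hz₀, hz₀ρ, hq⟩ :
        ∃ q, q ∉ Ω ∧ ∃ z₀ ∈ ball (0 : ℂ) 1, ‖z₀ - ζ‖ = ρ ∧ ‖F z₀ - q‖ ≤ ε := by
      -- τ is chosen so that (1/τ - 1)R = ε: a point of gauge above τ is then within ε of its radial
      -- projection to gauge 1.
      set τ : ℝ := R / (R + ε) with hτ
      have hτ1 : τ < 1 := by rw [hτ, div_lt_one (by positivity)]; linarith
      have hτ0 : 0 < τ := by positivity
      obtain ⟨r, hr, hr'⟩ := T.exists_norm_le_of_gauge_le hτ1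
      obtain ⟨z, hz, hzρ, hzr⟩ := hcut r hr
      have hg : τ < gauge Ω (F z) := by
        by_contra! h
        exact absurd (hr' z hz h) (not_le.mpr hzr)
      set s := gauge Ω (F z) with hs
      have hs0 : 0 < s := hτ0.trans hg
      have hs1 : s < 1 := T.gauge_lt_one_iff.mpr (T.maps hz)
      refine ⟨(s⁻¹ : ℝ) • F z, ?_, z, hz, hzρ, ?_⟩
      · rw [← T.gauge_lt_one_iff, gauge_smul_of_nonneg (by positivity), ← hs, smul_eq_mul,
          inv_mul_cancel₀ hs0.ne']
        exact lt_irrefl _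
      · have h1 : F z - (s⁻¹ : ℝ) • F z = ((1 - s⁻¹ : ℝ)) • F z := by
          rw [sub_smul, one_smul]
        have h2 : 1 < s⁻¹ := (one_lt_inv₀ hs0).mpr hs1
        have h3 : s⁻¹ ≤ τ⁻¹ := inv_anti₀ hτ0 hg.le
        rw [h1, norm_smul, Real.norm_of_nonpos (by linarith)]
        calc -(1 - s⁻¹) * ‖F z‖ ≤ (τ⁻¹ - 1) * R := by
              gcongr
              · linarith
              · linarith
              · exact hRΩ _ (T.maps hz)
          _ = ε := by rw [hτ, inv_div]; field_simp; ring
    -- The segment from F z to 0 pulls back to a path from z, inside the circle |· - ζ| = ρ, to 0,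
    -- outside it because ρ < 1. Where it meets the crosscut its image is within 2ε of q; convexity
    -- carries this closeness to F z itself.
    have hsmall : ∀ z ∈ ball (0 : ℂ) 1, ‖z - ζ‖ < ρ → ‖F z - q‖ ≤ 2 * ε * k := by
      intro z hz hzρ
      have hpΩ := T.maps hz
      have hsegΩ : ∀ s ∈ Set.Icc (0 : ℝ) 1, ((1 - s : ℝ) : ℂ) * F z ∈ Ω := by
        intro s hs
        have := T.convex hpΩ T.zero_mem (show 0 ≤ 1 - s by linarith [hs.2]) hs.1 (by ring)
        simpa using this
      have hc : ContinuousOn (fun s : ℝ => ‖Ψ (((1 - s : ℝ) : ℂ) * F z) - ζ‖) (Set.Icc 0 1) := by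
        refine ((T.cont_inv.comp ?_ hsegΩ).sub continuousOn_const).norm
        exact (by fun_prop : Continuous fun s : ℝ => ((1 - s : ℝ) : ℂ) * F z).continuousOn
      obtain ⟨s, hs, hsρ⟩ := intermediate_value_Icc zero_le_one hc (show ρ ∈ Set.Icc _ _ by
        constructor
        · simp only [sub_zero, ofReal_one, one_mul, T.left_inv z hz]
          exact hzρ.le
        · have h00 : Ψ 0 = 0 := by
            have := T.left_inv 0 (by simp)
            rwa [T.map_zero] at this
          simp [h00, hζ, hρ1.le])
      simp only at hsρ
      have h1 := hosc z₀ hz₀ _ (T.maps_inv (hsegΩ s hs)) hz₀ρ hsρ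
      rw [T.right_inv _ (hsegΩ s hs)] at h1
      refine norm_sub_le_of_convex T.convex hρ₀ hball hRΩ hpΩ hqΩ hs.1 hs.2 ?_
      calc _ = ‖(((1 - s : ℝ) : ℂ) * F z - F z₀) + (F z₀ - q)‖ := by congr 1; ring
        _ ≤ _ := by linarith [norm_add_le (((1 - s : ℝ) : ℂ) * F z - F z₀) (F z₀ - q)]
    refine ⟨F '' (ball 0 1 ∩ ball ζ ρ), image_mem_map (inter_mem self_mem_nhdsWithin
      (mem_nhdsWithin_of_mem_nhds (ball_mem_nhds ζ hρ0))), ?_⟩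
    rintro _ ⟨z, hz, rfl⟩ _ ⟨w, hw, rfl⟩
    have e1 := hsmall z hz.1 (by simpa [dist_eq_norm] using hz.2)
    have e2 := hsmall w hw.1 (by simpa [dist_eq_norm] using hw.2)
    rw [norm_sub_rev] at e2
    have e3 := norm_add_le (F z - q) (q - F w)
    rw [sub_add_sub_cancel] at e3
    rw [dist_eq_norm]
    have e4 : 2 * ε * k = η / 4 := by rw [hε]; field_simp; norm_num
    linarith
  obtain ⟨p, hp⟩ := cauchy_map_iff_exists_tendsto.mp hcauchy
  exact ⟨p, hp⟩

end Energy

/-! ### Boundary values of a linear functional do not interlace -/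

namespace ConvexHomeo

variable {F Ψ : ℂ → ℂ} {Ω : Set ℂ}

lemma gauge_pos_of_ne_zero (T : ConvexHomeo F Ψ Ω) {p : ℂ} (hp : p ≠ 0) : 0 < gauge Ω p := by
  rw [gauge_pos (absorbent_nhds_zero (T.isOpen.mem_nhds T.zero_mem))]
  · exact hp
  · exact (NormedSpace.isVonNBounded_iff ℝ).mpr T.bounded

/-- The part of a boundary layer of a convex domain in an open half-plane not containing the base
point is connected. -/
lemma isPreconnected_layer (T : ConvexHomeo F Ψ Ω) (a : ℂ) {c τ : ℝ} (hc : 0 ≤ c) :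
    IsPreconnected {p | τ < gauge Ω p ∧ gauge Ω p < 1 ∧ c < (a * p).re} := by
  refine isPreconnected_of_forall_pair fun p hp q hq => ?_
  -- The segment stays in the half-plane, hence away from 0. Scaling it radially to the linearly
  -- interpolated gauge `l` keeps it in the layer. The factor is at least 1 by convexity of the
  -- gauge, and c ≥ 0 then keeps the path in the half-plane.
  set x : ℝ → ℂ := fun s => (1 - s) • p + s • q with hx
  set l : ℝ → ℝ := fun s => (1 - s) * gauge Ω p + s * gauge Ω q with hl
  have hxre : ∀ s, (a * x s).re = (1 - s) * (a * p).re + s * (a * q).re := by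
    intro s
    simp only [hx, mul_add, mul_smul_comm, add_re, smul_re, smul_eq_mul]
  have hxc : ∀ s ∈ Set.Icc (0 : ℝ) 1, c < (a * x s).re := by
    intro s hs
    rw [hxre]
    rcases hs.1.eq_or_lt with rfl | h
    · simpa using hp.2.2
    · nlinarith [hp.2.2, hq.2.2, hs.2]
  have hx0 : ∀ s ∈ Set.Icc (0 : ℝ) 1, 0 < gauge Ω (x s) := by
    intro s hs
    apply T.gauge_pos_of_ne_zero
    intro h
    have := hxc s hs
    rw [h] at this
    simp at this
    linarith
  have hgl : ∀ s ∈ Set.Icc (0 : ℝ) 1, gauge Ω (x s) ≤ l s := by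
    intro s hs
    refine (gauge_add_le T.convex (absorbent_nhds_zero (T.isOpen.mem_nhds T.zero_mem)) _ _).trans ?_
    rw [gauge_smul_of_nonneg (by linarith [hs.2]), gauge_smul_of_nonneg hs.1]
    rfl
  have hxcont : Continuous x := by fun_prop
  have hlcont : Continuous l := by fun_prop
  have hcont : ContinuousOn (fun s => (l s / gauge Ω (x s)) • x s) (Set.Icc 0 1) :=
    (hlcont.continuousOn.div (T.continuous_gauge.comp hxcont).continuousOn
      fun s hs => (hx0 s hs).ne').smul hxcont.continuousOn
  refine ⟨(fun s => (l s / gauge Ω (x s)) • x s) '' Set.Icc 0 1, ?_, ⟨0, by simp, ?_⟩,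
    ⟨1, by simp, ?_⟩, isPreconnected_Icc.image _ hcont⟩
  · rintro _ ⟨s, hs, rfl⟩
    have h1 : 1 ≤ l s / gauge Ω (x s) := (one_le_div (hx0 s hs)).mpr (hgl s hs)
    have h2 : gauge Ω ((l s / gauge Ω (x s)) • x s) = l s := by
      rw [gauge_smul_of_nonneg (by linarith), smul_eq_mul, div_mul_cancel₀ _ (hx0 s hs).ne']
    have h3 : τ < l s ∧ l s < 1 := by
      simp only [hl]
      rcases hs.1.eq_or_lt with rfl | h
      · simpa using ⟨hp.1, hp.2.1⟩
      · constructor <;> nlinarith [hp.1, hq.1, hp.2.1, hq.2.1, hs.2]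
    refine ⟨by simpa only [h2] using h3.1, by simpa only [h2] using h3.2, ?_⟩
    have h4 := hxc s hs
    rw [mul_smul_comm, real_smul, re_ofReal_mul]
    nlinarith
  · have h := hx0 0 (by simp)
    simp only [hx, hl, sub_zero, one_smul, zero_smul, add_zero, one_mul, zero_mul] at h ⊢
    rw [div_self h.ne', one_smul]
  · have h := hx0 1 (by simp)
    simp only [hx, hl, sub_self, one_smul, zero_smul, zero_add, one_mul, zero_mul] at h ⊢
    rw [div_self h.ne', one_smul]

end ConvexHomeo

/-- A homeomorphism of the disk onto a convex domain with a continuous extension to the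
closed disk. -/
structure ClosedConvexHomeo (F Fh Ψ : ℂ → ℂ) (Ω : Set ℂ) : Prop extends ConvexHomeo F Ψ Ω where
  cont_ext : ContinuousOn Fh (closedBall 0 1)
  eq_ext : ∀ z ∈ ball (0 : ℂ) 1, Fh z = F z

lemma tendsto_radial {Fh : ℂ → ℂ} (h : ContinuousOn Fh (closedBall 0 1)) {ζ : ℂ} (hζ : ‖ζ‖ = 1) :
    Tendsto (fun s : ℝ => Fh (s * ζ)) (𝓝[<] 1) (𝓝 (Fh ζ)) := by
  have h1 : Tendsto (fun s : ℝ => (s : ℂ) * ζ) (𝓝[<] 1) (𝓝[closedBall 0 1] ζ) := by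
    refine tendsto_nhdsWithin_iff.mpr ⟨?_, ?_⟩
    · have : Tendsto (fun s : ℝ => (s : ℂ) * ζ) (𝓝 1) (𝓝 (((1 : ℝ) : ℂ) * ζ)) :=
        (by fun_prop : Continuous fun s : ℝ => (s : ℂ) * ζ).tendsto 1
      rw [ofReal_one, one_mul] at this
      exact this.mono_left nhdsWithin_le_nhds
    · filter_upwards [Ioo_mem_nhdsLT (zero_lt_one' ℝ)] with s hs
      simp [hζ, abs_of_pos hs.1, hs.2.le]
  exact (h ζ (by simp [hζ])).tendsto.comp h1

lemma radial_mem {ζ : ℂ} (hζ : ‖ζ‖ = 1) :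
    ∀ᶠ s : ℝ in 𝓝[<] 1, (s : ℂ) * ζ ∈ ball (0 : ℂ) 1 ∧ ‖(s : ℂ) * ζ‖ = s ∧ 0 < s := by
  filter_upwards [Ioo_mem_nhdsLT (zero_lt_one' ℝ)] with s hs
  simp [hζ, abs_of_pos hs.1, hs.2, hs.1]

/-- Twice the signed area of the triangle `q`, `z`, `p`, deciding the side of the line `pq` on
which `z` lies. -/
def side (q p z : ℂ) : ℝ := ((z - q) * conj (p - q)).im

/-- A line meets the circle in at most two points: with z = q + k(p - q), unit modulus forces k(k -
1) = 0. -/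
lemma eq_or_eq_of_side_eq_zero {p q z : ℂ} (hp : ‖p‖ = 1) (hq : ‖q‖ = 1) (hz : ‖z‖ = 1)
    (hpq : p ≠ q) (h : side q p z = 0) : z = q ∨ z = p := by
  have hp' : p.re * p.re + p.im * p.im = 1 := by rw [← normSq_apply, normSq_eq_norm_sq, hp]; simp
  have hq' : q.re * q.re + q.im * q.im = 1 := by rw [← normSq_apply, normSq_eq_norm_sq, hq]; simp
  have hz' : z.re * z.re + z.im * z.im = 1 := by rw [← normSq_apply, normSq_eq_norm_sq, hz]; simp
  have hpq' : normSq (p - q) ≠ 0 := by simpa [sub_eq_zero] using hpq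
  set k : ℝ := ((z - q) * conj (p - q)).re / normSq (p - q) with hk
  have h1 : (z - q) * conj (p - q) = (k * normSq (p - q) : ℝ) := by
    apply Complex.ext
    · rw [hk, div_mul_cancel₀ _ hpq']; simp
    · rw [ofReal_im]; exact h
  have hc0 : conj (p - q) ≠ 0 := (map_ne_zero _).mpr (sub_ne_zero.mpr hpq)
  have h2 : z - q = k * (p - q) := by
    apply mul_right_cancel₀ hc0
    rw [h1, mul_assoc, mul_conj]; push_cast; ring
  have hre := congrArg Complex.re h2
  have him := congrArg Complex.im h2
  simp at hre him
  have hre' : z.re = q.re + k * (p.re - q.re) := by linarith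
  have him' : z.im = q.im + k * (p.im - q.im) := by linarith
  have h3 : k * (k - 1) * normSq (p - q) = 0 := by
    rw [normSq_apply, sub_re, sub_im]
    rw [hre', him'] at hz'
    linear_combination hz' + (k - 1) * hq' - k * hp'
  rcases mul_eq_zero.mp ((mul_eq_zero.mp h3).resolve_right hpq') with h4 | h4
  · left
    rw [h4] at h2
    simpa [sub_eq_zero] using h2
  · right
    rw [sub_eq_zero.mp h4] at h2
    simpa using h2

namespace ClosedConvexHomeo

variable {F Fh Ψ : ℂ → ℂ} {Ω : Set ℂ}

/-- Properness of F: along a radius the gauge of the image eventually exceeds every τ < 1. -/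
lemma gauge_ext (T : ClosedConvexHomeo F Fh Ψ Ω) {ζ : ℂ} (hζ : ‖ζ‖ = 1) :
    gauge Ω (Fh ζ) = 1 := by
  have ht := (T.continuous_gauge.tendsto _).comp (tendsto_radial T.cont_ext hζ)
  apply le_antisymm
  · refine le_of_tendsto ht ?_
    filter_upwards [radial_mem hζ] with s hs
    simp only [Function.comp_apply]
    rw [T.eq_ext _ hs.1]
    exact (T.gauge_lt_one_iff.mpr (T.maps hs.1)).le
  · by_contra! h
    obtain ⟨τ, h1, h2⟩ := exists_between h
    obtain ⟨r, hr, hr'⟩ := T.exists_norm_le_of_gauge_le h2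
    obtain ⟨s, hs1, hs2, hs3⟩ := ((ht.eventually (gt_mem_nhds h1)).and
      ((radial_mem hζ).and (Ioo_mem_nhdsLT hr))).exists
    simp only [Function.comp_apply] at hs1
    rw [T.eq_ext _ hs2.1] at hs1
    have := hr' _ hs2.1 hs1.le
    rw [hs2.2.1] at this
    exact absurd hs3.1 (not_lt.mpr this)

/-- Near the boundary of Ω, the part of a thin layer where the functional exceeds c is connected,
and so is its preimage, which lies near the circle. On the preimage Re(m z/|z|) takes the values of
x₁ and x₂, hence also t. Letting the layer shrink gives a point of the circle on the line, still
with functional at least c. -/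
lemma exists_line_of_high (T : ClosedConvexHomeo F Fh Ψ Ω) (a m : ℂ) {c t : ℝ} (hc : 0 ≤ c)
    {x₁ x₂ : ℂ} (h₁ : ‖x₁‖ = 1) (h₂ : ‖x₂‖ = 1) (hx₁ : c < (a * Fh x₁).re)
    (hx₂ : c < (a * Fh x₂).re) (hm₁ : (m * x₁).re < t) (hm₂ : t < (m * x₂).re) :
    ∃ z, ‖z‖ = 1 ∧ (m * z).re = t ∧ c ≤ (a * Fh z).re := by
  have step : ∀ r < 1, ∃ z ∈ ball (0 : ℂ) 1, r < ‖z‖ ∧ 0 < ‖z‖ ∧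
      (m * ((‖z‖⁻¹ : ℝ) * z)).re = t ∧ c < (a * F z).re := by
    intro r hr
    obtain ⟨τ, hτ, hτ'⟩ := T.exists_gauge_le_of_norm_le (max_lt hr (zero_lt_one' ℝ))
    set N := {p | τ < gauge Ω p ∧ gauge Ω p < 1 ∧ c < (a * p).re} with hN
    have hNΩ : N ⊆ Ω := fun p hp => T.gauge_lt_one_iff.mp hp.2.1
    have hpre : IsPreconnected (Ψ '' N) :=
      (T.isPreconnected_layer a hc).image _ (T.cont_inv.mono hNΩ)
    have hmem : ∀ {x : ℂ}, ‖x‖ = 1 → c < (a * Fh x).re → ∃ s : ℝ, 0 < s ∧ ‖(s : ℂ) * x‖ = s ∧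
        (s : ℂ) * x ∈ Ψ '' N := by
      intro x hx hcx
      have ht := tendsto_radial T.cont_ext hx
      have hg := (T.continuous_gauge.tendsto _).comp ht
      rw [T.gauge_ext hx] at hg
      have hre : Tendsto (fun s : ℝ => (a * Fh (s * x)).re) (𝓝[<] 1) (𝓝 (a * Fh x).re) :=
        (continuous_re.tendsto _).comp (ht.const_mul a)
      obtain ⟨s, hs1, hs2, hs3⟩ := ((hg.eventually (lt_mem_nhds hτ)).and
        ((hre.eventually (lt_mem_nhds hcx)).and (radial_mem hx))).exists
      simp only [Function.comp_apply] at hs1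
      rw [T.eq_ext _ hs3.1] at hs1 hs2
      exact ⟨s, hs3.2.2, hs3.2.1, F (s * x),
        ⟨hs1, T.gauge_lt_one_iff.mpr (T.maps hs3.1), hs2⟩, T.left_inv _ hs3.1⟩
    have hnorm : ∀ z ∈ Ψ '' N, z ∈ ball (0 : ℂ) 1 ∧ max r 0 < ‖z‖ ∧ c < (a * F z).re := by
      rintro _ ⟨p, hp, rfl⟩
      have h1 := T.right_inv p (hNΩ hp)
      refine ⟨T.maps_inv (hNΩ hp), ?_, by rw [h1]; exact hp.2.2⟩
      by_contra! h
      have := hτ' _ h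
      rw [h1] at this
      exact absurd hp.1 (not_lt.mpr this)
    have hcont : ContinuousOn (fun z : ℂ => (m * ((‖z‖⁻¹ : ℝ) * z)).re) (Ψ '' N) := by
      have h0 : ∀ z ∈ Ψ '' N, ‖z‖ ≠ 0 := fun z hz =>
        ((le_max_right r 0).trans_lt (hnorm z hz).2.1).ne'
      refine continuous_re.comp_continuousOn (continuousOn_const.mul (ContinuousOn.mul ?_
        continuousOn_id))
      exact continuous_ofReal.comp_continuousOn (continuous_norm.continuousOn.inv₀ h0)
    obtain ⟨s₁, p₁, n₁, e₁⟩ := hmem h₁ hx₁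
    obtain ⟨s₂, p₂, n₂, e₂⟩ := hmem h₂ hx₂
    have hval : ∀ {s : ℝ} {x : ℂ}, 0 < s → ‖(s : ℂ) * x‖ = s →
        (m * ((‖(s : ℂ) * x‖⁻¹ : ℝ) * (s * x))).re = (m * x).re := by
      intro s x hs hn
      rw [hn, ← mul_assoc ((s⁻¹ : ℝ) : ℂ), ← ofReal_mul, inv_mul_cancel₀ hs.ne', ofReal_one, one_mul]
    obtain ⟨z, hz, hzt⟩ := hpre.intermediate_value e₁ e₂ hcont (show t ∈ Set.Icc _ _ by
      rw [hval p₁ n₁, hval p₂ n₂]; exact ⟨hm₁.le, hm₂.le⟩)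
    obtain ⟨k1, k2, k3⟩ := hnorm z hz
    exact ⟨z, k1, (le_max_left r 0).trans_lt k2, (le_max_right r 0).trans_lt k2, hzt, k3⟩
  choose z hzb hzr hz0 hzt hzc using fun n : ℕ => step (1 - 1 / ((n : ℝ) + 1))
    (by have : (0 : ℝ) < 1 / ((n : ℝ) + 1) := by positivity
        linarith)
  obtain ⟨w, hw, σ, hσ, hlim⟩ := (isCompact_closedBall (0 : ℂ) 1).tendsto_subseq
    (fun n => ball_subset_closedBall (hzb n))
  have hnl : Tendsto (fun n => ‖z n‖) atTop (𝓝 1) := by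
    refine tendsto_of_tendsto_of_tendsto_of_le_of_le (g := fun n : ℕ => 1 - 1 / ((n : ℝ) + 1))
      ?_ tendsto_const_nhds (fun n => (hzr n).le) fun n => by simpa using (mem_ball_zero_iff.mp (hzb n)).le
    simpa using (tendsto_const_nhds (x := (1 : ℝ))).sub (tendsto_one_div_add_atTop_nhds_zero_nat (𝕜 := ℝ))
  have hnl' := hnl.comp hσ.tendsto_atTop
  have hw1 : ‖w‖ = 1 := tendsto_nhds_unique hlim.norm hnl'
  refine ⟨w, hw1, ?_, ?_⟩
  · have h1 : Tendsto (fun n => (m * ((‖z (σ n)‖⁻¹ : ℝ) * z (σ n))).re) atTop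
        (𝓝 (m * (((1 : ℝ)⁻¹ : ℝ) * w)).re) := by
      refine (continuous_re.tendsto _).comp (Tendsto.const_mul m (Tendsto.mul ?_ hlim))
      exact (continuous_ofReal.tendsto _).comp (hnl'.inv₀ one_ne_zero)
    simp only [hzt, inv_one, ofReal_one, one_mul] at h1
    exact tendsto_nhds_unique h1 tendsto_const_nhds |>.symm ▸ rfl
  · have h1 : Tendsto (fun n => Fh (z (σ n))) atTop (𝓝 (Fh w)) := by
      refine (T.cont_ext w hw).tendsto.comp (tendsto_nhdsWithin_iff.mpr ⟨hlim, ?_⟩)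
      exact .of_forall fun n => ball_subset_closedBall (hzb _)
    refine ge_of_tendsto ((continuous_re.tendsto _).comp (h1.const_mul a)) (.of_forall fun n => ?_)
    simp only [Function.comp_apply]
    rw [T.eq_ext _ (hzb _)]
    exact (hzc _).le

/-- When the chord from p to q separates x₁ from x₂, the previous lemma gives a boundary point on
the line through p and q with functional at least c. That point is p or q, where the functional is
below c. -/
lemma crossing_aux (T : ClosedConvexHomeo F Fh Ψ Ω) (a : ℂ) {c : ℝ} (hc : 0 ≤ c) {x₁ x₂ p q : ℂ}
    (hx₁ : ‖x₁‖ = 1) (hx₂ : ‖x₂‖ = 1) (hp : ‖p‖ = 1) (hq : ‖q‖ = 1)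
    (h₁ : c < (a * Fh x₁).re) (h₂ : c < (a * Fh x₂).re) (hup : (a * Fh p).re < c)
    (huq : (a * Fh q).re < c) (hs : side q p x₁ * side q p x₂ < 0) : False := by
  wlog hlt : side q p x₁ < 0 generalizing x₁ x₂
  · refine this hx₂ hx₁ h₂ h₁ (by rwa [mul_comm]) ?_
    by_contra! h'
    have := mul_nonneg (not_lt.mp hlt) h'
    linarith
  have hgt : 0 < side q p x₂ := by
    by_contra! h'
    have := mul_nonneg_of_nonpos_of_nonpos hlt.le h'
    linarith
  have hside : ∀ z, side q p z = (-I * conj (p - q) * z).re - (-I * conj (p - q) * q).re := by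
    intro z
    simp only [side, mul_im, mul_re, neg_re, neg_im, I_re, I_im, sub_re, sub_im]
    ring
  obtain ⟨z, hz1, hz2, hz3⟩ := T.exists_line_of_high a (-I * conj (p - q)) hc hx₁ hx₂ h₁ h₂
    (t := (-I * conj (p - q) * q).re) (by linarith [hside x₁]) (by linarith [hside x₂])
  have hpq : p ≠ q := by
    rintro rfl
    simp [side] at hlt
  rcases eq_or_eq_of_side_eq_zero hp hq hz1 hpq (by rw [hside, hz2, sub_self]) with rfl | rfl
  · linarith
  · linarith

/-- High and low boundary values of a linear functional of `Fh` cannot interlace. -/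
lemma crossing (T : ClosedConvexHomeo F Fh Ψ Ω) (a : ℂ) {c : ℝ} {x₁ x₂ p q : ℂ}
    (hx₁ : ‖x₁‖ = 1) (hx₂ : ‖x₂‖ = 1) (hp : ‖p‖ = 1) (hq : ‖q‖ = 1)
    (h₁ : c < (a * Fh x₁).re) (h₂ : c < (a * Fh x₂).re) (hup : (a * Fh p).re < c)
    (huq : (a * Fh q).re < c) (hs : side q p x₁ * side q p x₂ < 0)
    (hs' : side x₂ x₁ p * side x₂ x₁ q < 0) : False := by
  -- The layer argument needs a half-plane that misses 0, i.e. c ≥ 0. For c ≤ 0, negating a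
  -- exchanges high and low values.
  rcases le_total 0 c with hc | hc
  · exact T.crossing_aux a hc hx₁ hx₂ hp hq h₁ h₂ hup huq hs
  · refine T.crossing_aux (-a) (c := -c) (by linarith) hp hq hx₁ hx₂ ?_ ?_ ?_ ?_ hs' <;>
      simp only [neg_mul, neg_re] <;> linarith

end ClosedConvexHomeo

/-! ### The half-plane inequality for images with a continuous normal -/

lemma nonneg_of_harmonicContOnCl {v : ℂ → ℝ} (hv : HarmonicContOnCl v (ball 0 1))
    (h : ∀ z : ℂ, ‖z‖ = 1 → 0 ≤ v z) : ∀ w ∈ ball (0 : ℂ) 1, 0 ≤ v w := by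
  intro w hw
  rw [← hv.circleAverage_poissonKernel_smul hw]
  apply Real.circleAverage_nonneg_of_nonneg
  intro z hz
  have hz1 : ‖z‖ = 1 := by simpa using hz
  have hw1 : ‖w‖ < 1 := by simpa using hw
  have h2 := h z hz1
  simp only [Pi.smul_apply', poissonKernel_def, sub_zero, smul_eq_mul, hz1]
  have : 0 ≤ 1 ^ 2 - ‖w‖ ^ 2 := by nlinarith [norm_nonneg w]
  positivity

lemma nonneg_of_hasDerivAt_of_le {k : ℝ → ℝ} {k' : ℝ} (h : HasDerivAt k k' 0)
    (hk : ∀ s, 0 < s → s < 1 → k 0 ≤ k s) : 0 ≤ k' := by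
  have h1 : Tendsto (slope k 0) (𝓝[>] 0) (𝓝 k') :=
    (hasDerivAt_iff_tendsto_slope.mp h).mono_left
      (nhdsWithin_mono _ fun x hx => (Set.mem_Ioi.mp hx).ne')
  refine ge_of_tendsto h1 ?_
  filter_upwards [Ioo_mem_nhdsGT (zero_lt_one' ℝ)] with s hs
  rw [slope_def_field]
  exact div_nonneg (by linarith [hk s hs.1 hs.2]) (by linarith [hs.1])

lemma conj_mul_self_of_norm_one {a : ℂ} (ha : ‖a‖ = 1) : conj a * a = 1 := by
  rw [mul_comm, mul_conj, normSq_eq_norm_sq, ha]; simp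

lemma mul_conj_self_of_norm_one {a : ℂ} (ha : ‖a‖ = 1) : a * conj a = 1 := by
  rw [mul_conj, normSq_eq_norm_sq, ha]; simp

lemma eq_or_eq_neg_of_im_eq_zero {a b : ℂ} (ha : ‖a‖ = 1) (hb : ‖b‖ = 1)
    (h : (conj a * b).im = 0) : b = a ∨ b = -a := by
  have h1 : conj a * b = ((conj a * b).re : ℝ) := by
    apply Complex.ext <;> simp [h]
  set r := (conj a * b).re
  have h2 : b = r * a := by
    rw [← h1]
    linear_combination -b * conj_mul_self_of_norm_one ha
  have h3 : |r| = 1 := by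
    have := congrArg norm h2
    rw [hb, norm_mul, ha, mul_one, norm_real, Real.norm_eq_abs] at this
    exact this.symm
  rcases eq_or_eq_neg_of_abs_eq h3 with h4 | h4
  · left; rw [h2, h4]; simp
  · right; rw [h2, h4]; simp

lemma norm_mobius_eq_one {c z : ℂ} (hc : ‖c‖ < 1) (hz : ‖z‖ = 1) : ‖mobius c z‖ = 1 := by
  have h0 := norm_pos_iff.mpr (one_sub_conj_mul_ne_zero hc hz.le)
  rw [mobius, norm_div, div_eq_one_iff_eq h0.ne']
  have h1 := normSq_one_sub_conj_mul c z
  rw [hz] at h1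
  have h2 : ‖z - c‖ ^ 2 = ‖1 - conj c * z‖ ^ 2 := by linarith
  exact (pow_left_inj₀ (norm_nonneg _) (norm_nonneg _) two_ne_zero).mp h2

namespace ClosedConvexHomeo

variable {F Fh Ψ : ℂ → ℂ} {Ω : Set ℂ}

lemma continuous_circle (T : ClosedConvexHomeo F Fh Ψ Ω) :
    Continuous fun θ : ℝ => Fh (cexp (θ * I)) :=
  T.cont_ext.comp_continuous (by fun_prop) fun θ => by simp [norm_exp_ofReal_mul_I]

lemma re_le_of_support (T : ClosedConvexHomeo F Fh Ψ Ω) {a : ℂ} {M : ℝ}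
    (h : ∀ p ∈ Ω, (a * p).re ≤ M) {x : ℂ} (hx : ‖x‖ = 1) : (a * Fh x).re ≤ M := by
  have ht : Tendsto (fun s : ℝ => (a * Fh (s * x)).re) (𝓝[<] 1) (𝓝 (a * Fh x).re) :=
    (continuous_re.tendsto _).comp ((tendsto_radial T.cont_ext hx).const_mul a)
  refine le_of_tendsto ht ?_
  filter_upwards [radial_mem hx] with s hs
  rw [T.eq_ext _ hs.1]
  exact h _ (T.maps hs.1)

/-- If the image domain has a continuous field `n` of unit outward normals, then some linear
functional attains its maximum and minimum over the boundary at antipodal points of the circle. -/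
lemma exists_antipodal (T : ClosedConvexHomeo F Fh Ψ Ω) {n : ℂ → ℂ}
    (hn : ContinuousOn n {p | gauge Ω p = 1}) (hn1 : ∀ p, gauge Ω p = 1 → ‖n p‖ = 1)
    (hsupp : ∀ p, gauge Ω p = 1 → ∀ q ∈ Ω, (conj (n p) * q).re ≤ (conj (n p) * p).re) :
    ∃ a b : ℂ, ‖a‖ = 1 ∧ ‖b‖ = 1 ∧ ∀ x : ℂ, ‖x‖ = 1 →
      (a * Fh x).re ≤ (a * Fh b).re ∧ (a * Fh (-b)).re ≤ (a * Fh x).re := by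
  have hN1 : ∀ {x : ℂ}, ‖x‖ = 1 → ‖n (Fh x)‖ = 1 := fun hx => hn1 _ (T.gauge_ext hx)
  have hNs : ∀ {x y : ℂ}, ‖x‖ = 1 → ‖y‖ = 1 →
      (conj (n (Fh x)) * Fh y).re ≤ (conj (n (Fh x)) * Fh x).re := fun hx hy =>
    T.re_le_of_support (hsupp _ (T.gauge_ext hx)) hy
  set N : ℝ → ℂ := fun θ => n (Fh (cexp (θ * I))) with hN
  have hNc : Continuous N := hn.comp_continuous T.continuous_circle fun θ =>
    T.gauge_ext (norm_exp_ofReal_mul_I θ)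
  -- k(π) = -k(0), so k vanishes somewhere; there the normals at two antipodal points are parallel.
  set k : ℝ → ℝ := fun θ => (conj (N θ) * N (θ + Real.pi)).im with hk
  have hkc : Continuous k := by fun_prop
  have hper : N (Real.pi + Real.pi) = N 0 := by
    have h1 : ((Real.pi + Real.pi : ℝ) : ℂ) * I = 2 * Real.pi * I := by push_cast; ring
    have h2 : cexp (((Real.pi + Real.pi : ℝ) : ℂ) * I) = cexp (((0 : ℝ) : ℂ) * I) := by
      rw [h1, exp_two_pi_mul_I]; simp
    simp only [hN, h2]
  have hanti : k Real.pi = -k 0 := by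
    simp only [hk, hper, zero_add, mul_im, conj_re, conj_im]
    ring
  obtain ⟨θ, -, hθ⟩ : ∃ θ ∈ Set.uIcc 0 Real.pi, k θ = 0 := by
    apply intermediate_value_uIcc hkc.continuousOn
    rw [hanti, Set.mem_uIcc]
    rcases le_total 0 (k 0) with h | h
    · right; constructor <;> linarith
    · left; constructor <;> linarith
  set ζ : ℂ := cexp (θ * I) with hζ
  have hζ1 : ‖ζ‖ = 1 := norm_exp_ofReal_mul_I θ
  have hζ1' : ‖-ζ‖ = 1 := by rwa [norm_neg]
  have hζ' : cexp ((θ + Real.pi : ℝ) * I) = -ζ := by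
    push_cast
    rw [add_mul, exp_add, exp_pi_mul_I, mul_neg_one]
  have hcase : n (Fh (-ζ)) = n (Fh ζ) ∨ n (Fh (-ζ)) = -n (Fh ζ) := by
    apply eq_or_eq_neg_of_im_eq_zero (hN1 hζ1) (hN1 hζ1')
    rw [← hζ']
    exact hθ
  set a := conj (n (Fh ζ)) with ha
  have ha1 : ‖a‖ = 1 := by rw [ha, norm_conj]; exact hN1 hζ1
  rcases hcase with hc | hc
  · -- both `ζ` and `-ζ` are maximum points
    have hmax : ∀ x : ℂ, ‖x‖ = 1 → (a * Fh x).re ≤ (a * Fh ζ).re := fun x hx => hNs hζ1 hx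
    have hmax' : ∀ x : ℂ, ‖x‖ = 1 → (a * Fh x).re ≤ (a * Fh (-ζ)).re := by
      intro x hx
      have := hNs hζ1' hx
      rwa [hc] at this
    have heq : (a * Fh (-ζ)).re = (a * Fh ζ).re := le_antisymm (hmax _ hζ1') (hmax' _ hζ1)
    obtain ⟨η, hη, hmin⟩ := (isCompact_sphere (0 : ℂ) 1).exists_isMinOn
      (NormedSpace.sphere_nonempty.mpr zero_le_one)
      (f := fun x => (a * Fh x).re)
      (continuous_re.comp_continuousOn (continuousOn_const.mul
        (T.cont_ext.mono sphere_subset_closedBall)))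
    have hη1 : ‖η‖ = 1 := by simpa using hη
    have hη1' : ‖-η‖ = 1 := by rwa [norm_neg]
    refine ⟨a, -η, ha1, hη1', fun x hx => ⟨?_, ?_⟩⟩
    · refine (hmax x hx).trans ?_
      -- Otherwise both η and -η lie strictly below the common maximum at ±ζ, and the two antipodal
      -- pairs alternate on the circle.
      by_contra! hlt
      have hηle : (a * Fh η).re ≤ (a * Fh (-η)).re := hmin (show -η ∈ sphere (0 : ℂ) 1 by simpa using hη1)
      obtain ⟨c, hc1, hc2⟩ := exists_between hlt
      have hne1 : ζ ≠ η := by rintro rfl; linarith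
      have hne2 : ζ ≠ -η := by intro h; rw [h] at hc2; linarith
      have hD : (ζ * conj η).im ≠ 0 := by
        intro h
        rcases eq_or_eq_neg_of_im_eq_zero hη1 hζ1 (by rwa [mul_comm]) with h' | h'
        · exact hne1 h'
        · exact hne2 h'
      have e1 : side (-η) η ζ * side (-η) η (-ζ) = -(2 * (ζ * conj η).im) ^ 2 := by
        simp only [side, sub_neg_eq_add, map_add, mul_im, add_re, add_im, conj_re, conj_im, neg_re,
          neg_im]
        ring
      have e2 : side (-ζ) ζ η * side (-ζ) ζ (-η) = -(2 * (ζ * conj η).im) ^ 2 := by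
        simp only [side, sub_neg_eq_add, map_add, mul_im, add_re, add_im, conj_re, conj_im, neg_re,
          neg_im]
        ring
      have e3 : 0 < (2 * (ζ * conj η).im) ^ 2 := by positivity
      exact T.crossing a (c := c) hζ1 hζ1' hη1 hη1' hc2 (heq ▸ hc2) (by linarith) hc1
        (by rw [e1]; linarith) (by rw [e2]; linarith)
    · rw [neg_neg]
      exact hmin (show x ∈ sphere (0 : ℂ) 1 by simpa using hx)
  · refine ⟨a, ζ, ha1, hζ1, fun x hx => ⟨hNs hζ1 hx, ?_⟩⟩
    have := hNs hζ1' hx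
    rw [hc, map_neg, neg_mul, neg_mul, neg_re, neg_re] at this
    linarith

/-- Monotonicity of the boundary function along the arcs joining antipodal extreme points. -/
lemma monotone_of_extreme (T : ClosedConvexHomeo F Fh Ψ Ω) {a b : ℂ} (hb : ‖b‖ = 1)
    (hext : ∀ x : ℂ, ‖x‖ = 1 → (a * Fh x).re ≤ (a * Fh b).re ∧ (a * Fh (-b)).re ≤ (a * Fh x).re)
    {s : ℝ} (hs0 : 0 < s) (hs1 : s < 1) {x : ℂ} (hx : ‖x‖ = 1) :
    (a * Fh x).re ≤ (a * Fh (b * mobius (-(s : ℂ)) (conj b * x))).re := by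
  have hsn : ‖-(s : ℂ)‖ < 1 := by rwa [norm_neg, norm_real, Real.norm_of_nonneg hs0.le]
  -- Rotate so that the fixed points are ±1. Then y = (w + s)/(1 + sw) is w moved towards 1 along
  -- its arc.
  set w : ℂ := conj b * x with hw
  have hw1 : ‖w‖ = 1 := by rw [hw, norm_mul, norm_conj, hb, hx, one_mul]
  have hbb := mul_conj_self_of_norm_one hb
  have hxw : x = b * w := by rw [hw, ← mul_assoc, hbb, one_mul]
  set y : ℂ := mobius (-(s : ℂ)) w with hy
  have hy1 : ‖y‖ = 1 := norm_mobius_eq_one hsn hw1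
  have hden : 1 + (s : ℂ) * w ≠ 0 := by
    have := one_sub_conj_mul_ne_zero hsn hw1.le
    simpa using this
  have hyv : y = (w + s) / (1 + s * w) := by simp [hy, mobius]
  by_contra! hlt
  obtain ⟨c, hc1, hc2⟩ := exists_between hlt
  have hwre : w.re * w.re + w.im * w.im = 1 := by
    rw [← normSq_apply, normSq_eq_norm_sq, hw1]; simp
  have hnsq : 0 < normSq (1 + s * w) := normSq_pos.mpr hden
  -- The fixed points w = ±1 are excluded because the functional is assumed to drop strictly from w
  -- to y.
  have him : w.im ≠ 0 := by
    intro h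
    have h1 : w = 1 ∨ w = -1 := by
      have := eq_or_eq_neg_of_im_eq_zero (a := 1) (b := w) (by simp) hw1 (by simpa using h)
      exact this
    have h2 : y = w := by
      rcases h1 with h1 | h1 <;> rw [hyv, h1]
      · rw [h1] at hden
        rw [div_eq_iff hden]; ring
      · rw [h1] at hden
        rw [div_eq_iff hden]; ring
    rw [h2, ← hxw] at hlt
    exact lt_irrefl _ hlt
  have hside : ∀ p q z : ℂ, side (b * q) (b * p) (b * z) = side q p z := by
    intro p q z
    simp only [side, ← mul_sub, map_mul]
    congr 1
    linear_combination (z - q) * (conj (p - q)) * hbb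
  have d1 : y + 1 = (1 + s) * (1 + w) / (1 + s * w) := by
    rw [hyv, eq_div_iff hden, add_mul, div_mul_cancel₀ _ hden]; ring
  have d2 : y - 1 = (1 - s) * (w - 1) / (1 + s * w) := by
    rw [hyv, eq_div_iff hden, sub_mul, div_mul_cancel₀ _ hden]; ring
  have hinvim : ((1 + s * w)⁻¹).im = -(s * w.im) / normSq (1 + s * w) := by
    rw [inv_im]; simp
  have hyim : y.im = (1 - s ^ 2) * w.im / normSq (1 + s * w) := by
    rw [hyv, div_im]
    simp
    field_simp
    ring
  have s1 : side (-1) y w = normSq (1 + w) * (1 + s) * (s * w.im) / normSq (1 + s * w) := by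
    have : (w - -1) * conj (y - -1) =
        ((normSq (1 + w) * (1 + s) : ℝ) : ℂ) * conj ((1 + s * w)⁻¹) := by
      rw [sub_neg_eq_add, sub_neg_eq_add, d1, div_eq_mul_inv, map_mul, map_mul]
      push_cast
      rw [← mul_conj]
      simp only [map_add, map_one, conj_ofReal]
      ring
    rw [side, this, im_ofReal_mul, conj_im, hinvim]
    ring
  have s2 : side (-1) y 1 = -2 * y.im := by
    simp only [side, sub_neg_eq_add, map_add, map_one, mul_im, add_re, add_im, conj_re, conj_im,
      one_re, one_im]
    ring
  have s3 : side 1 w y = -(normSq (w - 1) * (1 - s) * (s * w.im)) / normSq (1 + s * w) := by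
    have : (y - 1) * conj (w - 1) =
        ((normSq (w - 1) * (1 - s) : ℝ) : ℂ) * (1 + s * w)⁻¹ := by
      rw [d2, div_eq_mul_inv]
      push_cast
      rw [← mul_conj]
      ring
    rw [side, this, im_ofReal_mul, hinvim]
    ring
  have s4 : side 1 w (-1) = 2 * w.im := by
    simp [side]
    ring
  have hw0 : 0 < normSq (1 + w) := by
    apply normSq_pos.mpr
    intro h
    apply him
    rw [eq_neg_of_add_eq_zero_right h]; simp
  have hw0' : 0 < normSq (w - 1) := by
    apply normSq_pos.mpr
    intro h
    apply him
    rw [sub_eq_zero.mp h]; simp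
  have him2 : 0 < w.im ^ 2 := by positivity
  have hs2 : 0 < 1 - s ^ 2 := by nlinarith
  have hs3 : 0 < 1 - s := by linarith
  have hb1 : b * 1 = b := mul_one b
  have hbm : b * (-1) = -b := by ring
  -- A drop would make x and b high and the moved point and -b low; these pairs alternate, as the
  -- four signed areas show.
  refine T.crossing a (c := c) (x₁ := b * w) (x₂ := b * 1) (p := b * y) (q := b * (-1))
    (by simp [hb, hw1]) (by simp [hb]) (by simp [hb, hy1]) (by simp [hb]) ?_ ?_ hc1 ?_ ?_ ?_
  · rw [← hxw]; exact hc2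
  · rw [hb1]
    exact hc2.trans_le (hext x hx).1
  · rw [hbm]
    exact lt_of_le_of_lt (hext _ (by simp [hb, hy1])).2 hc1
  · rw [hside, hside, s1, s2, hyim]
    have : normSq (1 + w) * (1 + s) * (s * w.im) / normSq (1 + s * w) *
        (-2 * ((1 - s ^ 2) * w.im / normSq (1 + s * w))) =
        -(2 * normSq (1 + w) * (1 + s) * s * (1 - s ^ 2) * w.im ^ 2 /
          (normSq (1 + s * w) * normSq (1 + s * w))) := by field_simp
    rw [this, neg_lt_zero]
    positivity
  · rw [hside, hside, s3, s4]
    have : -(normSq (w - 1) * (1 - s) * (s * w.im)) / normSq (1 + s * w) * (2 * w.im) =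
        -(2 * normSq (w - 1) * (1 - s) * s * w.im ^ 2 / normSq (1 + s * w)) := by field_simp
    rw [this, neg_lt_zero]
    positivity

/-- The Clunie–Sheil-Small half-plane inequality on a domain with smooth convex image. -/
theorem exists_halfplane (T : ClosedConvexHomeo F Fh Ψ Ω) {H K : ℂ → ℂ} (D : Decomp F H K)
    {n : ℂ → ℂ} (hn : ContinuousOn n {p | gauge Ω p = 1}) (hn1 : ∀ p, gauge Ω p = 1 → ‖n p‖ = 1)
    (hsupp : ∀ p, gauge Ω p = 1 → ∀ q ∈ Ω, (conj (n p) * q).re ≤ (conj (n p) * p).re) :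
    ∃ a b : ℂ, ‖a‖ = 1 ∧ ‖b‖ = 1 ∧ ∀ z ∈ ball (0 : ℂ) 1,
      0 ≤ ((a * deriv H z + conj a * deriv K z) * (b - conj b * z ^ 2)).re := by
  obtain ⟨a, b, ha, hb, hext⟩ := T.exists_antipodal hn hn1 hsupp
  refine ⟨a, b, ha, hb, ?_⟩
  have hbb := mul_conj_self_of_norm_one hb
  -- Re(a F) is the real part of this analytic function, since Re(a conj K) = Re(conj a K).
  set A : ℂ → ℂ := fun z => a * H z + conj a * K z with hA
  have hAd : DifferentiableOn ℂ A (ball 0 1) := by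
    have h1 := D.h_diff
    have h2 := D.g_diff
    fun_prop
  have hAre : ∀ z ∈ ball (0 : ℂ) 1, (a * Fh z).re = (A z).re := by
    intro z hz
    rw [T.eq_ext z hz, D.eq z hz]
    simp only [hA, mul_re, add_re, add_im, conj_re, conj_im]
    ring
  have hAderiv : ∀ z ∈ ball (0 : ℂ) 1,
      HasDerivAt A (a * deriv H z + conj a * deriv K z) z := fun z hz =>
    ((D.hasDerivAt_h hz).const_mul a).add ((D.hasDerivAt_g hz).const_mul (conj a))
  -- Hyperbolic automorphisms fixing ±b, with velocity b - conj b z² at s = 0.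
  set S : ℝ → ℂ → ℂ := fun s z => b * mobius (-(s : ℂ)) (conj b * z) with hS
  have hnorm : ∀ z : ℂ, ‖conj b * z‖ = ‖z‖ := fun z => by rw [norm_mul, norm_conj, hb, one_mul]
  have hle : ∀ s : ℝ, 0 < s → s < 1 → ∀ z ∈ ball (0 : ℂ) 1, (A z).re ≤ (A (S s z)).re := by
    intro s hs0 hs1 z hz
    have hsn : ‖-(s : ℂ)‖ < 1 := by rwa [norm_neg, norm_real, Real.norm_of_nonneg hs0.le]
    have hSball : ∀ z ∈ ball (0 : ℂ) 1, S s z ∈ ball (0 : ℂ) 1 := by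
      intro z hz
      have : ‖conj b * z‖ < 1 := by rw [hnorm]; simpa using hz
      simpa [hS, hb] using norm_mobius_lt hsn this
    have hSsph : ∀ z : ℂ, ‖z‖ = 1 → ‖S s z‖ = 1 := by
      intro z hz
      have : ‖conj b * z‖ = 1 := by rw [hnorm, hz]
      simpa [hS, hb] using norm_mobius_eq_one hsn this
    have hScb : Set.MapsTo (S s) (closedBall 0 1) (closedBall 0 1) := by
      intro z hz
      rcases (mem_closedBall_zero_iff.mp hz).lt_or_eq with h | h
      · exact ball_subset_closedBall (hSball z (by simpa using h))
      · simp [hSsph z h]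
    have hSd : ∀ z ∈ closedBall (0 : ℂ) 1, DifferentiableAt ℂ (S s) z := by
      intro z hz
      have h1 : ‖conj b * z‖ ≤ 1 := by rw [hnorm]; simpa using hz
      have h2 : DifferentiableAt ℂ (fun z : ℂ => conj b * z) z := by fun_prop
      exact ((hasDerivAt_mobius hsn h1).differentiableAt.comp z h2).const_mul b
    have hv : HarmonicContOnCl (fun z => (a * Fh (S s z)).re - (a * Fh z).re) (ball 0 1) := by
      constructor
      · have hB : AnalyticOnNhd ℂ (fun z => A (S s z) - A z) (ball 0 1) := by
          apply DifferentiableOn.analyticOnNhd _ isOpen_ball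
          refine (hAd.comp ?_ hSball).sub hAd
          exact fun z hz => (hSd z (ball_subset_closedBall hz)).differentiableWithinAt
        intro z hz
        have h1 := (hB z hz).harmonicAt_re
        refine (harmonicAt_congr_nhds ?_).mp h1
        filter_upwards [isOpen_ball.mem_nhds hz] with w hw
        rw [hAre w hw, hAre _ (hSball w hw), sub_re]
      · rw [closure_ball _ one_ne_zero]
        have hSc : ContinuousOn (S s) (closedBall 0 1) := fun z hz =>
          (hSd z hz).continuousAt.continuousWithinAt
        refine ContinuousOn.sub ?_ ?_
        · exact continuous_re.comp_continuousOn
            (continuousOn_const.mul (T.cont_ext.comp hSc hScb))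
        · exact continuous_re.comp_continuousOn (continuousOn_const.mul T.cont_ext)
    have h1 := nonneg_of_harmonicContOnCl hv (fun x hx =>
      sub_nonneg.mpr (T.monotone_of_extreme hb hext hs0 hs1 hx)) z hz
    rw [hAre z hz, hAre _ (hSball z hz)] at h1
    linarith
  intro z hz
  set w := conj b * z with hw
  have hS0 : S 0 z = z := by
    simp only [hS, mobius, ofReal_zero, neg_zero, sub_zero, map_zero, zero_mul, div_one]
    rw [← mul_assoc, hbb, one_mul]
  have hSder : HasDerivAt (fun s : ℝ => S s z) (b - conj b * z ^ 2) 0 := by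
    have h1 : HasDerivAt (fun s : ℂ => b * ((w + s) / (1 + s * w))) (b * (1 - w ^ 2)) ((0 : ℝ) : ℂ) := by
      have e1 : HasDerivAt (fun s : ℂ => w + s) 1 ((0 : ℝ) : ℂ) := by
        simpa using (hasDerivAt_id ((0 : ℝ) : ℂ)).const_add w
      have e2 : HasDerivAt (fun s : ℂ => 1 + s * w) w ((0 : ℝ) : ℂ) := by
        simpa using ((hasDerivAt_id ((0 : ℝ) : ℂ)).mul_const w).const_add 1
      convert! (e1.div e2 (by simp)).const_mul b using 1
      simp [-mul_eq_mul_left_iff]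
      ring
    have h2 := h1.comp_ofReal
    have e : b * (1 - w ^ 2) = b - conj b * z ^ 2 := by
      rw [hw]
      linear_combination -(conj b) * z ^ 2 * hbb
    rw [e] at h2
    refine h2.congr_of_eventuallyEq (.of_forall fun s => ?_)
    simp [hS, mobius, hw]
  have hcomp : HasDerivAt (fun s : ℝ => (A (S s z)).re)
      ((a * deriv H z + conj a * deriv K z) * (b - conj b * z ^ 2)).re 0 := by
    have h1 := (hAderiv z hz)
    rw [← hS0] at h1
    have h2 := h1.comp (0 : ℝ) hSder
    rw [hS0] at h2
    exact reCLM.hasFDerivAt.comp_hasDerivAt (0 : ℝ) h2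
  refine nonneg_of_hasDerivAt_of_le hcomp fun s hs0 hs1 => ?_
  rw [hS0]
  exact hle s hs0 hs1 z hz

end ClosedConvexHomeo

/-! ### Approximation by parallel bodies and passage to the limit -/

/-- The outer unit normal field of an open parallel body of a compact convex set. -/
lemma exists_normal_field {K : Set ℂ} (hK : IsCompact K) (hc : Convex ℝ K) (h0 : 0 ∈ K) {ε : ℝ}
    (hε : 0 < ε) :
    ∃ n : ℂ → ℂ, ContinuousOn n {p | gauge (thickening ε K) p = 1} ∧
      (∀ p, gauge (thickening ε K) p = 1 → ‖n p‖ = 1) ∧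
      ∀ p, gauge (thickening ε K) p = 1 → ∀ q ∈ thickening ε K,
        (conj (n p) * q).re ≤ (conj (n p) * p).re := by
  have hne : K.Nonempty := ⟨0, h0⟩
  have hre : ∀ x y : ℂ, inner ℝ x y = (conj x * y).re := fun x y => by
    rw [Complex.inner, mul_comm]
  -- v is the nearest-point projection onto K. It is 1-Lipschitz, so (p - v p)/ε is a continuous
  -- candidate for the normal.
  choose v hvK hv using fun p => hK.exists_infDist_eq_dist hne p
  have hproj : ∀ p, ∀ k ∈ K, inner ℝ (p - v p) (k - v p) ≤ 0 := by
    intro p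
    apply (norm_eq_iInf_iff_real_inner_le_zero hc (hvK p)).mp
    rw [← dist_eq_norm, ← hv p, infDist_eq_iInf]
    simp only [dist_eq_norm]
  have hlip : LipschitzWith 1 v := by
    refine LipschitzWith.of_dist_le_mul fun p q => ?_
    have h1 := hproj p (v q) (hvK q)
    have h2 := hproj q (v p) (hvK p)
    rw [dist_eq_norm, dist_eq_norm, NNReal.coe_one, one_mul]
    have h3 : ‖v p - v q‖ * ‖v p - v q‖ ≤ ‖p - q‖ * ‖v p - v q‖ := by
      refine le_trans ?_ (real_inner_le_norm (p - q) (v p - v q))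
      rw [← real_inner_self_eq_norm_mul_norm]
      simp only [hre, mul_re, conj_re, conj_im, sub_re, sub_im] at h1 h2 ⊢
      nlinarith
    by_contra! hlt
    have h4 : 0 < ‖v p - v q‖ := (norm_nonneg _).trans_lt hlt
    nlinarith
  have hΩo : IsOpen (thickening ε K) := isOpen_thickening
  have hΩc : Convex ℝ (thickening ε K) := hc.thickening ε
  have hΩ0 : (0 : ℂ) ∈ thickening ε K := self_subset_thickening hε K h0
  have hlt : ∀ p, gauge (thickening ε K) p < 1 ↔ p ∈ thickening ε K := fun p => by
    rw [← Set.ext_iff.mp (setOfPred_gauge_lt_one_eq_self_of_isOpen hΩc hΩ0 hΩo) p]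
    rfl
  have hdist : ∀ p, gauge (thickening ε K) p = 1 → ‖p - v p‖ = ε := by
    intro p hp
    rw [← dist_eq_norm, ← hv p]
    apply le_antisymm
    · have h1 : Tendsto (fun s : ℝ => infDist ((s : ℂ) * p) K) (𝓝[<] 1) (𝓝 (infDist p K)) := by
        have : Continuous fun s : ℝ => infDist ((s : ℂ) * p) K := by fun_prop
        simpa using (this.tendsto 1).mono_left nhdsWithin_le_nhds
      refine le_of_tendsto h1 ?_
      filter_upwards [Ioo_mem_nhdsLT (show (0 : ℝ) < 1 by norm_num)] with s hs
      apply le_of_lt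
      rw [← mem_thickening_iff_infDist_lt hne, ← hlt, ← real_smul,
        gauge_smul_of_nonneg hs.1.le, hp]
      simpa using hs.2
    · by_contra! h
      rw [← mem_thickening_iff_infDist_lt hne, ← hlt, hp] at h
      exact lt_irrefl _ h
  refine ⟨fun p => (p - v p) / (ε : ℂ), ?_, ?_, ?_⟩
  · have := hlip.continuous
    exact Continuous.continuousOn (by fun_prop)
  · intro p hp
    rw [norm_div, hdist p hp, norm_real, Real.norm_of_nonneg hε.le, div_self hε.ne']
  · intro p hp q hq
    obtain ⟨k, hk, hqk⟩ := mem_thickening_iff.mp hq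
    have h1 : inner ℝ (p - v p) (q - k) ≤ ε * ε := by
      refine (real_inner_le_norm _ _).trans ?_
      rw [hdist p hp, ← dist_eq_norm]
      exact mul_le_mul_of_nonneg_left hqk.le hε.le
    have h2 := hproj p k hk
    have h3 : inner ℝ (p - v p) (p - v p) = ε * ε := by
      rw [real_inner_self_eq_norm_mul_norm, hdist p hp]
    have h4 : ∀ w : ℂ, (conj ((p - v p) / (ε : ℂ)) * w).re = inner ℝ (p - v p) w / ε := by
      intro w
      rw [hre, map_div₀, conj_ofReal, div_mul_eq_mul_div, div_ofReal_re]
    rw [h4, h4]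
    apply div_le_div_of_nonneg_right _ hε.le
    simp only [inner_sub_right] at h1 h2 h3
    linarith

namespace IsKH0

variable {f h g : ℂ → ℂ}

/-- The real derivative w ↦ h'w + conj(g'w) is injective because |g'| < |h'|, so f is open by the
inverse function theorem. -/
lemma Parts.map_nhds (D : Parts f h g) {z : ℂ} (hz : z ∈ ball (0 : ℂ) 1) :
    map f (𝓝 z) = 𝓝 (f z) := by
  have hh := ((D.h_diff.analyticAt (isOpen_ball.mem_nhds hz)).hasStrictDerivAt).hasStrictFDerivAt.restrictScalars ℝ
  have hg := ((D.g_diff.analyticAt (isOpen_ball.mem_nhds hz)).hasStrictDerivAt).hasStrictFDerivAt.restrictScalars ℝ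
  have h3 := (conjCLE : ℂ →L[ℝ] ℂ).hasStrictFDerivAt.comp z hg
  have h4 := (hh.add h3).congr_of_eventuallyEq (D.eventuallyEq hz).symm
  refine h4.map_nhds_eq_of_surj ?_
  rw [LinearMap.range_eq_top, ← LinearMap.injective_iff_surjective, injective_iff_map_eq_zero]
  intro w hw
  have hw' : w * deriv h z + conj (w * deriv g z) = 0 := by simpa using hw
  by_contra hw0
  have h5 : ‖w * deriv h z‖ = ‖w * deriv g z‖ := by
    rw [eq_neg_of_add_eq_zero_left hw', norm_neg, Complex.norm_conj]
  rw [norm_mul, norm_mul] at h5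
  exact (D.dilatation z hz).ne (mul_left_cancel₀ (norm_ne_zero_iff.mpr hw0) h5).symm

lemma Parts.isOpen_image (D : Parts f h g) {V : Set ℂ} (hV : IsOpen V) (hsub : V ⊆ ball 0 1) :
    IsOpen (f '' V) := by
  rw [isOpen_iff_mem_nhds]
  rintro _ ⟨z, hz, rfl⟩
  rw [← D.map_nhds (hsub hz)]
  exact image_mem_map (hV.mem_nhds hz)

lemma Parts.exists_inverse (hf : IsKH0 f) (D : Parts f h g) :
    ∃ Φ : ℂ → ℂ, ContinuousOn Φ (f '' ball 0 1) ∧ (∀ p ∈ f '' ball 0 1, Φ p ∈ ball (0 : ℂ) 1) ∧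
      (∀ z ∈ ball (0 : ℂ) 1, Φ (f z) = z) ∧ ∀ p ∈ f '' ball 0 1, f (Φ p) = p := by
  have hl : ∀ z ∈ ball (0 : ℂ) 1, Function.invFunOn f (ball 0 1) (f z) = z :=
    fun z hz => hf.univalent.leftInvOn_invFunOn hz
  refine ⟨Function.invFunOn f (ball 0 1), ?_, ?_, hl, ?_⟩
  · rw [continuousOn_open_iff (D.isOpen_image isOpen_ball subset_rfl)]
    intro t ht
    convert! D.isOpen_image (isOpen_ball.inter ht) Set.inter_subset_left using 1
    ext p
    constructor
    · rintro ⟨⟨z, hz, rfl⟩, hp⟩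
      refine ⟨z, ⟨hz, ?_⟩, rfl⟩
      rwa [Set.mem_preimage, hl z hz] at hp
    · rintro ⟨z, hz, rfl⟩
      refine ⟨⟨z, hz.1, rfl⟩, ?_⟩
      rw [Set.mem_preimage, hl z hz.1]
      exact hz.2
  · rintro _ ⟨z, hz, rfl⟩
    rwa [hl z hz]
  · rintro _ ⟨z, hz, rfl⟩
    rw [hl z hz]

end IsKH0

lemma ConvexHomeo.exists_closed {φ F Ψ H K : ℂ → ℂ} {Ω : Set ℂ} (T : ConvexHomeo F Ψ Ω)
    (hφ : DifferentiableOn ℂ φ (ball 0 1)) (hinj : Set.InjOn φ (ball 0 1))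
    (hmaps : Set.MapsTo φ (ball 0 1) (ball 0 1)) (D : Decomp F H K) {C : ℝ} (hC0 : 0 ≤ C)
    (hC : ∀ z ∈ ball (0 : ℂ) 1, ‖deriv H z‖ + ‖deriv K z‖ ≤ C * ‖deriv φ z‖) :
    ∃ Fh, ClosedConvexHomeo F Fh Ψ Ω := by
  have hcl : closure (ball (0 : ℂ) 1) = closedBall 0 1 := closure_ball 0 one_ne_zero
  have hlim : ∀ z ∈ ball (0 : ℂ) 1, Tendsto F (𝓝[ball 0 1] z) (𝓝 (F z)) := fun z hz => T.cont z hz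
  refine ⟨extendFrom (ball 0 1) F, T, ?_, ?_⟩
  · refine continuousOn_extendFrom hcl.ge fun z hz => ?_
    rcases (mem_closedBall_zero_iff.mp hz).lt_or_eq with h | h
    · exact ⟨_, hlim z (by simpa using h)⟩
    · exact T.exists_tendsto hφ hinj hmaps D hC0 hC h
  · intro z hz
    exact extendFrom_eq (subset_closure hz) (hlim z hz)

lemma exists_tendsto_of_norm_eq_one {ι : Type*} (U : Ultrafilter ι) {a : ι → ℂ}
    (ha : ∀ i, ‖a i‖ = 1) : ∃ x : ℂ, ‖x‖ = 1 ∧ Tendsto a U (𝓝 x) := by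
  obtain ⟨x, hx, hxU⟩ := (isCompact_sphere (0 : ℂ) 1).ultrafilter_le_nhds' (U.map a)
    (Filter.mem_map.mpr (Filter.univ_mem' fun i => by simpa using ha i))
  exact ⟨x, by simpa using hx, hxU⟩

namespace IsKH0

variable {f h g : ℂ → ℂ}

/-- A compact convex set inside the image of a mapping of class `K_H^0` that contains the image of
a given concentric closed disk. -/
lemma Parts.exists_compact (hf : IsKH0 f) (D : Parts f h g) {r : ℝ} (hr0 : 0 < r) (hr1 : r < 1) :
    ∃ K : Set ℂ, IsCompact K ∧ Convex ℝ K ∧ 0 ∈ K ∧ K ⊆ f '' ball 0 1 ∧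
      f '' closedBall 0 r ⊆ K := by
  have hsub : closedBall (0 : ℂ) r ⊆ ball 0 1 := closedBall_subset_ball hr1
  have hΩo : IsOpen (f '' ball 0 1) := D.isOpen_image isOpen_ball subset_rfl
  have hΩ0 : (0 : ℂ) ∈ f '' ball 0 1 := ⟨0, by simp, hf.map_zero⟩
  have hlt : ∀ p, gauge (f '' ball 0 1) p < 1 ↔ p ∈ f '' ball 0 1 := fun p => by
    rw [← Set.ext_iff.mp (setOfPred_gauge_lt_one_eq_self_of_isOpen hf.convex_image hΩ0 hΩo) p]
    rfl
  have hgc : Continuous (gauge (f '' ball 0 1)) :=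
    continuous_gauge hf.convex_image (hΩo.mem_nhds hΩ0)
  have hfc : ContinuousOn f (ball 0 1) := fun z hz =>
    ContinuousAt.continuousWithinAt (D.map_nhds hz).le
  have hcp : IsCompact (f '' closedBall 0 r) :=
    (isCompact_closedBall 0 r).image_of_continuousOn (hfc.mono hsub)
  have h0m : (0 : ℂ) ∈ f '' closedBall 0 r := ⟨0, by simpa using hr0.le, hf.map_zero⟩
  obtain ⟨p, hp, hpmax⟩ := hcp.exists_isMaxOn ⟨0, h0m⟩ hgc.continuousOn
  obtain ⟨R, hR⟩ := hcp.isBounded.subset_closedBall 0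
  set s := gauge (f '' ball 0 1) p with hs
  have hs1 : s < 1 := (hlt p).mpr (Set.image_mono hsub hp)
  -- The closed ball is needed because the image of f may be unbounded, so the gauge sublevel set
  -- need not be compact.
  refine ⟨{q | gauge (f '' ball 0 1) q ≤ s} ∩ closedBall 0 R, ?_, ?_, ?_, ?_, ?_⟩
  · exact (isCompact_closedBall 0 R).inter_left (isClosed_le hgc continuous_const)
  · exact (hf.convex_image.setOfPred_gauge_le hΩ0
      (absorbent_nhds_zero (hΩo.mem_nhds hΩ0)) s).inter
      (convex_closedBall 0 R)
  · exact ⟨hpmax h0m, hR h0m⟩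
  · rintro q ⟨hq, -⟩
    exact (hlt q).mp (lt_of_le_of_lt hq hs1)
  · intro q hq
    exact ⟨hpmax hq, hR hq⟩

/-- The half-plane property for an approximation of a mapping of class `K_H^0` by conformal
reparametrisation of its restriction to a slightly smaller subdomain. -/
lemma Parts.exists_halfplane_approx (hf : IsKH0 f) (D : Parts f h g) {r : ℝ} (hr0 : 0 < r)
    (hr1 : r < 1) :
    ∃ (φ : ℂ → ℂ) (a b : ℂ) (d : ℝ), DifferentiableOn ℂ φ (ball 0 1) ∧
      Set.MapsTo φ (ball 0 1) (ball 0 1) ∧ φ 0 = 0 ∧ deriv φ 0 = d ∧ r ≤ d ∧ ‖a‖ = 1 ∧ ‖b‖ = 1 ∧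
      ∀ z ∈ ball (0 : ℂ) 1, 0 ≤ ((a * (deriv h (φ z) * deriv φ z) +
        conj a * (deriv g (φ z) * deriv φ z)) * (b - conj b * z ^ 2)).re := by
  have hsub : closedBall (0 : ℂ) r ⊆ ball 0 1 := closedBall_subset_ball hr1
  have hfc : ContinuousOn f (ball 0 1) := fun z hz =>
    ContinuousAt.continuousWithinAt (D.map_nhds hz).le
  obtain ⟨Φ, hΦc, hΦm, hΦl, hΦr⟩ := D.exists_inverse hf
  obtain ⟨K, hKc, hKconv, hK0, hKsub, hKr⟩ := D.exists_compact hf hr0 hr1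
  obtain ⟨ε, hε, hεsub⟩ := hKc.exists_cthickening_subset_open
    (D.isOpen_image isOpen_ball subset_rfl) hKsub
  set Ω := thickening ε K with hΩ
  have hΩo : IsOpen Ω := isOpen_thickening
  have hΩc : Convex ℝ Ω := hKconv.thickening ε
  have hKΩ : K ⊆ Ω := self_subset_thickening hε K
  have hΩ' : Ω ⊆ cthickening ε K := thickening_subset_cthickening ε K
  have hΩf : Ω ⊆ f '' ball 0 1 := hΩ'.trans hεsub
  set V := ball (0 : ℂ) 1 ∩ f ⁻¹' Ω with hV
  have hVo : IsOpen V := hfc.isOpen_inter_preimage isOpen_ball hΩo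
  have hrV : closedBall 0 r ⊆ V := fun z hz => ⟨hsub hz, hKΩ (hKr ⟨z, hz, rfl⟩)⟩
  have hΦV : ∀ p ∈ Ω, Φ p ∈ V := fun p hp =>
    ⟨hΦm p (hΩf hp), by rwa [Set.mem_preimage, hΦr p (hΩf hp)]⟩
  have h0V : (0 : ℂ) ∈ V := hrV (by simpa using hr0.le)
  -- f restricts to a homeomorphism of V onto the convex set Ω.
  have hsc : IsSimplyConnected V := by
    have e : V ≃ₜ Ω :=
      { toFun := fun z => ⟨f z, z.2.2⟩
        invFun := fun p => ⟨Φ p, hΦV p p.2⟩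
        left_inv := fun z => Subtype.ext (hΦl z z.2.1)
        right_inv := fun p => Subtype.ext (hΦr p (hΩf p.2))
        continuous_toFun := by
          refine Continuous.subtype_mk ?_ _
          exact continuousOn_iff_continuous_domRestrict.mp (hfc.mono Set.inter_subset_left)
        continuous_invFun := by
          refine Continuous.subtype_mk ?_ _
          exact continuousOn_iff_continuous_domRestrict.mp (hΦc.mono hΩf) }
    have := hΩc.contractibleSpace ⟨0, hKΩ hK0⟩
    have := e.contractibleSpace
    exact SimplyConnectedSpace.ofContractible V
  obtain ⟨φ, ψ, hφd, hφm, hψm, hψc, hψφ, hφψ, hφ0, d, hd, hrd⟩ :=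
    exists_riemann_map hVo hsc h0V Set.inter_subset_left
  have hφm' : Set.MapsTo φ (ball 0 1) (ball 0 1) := fun z hz => (hφm hz).1
  have hφat : ∀ z ∈ ball (0 : ℂ) 1, DifferentiableAt ℂ φ z := fun z hz =>
    hφd.differentiableAt (isOpen_ball.mem_nhds hz)
  have hdh : ∀ z ∈ ball (0 : ℂ) 1, deriv (h ∘ φ) z = deriv h (φ z) * deriv φ z := fun z hz =>
    ((D.hasDerivAt_h (hφm' hz)).comp z (hφat z hz).hasDerivAt).deriv
  have hdg : ∀ z ∈ ball (0 : ℂ) 1, deriv (g ∘ φ) z = deriv g (φ z) * deriv φ z := fun z hz =>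
    ((D.hasDerivAt_g (hφm' hz)).comp z (hφat z hz).hasDerivAt).deriv
  have D' : Decomp (f ∘ φ) (h ∘ φ) (g ∘ φ) :=
    ⟨D.h_diff.comp hφd hφm', D.g_diff.comp hφd hφm', fun z hz => D.eq _ (hφm' hz)⟩
  have T : ConvexHomeo (f ∘ φ) (ψ ∘ Φ) Ω :=
    { isOpen := hΩo
      convex := hΩc
      bounded := hKc.isBounded.thickening
      zero_mem := hKΩ hK0
      map_zero := by simp [hφ0, hf.map_zero]
      maps := fun z hz => (hφm hz).2
      cont := hfc.comp hφd.continuousOn hφm'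
      maps_inv := fun p hp => hψm (hΦV p hp)
      cont_inv := hψc.comp (hΦc.mono hΩf) hΦV
      left_inv := fun z hz => by simp [hΦl _ (hφm' hz), hψφ z hz]
      right_inv := fun p hp => by simp [hφψ _ (hΦV p hp), hΦr p (hΩf hp)] }
  have hinj : Set.InjOn φ (ball 0 1) := fun z hz w hw he => by
    rw [← hψφ z hz, he, hψφ w hw]
  -- The closed thickening is compact in the image of f, so |h'| + |g'| is bounded on its preimage.
  -- This gives the gradient bound needed for boundary extension.
  obtain ⟨C, hC⟩ := (hKc.cthickening (r := ε)).exists_bound_of_continuousOn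
    (f := fun p => ‖deriv h (Φ p)‖ + ‖deriv g (Φ p)‖) (by
      have h1 := ((D.h_diff.deriv isOpen_ball).continuousOn).comp hΦc hΦm
      have h2 := ((D.g_diff.deriv isOpen_ball).continuousOn).comp hΦc hΦm
      exact (h1.norm.add h2.norm).mono hεsub)
  have hC0 : 0 ≤ C := (norm_nonneg _).trans (hC 0 (hΩ' (hKΩ hK0)))
  obtain ⟨Fh, T'⟩ := T.exists_closed hφd hinj hφm' D' hC0 (by
    intro z hz
    rw [hdh z hz, hdg z hz, norm_mul, norm_mul, ← add_mul]
    refine mul_le_mul_of_nonneg_right ?_ (norm_nonneg _)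
    have := hC _ (hΩ' (hφm hz).2)
    rw [hΦl _ (hφm' hz)] at this
    exact (le_abs_self _).trans this)
  obtain ⟨n, hn, hn1, hns⟩ := exists_normal_field hKc hKconv hK0 hε
  obtain ⟨a, b, ha, hb, hab⟩ := T'.exists_halfplane D' hn hn1 hns
  refine ⟨φ, a, b, d, hφd, hφm', hφ0, hd, hrd r hr0 (ball_subset_closedBall.trans hrV), ha, hb,
    fun z hz => ?_⟩
  rw [← hdh z hz, ← hdg z hz]
  exact hab z hz

/-- The analytic functions that determine a convex harmonic mapping have the half-plane
property of Hengartner and Schober, Sheil-Small and Clunie. -/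
theorem Parts.exists_halfplane (hf : IsKH0 f) (D : Parts f h g) :
    ∃ a b : ℂ, ‖a‖ = 1 ∧ ‖b‖ = 1 ∧ ∀ z ∈ ball (0 : ℂ) 1,
      0 ≤ ((a * deriv h z + conj a * deriv g z) * (b - conj b * z ^ 2)).re := by
  have hr0 : ∀ n : ℕ, (0 : ℝ) < 1 - 1 / ((n : ℝ) + 2) := fun n => by
    rw [sub_pos, div_lt_one (by positivity)]
    linarith [(Nat.cast_nonneg n : (0 : ℝ) ≤ n)]
  have hr1 : ∀ n : ℕ, 1 - 1 / ((n : ℝ) + 2) < 1 := fun n => by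
    have : 0 < 1 / ((n : ℝ) + 2) := by positivity
    linarith
  choose φ a b d hφd hφm hφ0 hd hrd ha hb hab using
    fun n : ℕ => D.exists_halfplane_approx hf (hr0 n) (hr1 n)
  -- A single ultrafilter makes the maps φ n and the unimodular constants a n, b n converge
  -- simultaneously.
  let U : Ultrafilter ℕ := hyperfilter ℕ
  have hle : ∀ n, ∀ z ∈ ball (0 : ℂ) 1, ‖φ n z‖ ≤ ‖z‖ := fun n z hz =>
    norm_le_norm_of_mapsTo_ball (hφd n)
      (fun w hw => ball_subset_closedBall (hφm n hw)) (hφ0 n) (by simpa using hz)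
  obtain ⟨G, hG⟩ := exists_tendstoLocallyUniformlyOn U (F := φ) (V := ball 0 1) isOpen_ball
    (.of_forall hφd) (.of_forall fun n z hz => (mem_ball_zero_iff.mp (hφm n hz)).le)
  have hGd : DifferentiableOn ℂ G (ball 0 1) := hG.differentiableOn (.of_forall hφd) isOpen_ball
  have hG' := hG.deriv (.of_forall hφd) isOpen_ball
  have h0 : (0 : ℂ) ∈ ball (0 : ℂ) 1 := by simp
  have hGle : ∀ z ∈ ball (0 : ℂ) 1, ‖G z‖ ≤ ‖z‖ := fun z hz =>
    le_of_tendsto (hG.tendsto_at hz).norm (.of_forall fun n => hle n z hz)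
  have hG0 : G 0 = 0 := by simpa using hGle 0 h0
  have hd1 : ∀ n, d n ≤ 1 := fun n => by
    have := norm_deriv_le_one_of_mapsTo_ball (hφd n) (c := 0) (R := 1)
      (fun w hw => by rw [hφ0 n]; exact ball_subset_closedBall (hφm n hw)) one_pos
    rw [hd n, norm_real] at this
    exact (le_abs_self _).trans this
  have hdlim : Tendsto d U (𝓝 1) := by
    have h1 : Tendsto (fun n : ℕ => 1 - 1 / ((n : ℝ) + 2)) atTop (𝓝 1) := by
      have h2 : Tendsto (fun n : ℕ => (n : ℝ) + 2) atTop atTop :=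
        tendsto_atTop_add_const_right _ _ tendsto_natCast_atTop_atTop
      simpa using (h2.inv_tendsto_atTop).const_sub 1
    exact tendsto_of_tendsto_of_tendsto_of_le_of_le (h1.mono_left Nat.hyperfilter_le_atTop)
      tendsto_const_nhds hrd hd1
  have hGd1 : deriv G 0 = 1 := by
    have h1 := hG'.tendsto_at h0
    have h2 : Tendsto (fun n => (d n : ℂ)) U (𝓝 ((1 : ℝ) : ℂ)) :=
      (continuous_ofReal.tendsto 1).comp hdlim
    simp only [Function.comp_def, hd] at h1
    simpa using tendsto_nhds_unique h1 h2
  -- G maps the disk into its closure with G(0) = 0 and G'(0) = 1: the equality case of Schwarz's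
  -- lemma.
  have hGid : Set.EqOn G id (ball 0 1) := by
    have h1 := affine_of_mapsTo_ball_of_norm_dslope_eq_div (R₁ := 1) (R₂ := 1) hGd
      (fun z hz => by
        rw [hG0, mem_closedBall_zero_iff]
        exact (hGle z hz).trans (mem_ball_zero_iff.mp hz).le) h0 (by simp [hGd1])
    intro z hz
    simpa [hG0, hGd1] using h1 hz
  have hGder : ∀ z ∈ ball (0 : ℂ) 1, deriv G z = 1 := fun z hz => by
    rw [(eventuallyEq_of_mem (isOpen_ball.mem_nhds hz) hGid).deriv_eq]
    simp
  obtain ⟨A, hA, hAU⟩ := exists_tendsto_of_norm_eq_one U ha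
  obtain ⟨B, hB, hBU⟩ := exists_tendsto_of_norm_eq_one U hb
  refine ⟨A, B, hA, hB, fun z hz => ?_⟩
  have t1 : Tendsto (fun n => φ n z) U (𝓝 z) := by
    have := hG.tendsto_at hz
    rwa [hGid hz] at this
  have t2 : Tendsto (fun n => deriv (φ n) z) U (𝓝 1) := by
    have := hG'.tendsto_at hz
    rwa [hGder z hz] at this
  have t3 : Tendsto (fun n => deriv h (φ n z)) U (𝓝 (deriv h z)) :=
    (((D.h_diff.deriv isOpen_ball).differentiableAt (isOpen_ball.mem_nhds hz)).continuousAt.tendsto).comp t1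
  have t4 : Tendsto (fun n => deriv g (φ n z)) U (𝓝 (deriv g z)) :=
    (((D.g_diff.deriv isOpen_ball).differentiableAt (isOpen_ball.mem_nhds hz)).continuousAt.tendsto).comp t1
  have tc : ∀ {x : ℕ → ℂ} {y : ℂ}, Tendsto x U (𝓝 y) → Tendsto (fun n => conj (x n)) U (𝓝 (conj y)) :=
    fun hx => (continuous_conj.tendsto _).comp hx
  have t5 := (((hAU.mul (t3.mul t2)).add ((tc hAU).mul (t4.mul t2))).mul
    (hBU.sub ((tc hBU).mul_const (z ^ 2))))
  rw [mul_one, mul_one] at t5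
  exact ge_of_tendsto ((continuous_re.tendsto _).comp t5) (.of_forall fun n => hab n z hz)

end IsKH0

/-! ### Power series with coefficients of polynomial growth -/

/-- A sequence of complex numbers of at most polynomial growth. -/
def PolyBounded (c : ℕ → ℂ) : Prop := ∃ (C : ℝ) (m : ℕ), ∀ n : ℕ, ‖c n‖ ≤ C * ((n : ℝ) + 1) ^ m

/-- The sequence `(n + 1) c n`. -/
def weighted (c : ℕ → ℂ) (n : ℕ) : ℂ := ((n : ℂ) + 1) * c n

/-- The power series `∑ c n z ^ (n + 1)`. -/
def powerSum (c : ℕ → ℂ) (z : ℂ) : ℂ := ∑' n : ℕ, c n * z ^ (n + 1)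

lemma norm_natCast_add_one (n : ℕ) : ‖(n : ℂ) + 1‖ = n + 1 := by
  have : ((n : ℂ) + 1) = ((n + 1 : ℕ) : ℂ) := by push_cast; ring
  rw [this, norm_natCast]
  push_cast
  ring

lemma norm_weighted (c : ℕ → ℂ) (n : ℕ) : ‖weighted c n‖ = ((n : ℝ) + 1) * ‖c n‖ := by
  rw [weighted, norm_mul, norm_natCast_add_one]

namespace PolyBounded

variable {c d : ℕ → ℂ}

lemma weighted (hc : PolyBounded c) : PolyBounded (weighted c) := by
  obtain ⟨C, m, h⟩ := hc
  refine ⟨C, m + 1, fun n => ?_⟩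
  rw [norm_weighted, pow_succ]
  have := mul_le_mul_of_nonneg_left (h n) (show (0 : ℝ) ≤ (n : ℝ) + 1 by positivity)
  linarith

lemma const_mul (hc : PolyBounded c) (t : ℂ) : PolyBounded fun n => t * c n := by
  obtain ⟨C, m, h⟩ := hc
  refine ⟨‖t‖ * C, m, fun n => ?_⟩
  rw [norm_mul, mul_assoc]
  exact mul_le_mul_of_nonneg_left (h n) (norm_nonneg _)

lemma add (hc : PolyBounded c) (hd : PolyBounded d) : PolyBounded fun n => c n + d n := by
  obtain ⟨C, m, h⟩ := hc
  obtain ⟨C', m', h'⟩ := hd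
  refine ⟨|C| + |C'|, max m m', fun n => (norm_add_le _ _).trans ?_⟩
  have h1 : (1 : ℝ) ≤ (n : ℝ) + 1 := by linarith [(Nat.cast_nonneg n : (0 : ℝ) ≤ n)]
  have e1 : C * ((n : ℝ) + 1) ^ m ≤ |C| * ((n : ℝ) + 1) ^ max m m' :=
    mul_le_mul (le_abs_self _) (pow_le_pow_right₀ h1 (le_max_left _ _)) (by positivity)
      (abs_nonneg _)
  have e2 : C' * ((n : ℝ) + 1) ^ m' ≤ |C'| * ((n : ℝ) + 1) ^ max m m' :=
    mul_le_mul (le_abs_self _) (pow_le_pow_right₀ h1 (le_max_right _ _)) (by positivity)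
      (abs_nonneg _)
  linarith [h n, h' n]

lemma summable_norm (hc : PolyBounded c) {r : ℝ} (hr0 : 0 ≤ r) (hr1 : r < 1) :
    Summable fun n => ‖c n‖ * r ^ n := by
  obtain ⟨C, m, h⟩ := hc
  rcases hr0.eq_or_lt with rfl | hr
  · refine summable_of_ne_finset_zero (s := {0}) fun n hn => ?_
    rw [zero_pow (by simpa using hn), mul_zero]
  have h1 : Summable fun n : ℕ => (n : ℝ) ^ m * r ^ n :=
    summable_pow_mul_geometric_of_norm_lt_one m (by rwa [Real.norm_of_nonneg hr0])
  have h2 := ((summable_nat_add_iff 1).mpr h1).mul_left (C * r⁻¹)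
  refine Summable.of_nonneg_of_le (fun n => by positivity) (fun n => ?_) h2
  refine (mul_le_mul_of_nonneg_right (h n) (by positivity)).trans (le_of_eq ?_)
  push_cast
  field_simp
  ring

lemma summable (hc : PolyBounded c) {z : ℂ} (hz : ‖z‖ < 1) : Summable fun n => c n * z ^ n := by
  refine Summable.of_norm ?_
  simpa using hc.summable_norm (norm_nonneg z) hz

lemma norm_tsum_le (hc : PolyBounded c) {r : ℝ} (hr1 : r < 1) {z : ℂ} (hz : ‖z‖ ≤ r) :
    ‖∑' n, c n * z ^ n‖ ≤ ∑' n, ‖c n‖ * r ^ n := by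
  have hr0 : 0 ≤ r := (norm_nonneg _).trans hz
  refine tsum_of_norm_bounded (hc.summable_norm hr0 hr1).hasSum fun n => ?_
  rw [norm_mul, norm_pow]
  gcongr

lemma powerSum_eq (c : ℕ → ℂ) (z : ℂ) : powerSum c z = z * ∑' n, c n * z ^ n := by
  rw [powerSum, ← tsum_mul_left]
  congr 1 with n
  ring

lemma norm_powerSum_le (hc : PolyBounded c) {z : ℂ} (hz : ‖z‖ < 1) :
    ‖powerSum c z‖ ≤ ‖z‖ * ∑' n, ‖c n‖ * ‖z‖ ^ n := by
  rw [powerSum_eq, norm_mul]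
  exact mul_le_mul_of_nonneg_left (hc.norm_tsum_le hz le_rfl) (norm_nonneg _)

lemma powerSum_add (hc : PolyBounded c) (hd : PolyBounded d) {z : ℂ} (hz : ‖z‖ < 1) :
    powerSum (fun n => c n + d n) z = powerSum c z + powerSum d z := by
  rw [powerSum_eq, powerSum_eq, powerSum_eq, ← mul_add, ← (hc.summable hz).tsum_add (hd.summable hz)]
  simp only [add_mul]

lemma powerSum_const_mul (c : ℕ → ℂ) (t z : ℂ) :
    powerSum (fun n => t * c n) z = t * powerSum c z := by
  simp only [powerSum, mul_assoc, tsum_mul_left]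

lemma hasDerivAt (hc : PolyBounded c) {z : ℂ} (hz : ‖z‖ < 1) :
    HasDerivAt (powerSum c) (∑' n, HarmonicMapping.weighted c n * z ^ n) z := by
  obtain ⟨ρ, hzρ, hρ1⟩ := exists_between hz
  have hρ0 : 0 ≤ ρ := (norm_nonneg _).trans hzρ.le
  refine hasDerivAt_tsum_of_isPreconnected (t := ball 0 ρ) (y₀ := 0)
    (hc.weighted.summable_norm hρ0 hρ1) isOpen_ball (convex_ball 0 ρ).isPreconnected
    (g := fun n w => c n * w ^ (n + 1)) (g' := fun n w => HarmonicMapping.weighted c n * w ^ n)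
    ?_ ?_ ?_ ?_ ?_
  · intro n w _
    convert! (hasDerivAt_pow (n + 1) w).const_mul (c n) using 1
    simp only [HarmonicMapping.weighted, Nat.add_sub_cancel]
    push_cast
    ring
  · intro n w hw
    rw [norm_mul, norm_pow]
    have : ‖w‖ ≤ ρ := (mem_ball_zero_iff.mp hw).le
    gcongr
  · simpa using (norm_nonneg z).trans_lt hzρ
  · refine summable_of_ne_finset_zero (s := ∅) fun n _ => by simp
  · simpa using hzρ

lemma differentiableAt (hc : PolyBounded c) {z : ℂ} (hz : ‖z‖ < 1) :
    DifferentiableAt ℂ (powerSum c) z := (hc.hasDerivAt hz).differentiableAt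

/-- On the circle d/dθ is i·z·d/dz, which multiplies the coefficient of z^(n+1) by i(n+1). -/
lemma hasDerivAt_circle (hc : PolyBounded c) {r : ℝ} (hr0 : 0 ≤ r) (hr1 : r < 1) (θ : ℝ) :
    HasDerivAt (fun t : ℝ => powerSum c ((r : ℂ) * cexp (I * (t : ℂ))))
      (I * powerSum (HarmonicMapping.weighted c) ((r : ℂ) * cexp (I * (θ : ℂ)))) θ := by
  have hn : ‖(r : ℂ) * cexp (I * (θ : ℂ))‖ < 1 := by
    rw [norm_mul, mul_comm I, norm_exp_ofReal_mul_I, norm_real, Real.norm_of_nonneg hr0, mul_one]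
    exact hr1
  have h1 : HasDerivAt (fun t : ℂ => (r : ℂ) * cexp (I * t)) (r * (cexp (I * (θ : ℂ)) * I)) θ := by
    simpa using (((hasDerivAt_id (θ : ℂ)).const_mul I).cexp).const_mul (r : ℂ)
  have h2 := ((hc.hasDerivAt hn).comp (θ : ℂ) h1).comp_ofReal
  convert! h2 using 1
  rw [powerSum_eq]
  ring

lemma lipschitz (hc : PolyBounded c) {r : ℝ} (hr1 : r < 1) {z w : ℂ} (hz : ‖z‖ ≤ r)
    (hw : ‖w‖ ≤ r) : ‖powerSum c z - powerSum c w‖ ≤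
      (∑' n : ℕ, ((n : ℝ) + 1) * ‖c n‖ * r ^ n) * ‖z - w‖ := by
  refine (convex_closedBall (0 : ℂ) r).norm_image_sub_le_of_norm_hasDerivWithin_le
    (f' := fun x => ∑' n, HarmonicMapping.weighted c n * x ^ n)
    (fun x hx => (hc.hasDerivAt ?_).hasDerivWithinAt) (fun x hx => ?_) (by simpa using hw)
    (by simpa using hz)
  · exact (mem_closedBall_zero_iff.mp hx).trans_lt hr1
  · simpa only [norm_weighted] using hc.weighted.norm_tsum_le hr1 (mem_closedBall_zero_iff.mp hx)

end PolyBounded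

/-! ### The coefficient criterion for full convexity -/

/-- The harmonic mapping `z + ∑ c n z ^ (n + 1) + conj (∑ d n z ^ (n + 1))`. -/
def seriesMap (c d : ℕ → ℂ) (z : ℂ) : ℂ := z + powerSum c z + conj (powerSum d z)

/-- A coefficient condition for full convexity of order `α` in the disk `|z| < R`. -/
structure ConvexSeries (c d : ℕ → ℂ) (α R : ℝ) : Prop where
  c_poly : PolyBounded c
  d_poly : PolyBounded d
  nonneg : 0 ≤ α
  lt_one : α < 1
  radius_le : R ≤ 1
  bound : ∀ r, 0 < r → r < R → ∑' n : ℕ, ((n : ℝ) + 1) *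
    (((n : ℝ) + 1 - α) * ‖c n‖ + ((n : ℝ) + 1 + α) * ‖d n‖) * r ^ n < 1 - α

/-- A complex number is a unit vector times its norm, with angle given by `arg`. -/
lemma norm_mul_exp_I_mul_arg (x : ℂ) : (‖x‖ : ℂ) * cexp (I * (arg x : ℂ)) = x := by
  rw [mul_comm I, norm_mul_exp_arg_mul_I]

/-- α is the midpoint of 1 and 2α - 1, so being closer to 1 means lying to the right of Re = α. -/
lemma lt_re_of_norm_sub_lt {X : ℂ} {α : ℝ} (hα : α < 1)
    (h : ‖X - 1‖ < ‖X - ((2 * α - 1 : ℝ) : ℂ)‖) : α < X.re := by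
  rw [← sq_lt_sq₀ (norm_nonneg _) (norm_nonneg _), ← normSq_eq_norm_sq, ← normSq_eq_norm_sq,
    normSq_apply, normSq_apply] at h
  simp only [sub_re, one_re, sub_im, one_im, ofReal_re, ofReal_im] at h
  nlinarith

namespace ConvexSeries

variable {c d : ℕ → ℂ} {α R r : ℝ}

lemma summable_weighted (hc : PolyBounded c) (hr0 : 0 ≤ r) (hr1 : r < 1) :
    Summable fun n : ℕ => ((n : ℝ) + 1) * ‖c n‖ * r ^ n := by
  simpa only [norm_weighted] using hc.weighted.summable_norm hr0 hr1

lemma summable_weighted_weighted (hc : PolyBounded c) (hr0 : 0 ≤ r) (hr1 : r < 1) :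
    Summable fun n : ℕ => ((n : ℝ) + 1) * (((n : ℝ) + 1) * ‖c n‖) * r ^ n := by
  simpa only [norm_weighted] using hc.weighted.weighted.summable_norm hr0 hr1

lemma summable_bound (S : ConvexSeries c d α R) (hr0 : 0 ≤ r) (hr1 : r < 1) :
    Summable fun n : ℕ => ((n : ℝ) + 1) *
      (((n : ℝ) + 1 - α) * ‖c n‖ + ((n : ℝ) + 1 + α) * ‖d n‖) * r ^ n := by
  have h1 := summable_weighted_weighted S.c_poly hr0 hr1
  have h2 := summable_weighted_weighted S.d_poly hr0 hr1
  have h3 := (summable_weighted S.c_poly hr0 hr1).mul_left α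
  have h4 := (summable_weighted S.d_poly hr0 hr1).mul_left α
  convert! ((h1.sub h3).add h2).add h4 using 2 with n
  ring

/-- Both weights n+1-α and n+1+α are at least 1-α, so dividing the criterion by 1-α leaves a
first-derivative bound. It makes the map a perturbation of the identity with Lipschitz constant
below 1. -/
lemma tsum_add_tsum_lt_one (S : ConvexSeries c d α R) (hr0 : 0 < r) (hrR : r < R) :
    (∑' n : ℕ, ((n : ℝ) + 1) * ‖c n‖ * r ^ n) + ∑' n : ℕ, ((n : ℝ) + 1) * ‖d n‖ * r ^ n < 1 := by
  have hr1 := hrR.trans_le S.radius_le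
  have h1 := summable_weighted S.c_poly hr0.le hr1
  have h2 := summable_weighted S.d_poly hr0.le hr1
  have hα : 0 < 1 - α := sub_pos.mpr S.lt_one
  rw [← h1.tsum_add h2, ← mul_lt_mul_iff_right₀ hα, mul_one, ← tsum_mul_left]
  refine lt_of_le_of_lt ?_ (S.bound r hr0 hrR)
  refine ((h1.add h2).mul_left _).tsum_le_tsum (fun n => ?_) (S.summable_bound hr0.le hr1)
  have hn : (0 : ℝ) ≤ n := Nat.cast_nonneg n
  have e1 : (1 - α) * ‖c n‖ ≤ ((n : ℝ) + 1 - α) * ‖c n‖ :=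
    mul_le_mul_of_nonneg_right (by linarith) (norm_nonneg _)
  have e2 : (1 - α) * ‖d n‖ ≤ ((n : ℝ) + 1 + α) * ‖d n‖ :=
    mul_le_mul_of_nonneg_right (by linarith [S.nonneg]) (norm_nonneg _)
  have e3 : 0 ≤ ((n : ℝ) + 1) * r ^ n := by positivity
  have := mul_le_mul_of_nonneg_left (add_le_add e1 e2) e3
  calc _ = ((n : ℝ) + 1) * r ^ n * ((1 - α) * ‖c n‖ + (1 - α) * ‖d n‖) := by ring
    _ ≤ _ := this
    _ = _ := by ring

lemma exists_lipschitz (S : ConvexSeries c d α R) (hr0 : 0 < r) (hrR : r < R) :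
    ∃ l : ℝ, 0 ≤ l ∧ l < 1 ∧ ∀ z w : ℂ, ‖z‖ ≤ r → ‖w‖ ≤ r →
      ‖seriesMap c d z - seriesMap c d w - (z - w)‖ ≤ l * ‖z - w‖ := by
  have hr1 := hrR.trans_le S.radius_le
  refine ⟨_, ?_, S.tsum_add_tsum_lt_one hr0 hrR, fun z w hz hw => ?_⟩
  · exact add_nonneg (tsum_nonneg fun n => by positivity) (tsum_nonneg fun n => by positivity)
  · have h1 := S.c_poly.lipschitz hr1 hz hw
    have h2 := S.d_poly.lipschitz hr1 hz hw
    have e : seriesMap c d z - seriesMap c d w - (z - w) =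
        (powerSum c z - powerSum c w) + conj (powerSum d z - powerSum d w) := by
      simp only [seriesMap, map_sub]
      ring
    rw [e, add_mul]
    refine (norm_add_le _ _).trans ?_
    rw [Complex.norm_conj]
    exact add_le_add h1 h2

lemma eq_of_eq (S : ConvexSeries c d α R) (hr0 : 0 < r) (hrR : r < R) {z w : ℂ} (hz : ‖z‖ ≤ r)
    (hw : ‖w‖ ≤ r) (h : seriesMap c d z = seriesMap c d w) : z = w := by
  obtain ⟨l, -, hl1, hl⟩ := S.exists_lipschitz hr0 hrR
  have := hl z w hz hw
  rw [h, sub_self, zero_sub, norm_neg] at this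
  by_contra hne
  have h0 : 0 < ‖z - w‖ := norm_pos_iff.mpr (sub_ne_zero.mpr hne)
  nlinarith

lemma injOn (S : ConvexSeries c d α R) : Set.InjOn (seriesMap c d) (ball 0 R) := by
  intro z hz w hw h
  have hm : max ‖z‖ ‖w‖ < R := max_lt (by simpa using hz) (by simpa using hw)
  obtain ⟨r, hr, hrR⟩ := exists_between hm
  have hr0 : 0 < r := ((norm_nonneg z).trans (le_max_left _ _)).trans_lt hr
  exact S.eq_of_eq hr0 hrR ((le_max_left _ _).trans hr.le) ((le_max_right _ _).trans hr.le) h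

lemma harmonicOnNhd (S : ConvexSeries c d α R) : HarmonicOnNhd (seriesMap c d) (ball 0 R) := by
  intro z hz
  have hz1 : z ∈ ball (0 : ℂ) 1 := ball_subset_ball S.radius_le hz
  have hA : ∀ {c : ℕ → ℂ}, PolyBounded c → AnalyticAt ℂ (powerSum c) z := fun hc =>
    DifferentiableOn.analyticAt (s := ball 0 1) (fun w hw =>
      (hc.differentiableAt (by simpa using hw)).differentiableWithinAt) (isOpen_ball.mem_nhds hz1)
  have h1 : HarmonicAt (fun w => w + powerSum c w) z :=
    (analyticAt_id.add (hA S.c_poly)).harmonicAt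
  have h2 : HarmonicAt (fun w => conj (powerSum d w)) z :=
    ((hA S.d_poly).harmonicAt).comp_CLM (conjCLE : ℂ →L[ℝ] ℂ)
  exact h1.add h2

/-- The tangent direction of the image of the circle, divided by `i z`. -/
lemma exists_tangent_arg (S : ConvexSeries c d α R) (hr0 : 0 < r) (hrR : r < R) :
    ∃ (γ' : ℝ → ℂ) (Ψ : ℝ → ℝ),
      (∀ θ, HasDerivAt (fun t : ℝ => seriesMap c d ((r : ℂ) * cexp (I * (t : ℂ)))) (γ' θ) θ) ∧
      (∀ θ, γ' θ ≠ 0) ∧ (∀ θ, γ' θ = (‖γ' θ‖ : ℂ) * cexp (I * (Ψ θ : ℂ))) ∧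
      Differentiable ℝ Ψ ∧ (∀ θ, α < deriv Ψ θ) ∧ ∀ θ, Ψ (θ + 2 * Real.pi) = Ψ θ + 2 * Real.pi := by
  have hr1 := hrR.trans_le S.radius_le
  have hc := S.c_poly
  have hd := S.d_poly
  set Z : ℝ → ℂ := fun t => (r : ℂ) * cexp (I * (t : ℂ)) with hZ
  have hZn : ∀ t, ‖Z t‖ = r := fun t => by
    rw [hZ, norm_mul, mul_comm I, norm_exp_ofReal_mul_I, norm_real, Real.norm_of_nonneg hr0.le,
      mul_one]
  have hZ1 : ∀ t, ‖Z t‖ < 1 := fun t => by rw [hZn]; exact hr1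
  have hZ0 : ∀ t, Z t ≠ 0 := fun t => norm_pos_iff.mp (by rw [hZn]; exact hr0)
  have hZd : ∀ t, HasDerivAt Z (I * Z t) t := fun t => by
    have h1 : HasDerivAt (fun t : ℂ => (r : ℂ) * cexp (I * t)) (r * (cexp (I * (t : ℂ)) * I)) t := by
      simpa using (((hasDerivAt_id (t : ℂ)).const_mul I).cexp).const_mul (r : ℂ)
    convert! h1.comp_ofReal using 1
    simp only [hZ]
    ring
  have hconj : ∀ {u : ℝ → ℂ} {u' : ℂ} {t : ℝ}, HasDerivAt u u' t →
      HasDerivAt (fun s => conj (u s)) (conj u') t := fun hu =>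
    (conjCLE : ℂ →L[ℝ] ℂ).hasFDerivAt.comp_hasDerivAt _ hu
  -- The tangent is γ' = iP, and P' = iN.
  set P : ℝ → ℂ := fun t =>
    Z t + powerSum (weighted c) (Z t) - conj (powerSum (weighted d) (Z t)) with hP
  set N : ℝ → ℂ := fun t => Z t + powerSum (weighted (weighted c)) (Z t) +
    conj (powerSum (weighted (weighted d)) (Z t)) with hN
  have hγ : ∀ t, HasDerivAt (fun t => seriesMap c d (Z t)) (I * P t) t := fun t => by
    convert! ((hZd t).add (hc.hasDerivAt_circle hr0.le hr1 t)).add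
      (hconj (hd.hasDerivAt_circle hr0.le hr1 t)) using 1
    simp only [hP, map_mul, conj_I]
    ring
  have hPd : ∀ t, HasDerivAt P (I * N t) t := fun t => by
    convert! ((hZd t).add (hc.weighted.hasDerivAt_circle hr0.le hr1 t)).sub
      (hconj (hd.weighted.hasDerivAt_circle hr0.le hr1 t)) using 1
    simp only [hN, map_mul, conj_I]
    ring
  have hw : ∀ {c : ℕ → ℂ}, PolyBounded c → ∀ t,
      ‖powerSum (weighted c) (Z t)‖ ≤ r * ∑' n : ℕ, ((n : ℝ) + 1) * ‖c n‖ * r ^ n := fun hc t => by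
    simpa only [hZn, norm_weighted] using hc.weighted.norm_powerSum_le (hZ1 t)
  have hPZ : ∀ t, ‖P t - Z t‖ < r := fun t => by
    have e : P t - Z t = powerSum (weighted c) (Z t) - conj (powerSum (weighted d) (Z t)) := by
      simp only [hP]; ring
    rw [e]
    refine (norm_sub_le _ _).trans_lt ?_
    rw [Complex.norm_conj]
    have := mul_lt_mul_of_pos_left (S.tsum_add_tsum_lt_one hr0 hrR) hr0
    linarith [hw hc t, hw hd t]
  have hP0 : ∀ t, P t ≠ 0 := fun t h => by
    have := hPZ t
    rw [h, zero_sub, norm_neg, hZn] at this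
    exact lt_irrefl _ this
  -- |P - Z| < |Z| keeps Q in the right half-plane. Hence θ + π/2 + arg Q with the principal
  -- argument is a smooth branch, with derivative Re(N/P).
  set Q : ℝ → ℂ := fun t => P t / Z t with hQ
  have hQre : ∀ t, 0 < (Q t).re := fun t => by
    have h1 : ‖Q t - 1‖ < 1 := by
      rw [hQ, div_sub_one (hZ0 t), norm_div, hZn, div_lt_one hr0]
      exact hPZ t
    have h2 := (neg_le_abs _).trans ((abs_re_le_norm (Q t - 1)).trans h1.le)
    have h3 := (abs_re_le_norm (Q t - 1)).trans_lt h1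
    rw [abs_lt, sub_re, one_re] at h3
    linarith
  have hQs : ∀ t, Q t ∈ slitPlane := fun t => Or.inl (hQre t)
  have hQd : ∀ t, HasDerivAt Q (I * (N t - P t) / Z t) t := fun t => by
    convert! (hPd t).div (hZd t) (hZ0 t) using 1
    have := hZ0 t
    field_simp
  have hargd : ∀ t, HasDerivAt (fun s => arg (Q s)) ((N t - P t) / P t).re t := fun t => by
    have h1 := (hQd t).clog_real (hQs t)
    have h2 := imCLM.hasFDerivAt.comp_hasDerivAt t h1
    simp only [Function.comp_def, imCLM_apply, log_im] at h2
    convert! h2 using 1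
    have e : I * (N t - P t) / Z t / Q t = I * ((N t - P t) / P t) := by
      have h1 := hZ0 t
      have h2 := hP0 t
      simp only [hQ]
      field_simp
    rw [e]
    simp only [I_mul_im]
  -- It suffices that |N - P| < |N - (2α-1)P|; both sides are estimated by their coefficients, the
  -- term 2(1-α)Z dominating on the right.
  have hmain : ∀ t, α < (N t / P t).re := fun t => by
    apply lt_re_of_norm_sub_lt S.lt_one
    rw [div_sub_one (hP0 t), div_sub' (hP0 t), norm_div, norm_div]
    refine div_lt_div_of_pos_right ?_ (norm_pos_iff.mpr (hP0 t))
    have hβ : (0 : ℝ) < 1 - α := sub_pos.mpr S.lt_one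
    have k1 : PolyBounded fun n => weighted (weighted c) n + (-1 : ℂ) * weighted c n :=
      hc.weighted.weighted.add (hc.weighted.const_mul _)
    have k2 : PolyBounded fun n => weighted (weighted d) n + (1 : ℂ) * weighted d n :=
      hd.weighted.weighted.add (hd.weighted.const_mul _)
    have k3 : PolyBounded fun n => weighted (weighted c) n + ((1 - 2 * α : ℝ) : ℂ) * weighted c n :=
      hc.weighted.weighted.add (hc.weighted.const_mul _)
    have k4 : PolyBounded fun n =>
        weighted (weighted d) n + ((2 * α - 1 : ℝ) : ℂ) * weighted d n :=
      hd.weighted.weighted.add (hd.weighted.const_mul _)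
    have nrm : ∀ (e : ℕ → ℂ) (x : ℝ) (n : ℕ), 0 ≤ (n : ℝ) + 1 + x →
        ‖weighted (weighted e) n + (x : ℂ) * weighted e n‖ =
          ((n : ℝ) + 1 + x) * (((n : ℝ) + 1) * ‖e n‖) := by
      intro e x n hx
      have : weighted (weighted e) n + (x : ℂ) * weighted e n =
          (((n : ℝ) + 1 + x : ℝ) : ℂ) * weighted e n := by
        rw [weighted]; push_cast; ring
      rw [this, norm_mul, norm_real, Real.norm_of_nonneg hx, norm_weighted]
    have b1 := k1.norm_powerSum_le (hZ1 t)
    have b2 := k2.norm_powerSum_le (hZ1 t)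
    have b3 := k3.norm_powerSum_le (hZ1 t)
    have b4 := k4.norm_powerSum_le (hZ1 t)
    have s1 := k1.summable_norm hr0.le hr1
    have s2 := k2.summable_norm hr0.le hr1
    have s3 := k3.summable_norm hr0.le hr1
    have s4 := k4.summable_norm hr0.le hr1
    rw [hZn] at b1 b2 b3 b4
    have e1 : N t - P t =
        powerSum (fun n => weighted (weighted c) n + (-1 : ℂ) * weighted c n) (Z t) +
        conj (powerSum (fun n => weighted (weighted d) n + (1 : ℂ) * weighted d n) (Z t)) := by
      rw [hc.weighted.weighted.powerSum_add (hc.weighted.const_mul _) (hZ1 t),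
        hd.weighted.weighted.powerSum_add (hd.weighted.const_mul _) (hZ1 t),
        PolyBounded.powerSum_const_mul, PolyBounded.powerSum_const_mul]
      simp only [hN, hP, map_add, one_mul]
      ring
    have e2 : N t - P t * ((2 * α - 1 : ℝ) : ℂ) = ((2 * (1 - α) : ℝ) : ℂ) * Z t + (
        powerSum (fun n => weighted (weighted c) n + ((1 - 2 * α : ℝ) : ℂ) * weighted c n) (Z t) +
        conj (powerSum (fun n =>
          weighted (weighted d) n + ((2 * α - 1 : ℝ) : ℂ) * weighted d n) (Z t))) := by
      rw [hc.weighted.weighted.powerSum_add (hc.weighted.const_mul _) (hZ1 t),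
        hd.weighted.weighted.powerSum_add (hd.weighted.const_mul _) (hZ1 t),
        PolyBounded.powerSum_const_mul, PolyBounded.powerSum_const_mul]
      simp only [hN, hP, map_add, map_mul, conj_ofReal]
      push_cast
      ring
    have n1 : ‖N t - P t‖ ≤ r * ((∑' n, ‖weighted (weighted c) n + (-1 : ℂ) * weighted c n‖ * r ^ n)
        + ∑' n, ‖weighted (weighted d) n + (1 : ℂ) * weighted d n‖ * r ^ n) := by
      rw [e1, mul_add]
      refine (norm_add_le _ _).trans ?_
      rw [Complex.norm_conj]
      exact add_le_add b1 b2
    have n2 : 2 * (1 - α) * r - r * (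
        (∑' n, ‖weighted (weighted c) n + ((1 - 2 * α : ℝ) : ℂ) * weighted c n‖ * r ^ n) +
        ∑' n, ‖weighted (weighted d) n + ((2 * α - 1 : ℝ) : ℂ) * weighted d n‖ * r ^ n) ≤
        ‖N t - P t * ((2 * α - 1 : ℝ) : ℂ)‖ := by
      rw [e2]
      have h1 := norm_sub_le_norm_add (((2 * (1 - α) : ℝ) : ℂ) * Z t) (
        powerSum (fun n => weighted (weighted c) n + ((1 - 2 * α : ℝ) : ℂ) * weighted c n) (Z t) +
        conj (powerSum (fun n =>
          weighted (weighted d) n + ((2 * α - 1 : ℝ) : ℂ) * weighted d n) (Z t)))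
      rw [norm_mul, hZn, norm_real, Real.norm_of_nonneg (by linarith : 0 ≤ 2 * (1 - α))] at h1
      have h2 := norm_add_le (powerSum (fun n => weighted (weighted c) n +
        ((1 - 2 * α : ℝ) : ℂ) * weighted c n) (Z t)) (conj (powerSum (fun n =>
          weighted (weighted d) n + ((2 * α - 1 : ℝ) : ℂ) * weighted d n) (Z t)))
      rw [Complex.norm_conj] at h2
      linarith
    -- The analytic weights n and n+2-2α add up to 2(n+1-α), the co-analytic ones n+2 and n+2α to
    -- 2(n+1+α): twice the sum in the criterion.
    have hsum : (∑' n, ‖weighted (weighted c) n + (-1 : ℂ) * weighted c n‖ * r ^ n)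
        + (∑' n, ‖weighted (weighted d) n + (1 : ℂ) * weighted d n‖ * r ^ n) +
        ((∑' n, ‖weighted (weighted c) n + ((1 - 2 * α : ℝ) : ℂ) * weighted c n‖ * r ^ n) +
        ∑' n, ‖weighted (weighted d) n + ((2 * α - 1 : ℝ) : ℂ) * weighted d n‖ * r ^ n) =
        2 * ∑' n : ℕ, ((n : ℝ) + 1) *
          (((n : ℝ) + 1 - α) * ‖c n‖ + ((n : ℝ) + 1 + α) * ‖d n‖) * r ^ n := by
      rw [← s1.tsum_add s2, ← s3.tsum_add s4, ← (s1.add s2).tsum_add (s3.add s4), ← tsum_mul_left]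
      congr 1 with n
      have hn : (0 : ℝ) ≤ n := Nat.cast_nonneg n
      have := S.nonneg
      have := S.lt_one
      have i1 := nrm c (-1) n (by linarith)
      have i2 := nrm d 1 n (by linarith)
      push_cast at i1 i2
      rw [i1, i2, nrm c (1 - 2 * α) n (by linarith), nrm d (2 * α - 1) n (by linarith)]
      ring
    have hlt := mul_lt_mul_of_pos_left (S.bound r hr0 hrR) (by linarith : 0 < 2 * r)
    have hsum' := congrArg (fun x => r * x) hsum
    simp only [mul_add r] at hsum' n1 n2
    linarith
  have hΨd : ∀ t, HasDerivAt (fun s : ℝ => s + Real.pi / 2 + arg (Q s)) (N t / P t).re t := fun t => by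
    convert! ((hasDerivAt_id t).add_const (Real.pi / 2)).add (hargd t) using 1
    rw [sub_div, div_self (hP0 t), sub_re, one_re]
    ring
  refine ⟨fun t => I * P t, fun t => t + Real.pi / 2 + arg (Q t), hγ,
    fun t => mul_ne_zero I_ne_zero (hP0 t), fun t => ?_, fun t => (hΨd t).differentiableAt,
    fun t => by rw [(hΨd t).deriv]; exact hmain t, fun t => ?_⟩
  · have e1 : P t = Z t * Q t := by
      simp only [hQ]
      rw [mul_div_cancel₀ _ (hZ0 t)]
    have e2 : ‖I * P t‖ = r * ‖Q t‖ := by rw [norm_mul, norm_I, one_mul, e1, norm_mul, hZn]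
    have e3 : cexp (I * ((Real.pi / 2 : ℝ) : ℂ)) = I := by
      push_cast
      rw [mul_comm, exp_pi_div_two_mul_I]
    rw [e2]
    push_cast
    rw [mul_add, mul_add, exp_add, exp_add]
    push_cast at e3
    rw [e3, e1]
    conv_lhs => rw [← norm_mul_exp_I_mul_arg (Q t)]
    simp only [hZ]
    ring
  · have : Z (t + 2 * Real.pi) = Z t := by
      simp only [hZ]
      push_cast
      rw [mul_add, exp_add, show I * (2 * (Real.pi : ℂ)) = 2 * Real.pi * I by ring, exp_two_pi_mul_I,
        mul_one]
    simp only [hQ, hP, this]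
    ring

end ConvexSeries

/-- A curve whose tangent turns monotonically through one full angle lies on one side of each of
its tangent lines. -/
lemma re_le_of_tangent_arg {γ γ' : ℝ → ℂ} {Ψ : ℝ → ℝ} (hγ : ∀ θ, HasDerivAt γ (γ' θ) θ)
    (hΨ : ∀ θ, γ' θ = (‖γ' θ‖ : ℂ) * cexp (I * (Ψ θ : ℂ))) (hc : Continuous Ψ) (hm : Monotone Ψ)
    (hper : ∀ θ, Ψ (θ + 2 * Real.pi) = Ψ θ + 2 * Real.pi)
    (hγper : ∀ θ, γ (θ + 2 * Real.pi) = γ θ) (θ₀ : ℝ) {θ : ℝ} (h0 : θ₀ ≤ θ)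
    (h1 : θ ≤ θ₀ + 2 * Real.pi) :
    (conj (cexp (I * (Ψ θ₀ : ℂ))) * γ θ).im ≥ (conj (cexp (I * (Ψ θ₀ : ℂ))) * γ θ₀).im := by
  have hπ := Real.pi_pos
  -- The height above the tangent line has derivative |γ'| sin(Ψ - Ψ(θ₀)). It rises until the
  -- tangent has turned by π, then falls, returning to its initial value after the full turn.
  have hd : ∀ t, HasDerivAt (fun s => (conj (cexp (I * (Ψ θ₀ : ℂ))) * γ s).im)
      (‖γ' t‖ * Real.sin (Ψ t - Ψ θ₀)) t := by
    intro t
    have h2 := imCLM.hasFDerivAt.comp_hasDerivAt t ((hγ t).const_mul (conj (cexp (I * (Ψ θ₀ : ℂ)))))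
    convert! h2 using 1
    have e : conj (cexp (I * (Ψ θ₀ : ℂ))) * γ' t =
        (‖γ' t‖ : ℂ) * cexp (((Ψ t - Ψ θ₀ : ℝ) : ℂ) * I) := by
      rw [hΨ t, ← exp_conj, map_mul, conj_I, conj_ofReal]
      rw [mul_left_comm, ← exp_add, norm_mul, norm_real, norm_norm, mul_comm I (Ψ t : ℂ),
        norm_exp_ofReal_mul_I, mul_one]
      congr 2
      push_cast
      ring
    rw [imCLM_apply, e, im_ofReal_mul, exp_ofReal_mul_I_im]
  have hcont : Continuous fun s => (conj (cexp (I * (Ψ θ₀ : ℂ))) * γ s).im :=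
    continuous_iff_continuousAt.mpr fun t => (hd t).continuousAt
  obtain ⟨θ₁, ⟨h01, h12⟩, hθ₁⟩ : ∃ θ₁ ∈ Set.Icc θ₀ (θ₀ + 2 * Real.pi), Ψ θ₁ = Ψ θ₀ + Real.pi := by
    apply intermediate_value_Icc (by linarith) hc.continuousOn
    rw [hper]
    constructor <;> linarith
  rcases le_total θ θ₁ with h | h
  · have hmono : MonotoneOn (fun s => (conj (cexp (I * (Ψ θ₀ : ℂ))) * γ s).im) (Set.Icc θ₀ θ₁) := by
      refine monotoneOn_of_deriv_nonneg (convex_Icc _ _) hcont.continuousOn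
        (fun t _ => (hd t).differentiableAt.differentiableWithinAt) fun t ht => ?_
      rw [interior_Icc] at ht
      rw [(hd t).deriv]
      exact mul_nonneg (norm_nonneg _) (Real.sin_nonneg_of_nonneg_of_le_pi
        (by linarith [hm ht.1.le]) (by linarith [hm ht.2.le]))
    exact hmono ⟨le_rfl, h01⟩ ⟨h0, h⟩ h0
  · have hanti : AntitoneOn (fun s => (conj (cexp (I * (Ψ θ₀ : ℂ))) * γ s).im)
        (Set.Icc θ₁ (θ₀ + 2 * Real.pi)) := by
      refine antitoneOn_of_deriv_nonpos (convex_Icc _ _) hcont.continuousOn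
        (fun t _ => (hd t).differentiableAt.differentiableWithinAt) fun t ht => ?_
      rw [interior_Icc] at ht
      rw [(hd t).deriv]
      refine mul_nonpos_of_nonneg_of_nonpos (norm_nonneg _) ?_
      have e1 := hm ht.1.le
      have e2 := hm ht.2.le
      rw [hper] at e2
      rw [← Real.sin_sub_two_pi]
      exact Real.sin_nonpos_of_nonpos_of_neg_pi_le (by linarith) (by linarith)
    have := hanti ⟨h, h1⟩ ⟨h12, le_rfl⟩ h1
    simp only [hγper] at this
    exact this

/-- The maximum principle for the real part of an analytic function on a disk. -/
lemma re_le_of_re_le_sphere {A : ℂ → ℂ} {r M : ℝ} (hr : 0 < r) (hA : DiffContOnCl ℂ A (ball 0 r))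
    (h : ∀ z : ℂ, ‖z‖ = r → (A z).re ≤ M) {z : ℂ} (hz : ‖z‖ ≤ r) : (A z).re ≤ M := by
  -- |e^A| = e^(Re A) reduces the claim to the maximum modulus principle.
  have h1 : DiffContOnCl ℂ (fun z => cexp (A z)) (ball 0 r) :=
    ⟨hA.1.cexp, hA.2.cexp⟩
  have h2 := Complex.norm_le_of_forall_mem_frontier_norm_le (C := Real.exp M) isBounded_ball h1
    (fun w hw => by
      rw [frontier_ball 0 hr.ne'] at hw
      rw [norm_exp]
      exact Real.exp_le_exp.mpr (h w (by simpa using hw))) (z := z)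
    (by rw [closure_ball 0 hr.ne']; simpa using hz)
  rwa [norm_exp, Real.exp_le_exp] at h2

namespace ConvexSeries

variable {c d : ℕ → ℂ} {α R r : ℝ}

lemma continuousOn (S : ConvexSeries c d α R) : ContinuousOn (seriesMap c d) (ball 0 1) := by
  intro z hz
  have hz1 : ‖z‖ < 1 := by simpa using hz
  have h1 := (S.c_poly.differentiableAt hz1).continuousAt
  have h2 := (S.d_poly.differentiableAt hz1).continuousAt
  exact ((continuousAt_id.add h1).add (continuous_conj.continuousAt.comp h2)).continuousWithinAt

/-- The support property of the image of a circle extends to the image of the disk. -/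
lemma exists_support (S : ConvexSeries c d α R) (hr0 : 0 < r) (hrR : r < R) {ζ : ℂ} (hζ : ‖ζ‖ = r) :
    ∃ ν : ℂ, ‖ν‖ = 1 ∧ ∀ z : ℂ, ‖z‖ ≤ r →
      (ν * seriesMap c d z).re ≤ (ν * seriesMap c d ζ).re := by
  obtain ⟨γ', Ψ, hγ, -, hΨ, hΨd, hΨα, hΨper⟩ := S.exists_tangent_arg hr0 hrR
  have hr1 := hrR.trans_le S.radius_le
  have hm : Monotone Ψ := monotone_of_deriv_nonneg hΨd fun t => S.nonneg.trans (hΨα t).le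
  have hpolar : ∀ z : ℂ, ‖z‖ = r → ∀ θ₀ : ℝ, ∃ θ : ℝ, θ₀ ≤ θ ∧ θ ≤ θ₀ + 2 * Real.pi ∧
      z = (r : ℂ) * cexp (I * (θ : ℂ)) := by
    intro z hz θ₀
    have h2π := Real.two_pi_pos
    refine ⟨toIcoMod h2π θ₀ (arg z), left_le_toIcoMod h2π _ _, (toIcoMod_lt_right h2π _ _).le, ?_⟩
    have h1 := self_sub_toIcoDiv_zsmul h2π θ₀ (arg z)
    rw [← h1, ← hz]
    conv_lhs => rw [← norm_mul_exp_arg_mul_I z]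
    congr 1
    rw [exp_eq_exp_iff_exists_int]
    refine ⟨toIcoDiv h2π θ₀ (arg z), ?_⟩
    simp only [zsmul_eq_mul]
    push_cast
    ring
  obtain ⟨θ₀, -, -, rfl⟩ := hpolar ζ hζ 0
  have hγper : ∀ θ : ℝ, seriesMap c d ((r : ℂ) * cexp (I * ((θ + 2 * Real.pi : ℝ) : ℂ))) =
      seriesMap c d ((r : ℂ) * cexp (I * (θ : ℂ))) := by
    intro θ
    congr 2
    push_cast
    rw [mul_add, exp_add, show I * (2 * (Real.pi : ℂ)) = 2 * Real.pi * I by ring, exp_two_pi_mul_I,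
      mul_one]
  set ν : ℂ := I * conj (cexp (I * (Ψ θ₀ : ℂ))) with hν
  have hre : ∀ x : ℂ, (ν * x).re = -(conj (cexp (I * (Ψ θ₀ : ℂ))) * x).im := fun x => by
    rw [hν, mul_assoc, I_mul_re]
  refine ⟨ν, ?_, fun z hz => ?_⟩
  · rw [hν, norm_mul, norm_I, one_mul, Complex.norm_conj, mul_comm, norm_exp_ofReal_mul_I]
  · have hA : ∀ z, (ν * seriesMap c d z).re =
        (ν * (z + powerSum c z) + conj ν * powerSum d z).re := by
      intro z
      simp only [seriesMap, mul_re, add_re, add_im, conj_re, conj_im]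
      ring
    rw [hA z]
    refine re_le_of_re_le_sphere (A := fun z => ν * (z + powerSum c z) + conj ν * powerSum d z)
      hr0 ?_ ?_ hz
    · apply DifferentiableOn.diffContOnCl
      rw [closure_ball 0 hr0.ne']
      intro w hw
      have hw1 : ‖w‖ < 1 := (mem_closedBall_zero_iff.mp hw).trans_lt hr1
      have h1 := S.c_poly.differentiableAt hw1
      have h2 := S.d_poly.differentiableAt hw1
      exact DifferentiableAt.differentiableWithinAt (by fun_prop)
    · intro w hw
      obtain ⟨θ, h1, h2, rfl⟩ := hpolar w hw θ₀
      rw [← hA, hre, hre]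
      have := re_le_of_tangent_arg hγ hΨ hΨd.continuous hm hΨper hγper θ₀ h1 h2
      linarith

/-- The map differs from the identity by a Lipschitz map with constant below 1, so the quantitative
inverse function theorem applies. -/
lemma isOpen_image (S : ConvexSeries c d α R) (hr0 : 0 < r) (hrR : r < R) :
    IsOpen (seriesMap c d '' ball 0 r) := by
  obtain ⟨l, hl0, hl1, hl⟩ := S.exists_lipschitz hr0 hrR
  lift l to NNReal using hl0
  have h1 : ApproximatesLinearOn (seriesMap c d)
      ((ContinuousLinearEquiv.refl ℝ ℂ : ℂ ≃L[ℝ] ℂ) : ℂ →L[ℝ] ℂ) (ball 0 r) l :=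
    fun z hz w hw => hl z w (mem_ball_zero_iff.mp hz).le (mem_ball_zero_iff.mp hw).le
  refine h1.open_image (ContinuousLinearEquiv.toNonlinearRightInverse _) isOpen_ball (Or.inr ?_)
  have h2 : (ContinuousLinearEquiv.refl ℝ ℂ).toNonlinearRightInverse.nnnorm = 1 := by
    apply NNReal.coe_injective
    exact ContinuousLinearMap.norm_id
  rw [h2, inv_one]
  exact_mod_cast hl1

/-- The image U of the open disk equals the interior of the intersection C of the supporting
half-planes. U is open in the connected set int C, and it is relatively closed there because closure
points outside U lie on the image of the circle, which misses int C. -/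
theorem isConvexCurve (S : ConvexSeries c d α R) (hr0 : 0 < r) (hrR : r < R) :
    IsConvexCurve (seriesMap c d '' sphere 0 r) := by
  have hr1 := hrR.trans_le S.radius_le
  set F := seriesMap c d with hF
  set U := F '' ball 0 r with hU
  have hUo : IsOpen U := S.isOpen_image hr0 hrR
  have hcont : ContinuousOn F (closedBall 0 r) :=
    S.continuousOn.mono (closedBall_subset_ball hr1)
  have hcomp : IsCompact (F '' closedBall 0 r) := (isCompact_closedBall 0 r).image_of_continuousOn hcont
  have hcl : closure U = F '' closedBall 0 r := by
    apply Set.Subset.antisymm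
    · exact closure_minimal (Set.image_mono ball_subset_closedBall) hcomp.isClosed
    · rw [← closure_ball 0 hr0.ne']
      exact ContinuousOn.image_closure (by rwa [closure_ball 0 hr0.ne'])
  have hsplit : F '' closedBall 0 r = U ∪ F '' sphere 0 r := by
    rw [← ball_union_sphere, Set.image_union]
  have hdisj : ∀ p ∈ F '' sphere 0 r, p ∉ U := by
    rintro _ ⟨z, hz, rfl⟩ ⟨w, hw, h⟩
    have hz' : ‖z‖ = r := by simpa using hz
    have hw' : ‖w‖ < r := by simpa using hw
    have := S.eq_of_eq hr0 hrR hw'.le hz'.le h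
    rw [this] at hw'
    linarith
  have hne : U.Nonempty := ⟨F 0, 0, by simpa using hr0, rfl⟩
  choose! ν hν1 hν using fun (ζ : ℂ) (hζ : ‖ζ‖ = r) => S.exists_support hr0 hrR hζ
  set C : Set ℂ := {p | ∀ ζ : ℂ, ‖ζ‖ = r → (ν ζ * p).re ≤ (ν ζ * F ζ).re} with hC
  have hCconv : Convex ℝ C := by
    intro p hp q hq s t hs ht hst ζ hζ
    have e : (ν ζ * (s • p + t • q)).re = s * (ν ζ * p).re + t * (ν ζ * q).re := by
      simp only [real_smul, mul_re, mul_im, add_re, add_im, ofReal_re, ofReal_im]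
      ring
    rw [e]
    have h1 := mul_le_mul_of_nonneg_left (hp ζ hζ) hs
    have h2 := mul_le_mul_of_nonneg_left (hq ζ hζ) ht
    calc _ ≤ s * (ν ζ * F ζ).re + t * (ν ζ * F ζ).re := add_le_add h1 h2
      _ = _ := by rw [← add_mul, hst, one_mul]
  have hUC : U ⊆ interior C := by
    refine interior_maximal ?_ hUo
    rintro _ ⟨z, hz, rfl⟩ ζ hζ
    exact hν ζ hζ z (mem_ball_zero_iff.mp hz).le
  have hCU : interior C ⊆ U := by
    refine hCconv.interior.isPreconnected.subset_of_closure_inter_subset hUo ?_ ?_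
    · obtain ⟨p, hp⟩ := hne
      exact ⟨p, hUC hp, hp⟩
    · rintro p ⟨hp, hpC⟩
      rw [hcl, hsplit] at hp
      rcases hp with hp | ⟨ζ, hζ, rfl⟩
      · exact hp
      · exfalso
        have hζ' : ‖ζ‖ = r := by simpa using hζ
        obtain ⟨ε, hε, hball⟩ := Metric.isOpen_iff.mp isOpen_interior _ hpC
        -- A small step from F ζ in the outward direction conj (ν ζ) leaves the supporting
        -- half-plane at ζ, so F ζ is not interior to C.
        have hmem : F ζ + (((ε / 2 : ℝ) : ℂ) * conj (ν ζ)) ∈ ball (F ζ) ε := by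
          rw [mem_ball, dist_eq_norm, add_sub_cancel_left, norm_mul, Complex.norm_conj, hν1 ζ hζ',
            norm_real, Real.norm_of_nonneg (by positivity)]
          linarith
        have h1 := interior_subset (hball hmem) ζ hζ'
        rw [mul_add, mul_left_comm, mul_conj, normSq_eq_norm_sq, hν1 ζ hζ'] at h1
        norm_num at h1
        linarith
  refine ⟨U, hUo, hne, hcomp.isBounded.subset (Set.image_mono ball_subset_closedBall), ?_, ?_⟩
  · rw [Set.Subset.antisymm hUC hCU]
    exact hCconv.interior
  · rw [frontier, hUo.interior_eq, hcl, hsplit, Set.union_sdiff_left]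
    exact sdiff_eq_left.mpr (Set.disjoint_left.mpr hdisj)

/-- Full convexity of harmonic mappings under a coefficient condition. -/
theorem fullyConvexOfOrder (S : ConvexSeries c d α R) :
    FullyConvexOfOrder (seriesMap c d) α R := by
  refine ⟨S.harmonicOnNhd, fun r hr0 hrR => ⟨?_, S.isConvexCurve hr0 hrR, ?_⟩⟩
  · exact S.injOn.mono (sphere_subset_closedBall.trans (closedBall_subset_ball hrR))
  · obtain ⟨γ', Ψ, hγ, hγ0, hΨ, hΨd, hΨα, -⟩ := S.exists_tangent_arg hr0 hrR
    refine ⟨fun t => (hγ t).differentiableAt, fun t => ?_, Ψ, hΨd, fun t => ?_, hΨα⟩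
    · rw [(hγ t).deriv]
      exact hγ0 t
    · rw [(hγ t).deriv]
      exact hΨ t

end ConvexSeries

/-! ### The radius polynomial and the convolution -/

/-- The polynomial whose root is the radius of full convexity of order `α`. -/
def radiusPoly (α r : ℝ) : ℝ :=
  2 * (1 - α) * (1 - r) ^ 5 + α * (1 + r) * (1 - r) ^ 2 - (1 + r) * (r ^ 2 + 4 * r + 1)

/-- Each summand is nonincreasing on [0,1] and the last is strictly decreasing; for the middle one,
(1+x)(1-x)² = (1-x²)(1-x). -/
lemma radiusPoly_lt {α r s : ℝ} (h0 : 0 ≤ α) (h1 : α < 1) (hr : 0 ≤ r) (hrs : r < s) (hs : s ≤ 1) :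
    radiusPoly α s < radiusPoly α r := by
  have e1 : (1 - s) ^ 5 ≤ (1 - r) ^ 5 := pow_le_pow_left₀ (by linarith) (by linarith) 5
  have e2 : (1 - s ^ 2) * (1 - s) ≤ (1 - r ^ 2) * (1 - r) :=
    mul_le_mul (by nlinarith) (by linarith) (by linarith) (by nlinarith)
  have e3 : (1 + r) * (r ^ 2 + 4 * r + 1) < (1 + s) * (s ^ 2 + 4 * s + 1) :=
    mul_lt_mul'' (by linarith) (by nlinarith) (by linarith) (by positivity)
  have e4 := mul_le_mul_of_nonneg_left e1 (by linarith : 0 ≤ 2 * (1 - α))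
  have e5 := mul_le_mul_of_nonneg_left e2 h0
  have k : ∀ x : ℝ, α * (1 + x) * (1 - x) ^ 2 = α * ((1 - x ^ 2) * (1 - x)) := fun x => by ring
  simp only [radiusPoly, k]
  linarith

lemma exists_radiusPoly_root {α : ℝ} (h1 : α < 1) :
    ∃ r ∈ Set.Ioo (0 : ℝ) 1, radiusPoly α r = 0 := by
  have hc : ContinuousOn (radiusPoly α) (Set.Icc 0 1) := by
    apply Continuous.continuousOn
    unfold radiusPoly
    fun_prop
  have := intermediate_value_Ioo' zero_le_one hc
  exact this ⟨by norm_num [radiusPoly], by simp only [radiusPoly]; linarith⟩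

lemma hasSum_natCast_sq {r : ℝ} (hr : ‖r‖ < 1) :
    HasSum (fun n : ℕ => ((n : ℝ) + 1) ^ 2 * r ^ n) ((1 + r) / (1 - r) ^ 3) := by
  have c1 : ∀ n : ℕ, ((n + 1).choose 1 : ℝ) = n + 1 := fun n => by simp
  have c2 : ∀ n : ℕ, ((n + 2).choose 2 : ℝ) = (n + 1) * (n + 2) / 2 := fun n => by
    have h : (((n + 1).ascFactorial 2 : ℕ) : ℝ) = ((2).factorial * (n + 2).choose 2 : ℕ) := by
      rw [Nat.ascFactorial_eq_factorial_mul_choose]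
    simp only [Nat.ascFactorial, Nat.factorial] at h
    push_cast at h
    linarith
  have h := ((hasSum_choose_mul_geometric_of_norm_lt_one 2 hr).mul_left 2).sub
    (hasSum_choose_mul_geometric_of_norm_lt_one 1 hr)
  have h1r : 1 - r ≠ 0 := by
    rw [Real.norm_eq_abs, abs_lt] at hr
    linarith [hr.2]
  convert! h using 1
  · funext n
    rw [c1, c2]
    ring
  · field_simp
    ring

lemma hasSum_natCast_pow_four {r : ℝ} (hr : ‖r‖ < 1) :
    HasSum (fun n : ℕ => ((n : ℝ) + 1) ^ 4 * r ^ n)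
      ((1 + r) * (1 + 10 * r + r ^ 2) / (1 - r) ^ 5) := by
  have c3 : ∀ n : ℕ, ((n + 3).choose 3 : ℝ) = (n + 1) * (n + 2) * (n + 3) / 6 := fun n => by
    have h : (((n + 1).ascFactorial 3 : ℕ) : ℝ) = ((3).factorial * (n + 3).choose 3 : ℕ) := by
      rw [Nat.ascFactorial_eq_factorial_mul_choose]
    simp only [Nat.ascFactorial, Nat.factorial] at h
    push_cast at h
    linarith
  have c4 : ∀ n : ℕ, ((n + 4).choose 4 : ℝ) = (n + 1) * (n + 2) * (n + 3) * (n + 4) / 24 := fun n => by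
    have h : (((n + 1).ascFactorial 4 : ℕ) : ℝ) = ((4).factorial * (n + 4).choose 4 : ℕ) := by
      rw [Nat.ascFactorial_eq_factorial_mul_choose]
    simp only [Nat.ascFactorial, Nat.factorial] at h
    push_cast at h
    linarith
  have h0 := hasSum_choose_mul_geometric_of_norm_lt_one 1 hr
  have h := (((hasSum_choose_mul_geometric_of_norm_lt_one 4 hr).mul_left 24).sub
    ((hasSum_choose_mul_geometric_of_norm_lt_one 3 hr).mul_left 36)).add
    (((hasSum_natCast_sq hr).mul_left 7).add (h0.mul_left 6))
  have h1r : 1 - r ≠ 0 := by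
    rw [Real.norm_eq_abs, abs_lt] at hr
    linarith [hr.2]
  convert! h using 1
  · funext n
    rw [c3, c4, Nat.choose_one_right]
    push_cast
    ring
  · field_simp
    ring

/-- Coefficients of the convolution of two functions of class `K_H^0` satisfy the coefficient
condition for full convexity in the disk bounded by the root of `radiusPoly`. -/
lemma convexSeries_of_norm_le {c d : ℕ → ℂ} {α s : ℝ} (hα0 : 0 ≤ α) (hα1 : α < 1)
    (hs : s ∈ Set.Ioo (0 : ℝ) 1) (hroot : radiusPoly α s = 0) (hc0 : c 0 = 0)
    (hc : ∀ n, ‖c n‖ ≤ (((n : ℝ) + 2) / 2) ^ 2) (hd : ∀ n, ‖d n‖ ≤ ((n : ℝ) / 2) ^ 2) :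
    ConvexSeries c d α s := by
  refine ⟨⟨1, 2, fun n => (hc n).trans ?_⟩, ⟨1, 2, fun n => (hd n).trans ?_⟩, hα0, hα1, hs.2.le,
    fun r hr0 hrs => ?_⟩
  · have hn : (0 : ℝ) ≤ n := Nat.cast_nonneg n
    nlinarith
  · have hn : (0 : ℝ) ≤ n := Nat.cast_nonneg n
    nlinarith
  have hr1 : r < 1 := hrs.trans hs.2
  have hrn : ‖r‖ < 1 := by rwa [Real.norm_of_nonneg hr0.le]
  have hp : 0 < radiusPoly α r := hroot ▸ radiusPoly_lt hα0 hα1 hr0.le hrs hs.2.le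
  -- With m = n+1, the squared bounds combine to m²(m²+1)/2 - αm². At m = 1 this equals 1-α, which
  -- is subtracted because c 0 and d 0 vanish.
  have hsum := ((((hasSum_natCast_pow_four hrn).add (hasSum_natCast_sq hrn)).div_const 2).sub
    ((hasSum_natCast_sq hrn).mul_left α)).sub (hasSum_ite_eq 0 (1 - α))
  have h1r : 0 < 1 - r := sub_pos.mpr hr1
  have hle : ∀ n : ℕ, ((n : ℝ) + 1) * (((n : ℝ) + 1 - α) * ‖c n‖ + ((n : ℝ) + 1 + α) * ‖d n‖) * r ^ n
      ≤ (((n : ℝ) + 1) ^ 4 * r ^ n + ((n : ℝ) + 1) ^ 2 * r ^ n) / 2 -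
        α * (((n : ℝ) + 1) ^ 2 * r ^ n) - if n = 0 then 1 - α else 0 := by
    intro n
    have hn : (0 : ℝ) ≤ n := Nat.cast_nonneg n
    have k2 := mul_le_mul_of_nonneg_left (hd n) (by linarith : 0 ≤ (n : ℝ) + 1 + α)
    rcases n.eq_zero_or_pos with rfl | hpos
    · have hd0 : ‖d 0‖ ≤ 0 := by simpa using hd 0
      have hd0' : ‖d 0‖ = 0 := le_antisymm hd0 (norm_nonneg _)
      rw [hc0, hd0']
      norm_num
    · have k1 := mul_le_mul_of_nonneg_left (hc n) (by linarith : 0 ≤ (n : ℝ) + 1 - α)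
      rw [if_neg hpos.ne', sub_zero]
      have k3 := mul_le_mul_of_nonneg_left (add_le_add k1 k2)
        (by positivity : 0 ≤ ((n : ℝ) + 1) * r ^ n)
      calc _ = ((n : ℝ) + 1) * r ^ n * (((n : ℝ) + 1 - α) * ‖c n‖ + ((n : ℝ) + 1 + α) * ‖d n‖) := by
            ring
        _ ≤ _ := k3
        _ = _ := by ring
  have hsummable : Summable fun n : ℕ => ((n : ℝ) + 1) *
      (((n : ℝ) + 1 - α) * ‖c n‖ + ((n : ℝ) + 1 + α) * ‖d n‖) * r ^ n := by
    refine Summable.of_nonneg_of_le (fun n => ?_) hle hsum.summable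
    have hn : (0 : ℝ) ≤ n := Nat.cast_nonneg n
    have : 0 ≤ (n : ℝ) + 1 - α := by linarith
    positivity
  refine (hsummable.tsum_le_tsum hle hsum.summable).trans_lt ?_
  rw [hsum.tsum_eq]
  have e : ((1 + r) * (1 + 10 * r + r ^ 2) / (1 - r) ^ 5 + (1 + r) / (1 - r) ^ 3) / 2 -
      α * ((1 + r) / (1 - r) ^ 3) - (1 - α) = (1 - α) - radiusPoly α r / (1 - r) ^ 5 := by
    simp only [radiusPoly]
    field_simp
    ring
  rw [e, sub_lt_self_iff]
  positivity

/-- The coefficient bounds for the class `K_H^0`. -/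
theorem IsKH0.norm_coeff_le {f : ℂ → ℂ} (hf : IsKH0 f) :
    analyticCoeff f 1 = 1 ∧ ∀ n : ℕ, ‖analyticCoeff f (n + 1)‖ ≤ ((n : ℝ) + 2) / 2 ∧
      ‖coanalyticCoeff f (n + 1)‖ ≤ (n : ℝ) / 2 := by
  obtain ⟨h, g, D⟩ := hf.exists_parts
  obtain ⟨a, b, ha, hb, hab⟩ := D.exists_halfplane hf
  refine ⟨?_, fun n => ?_⟩
  · rw [D.analyticCoeff_eq 0]
    simp [D.deriv_h_zero]
  · rw [D.analyticCoeff_eq n, D.coanalyticCoeff_eq n]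
    exact D.norm_taylorCoeff_le ha hb hab n

lemma FullyConvexOfOrder.congr {F G : ℂ → ℂ} {α R : ℝ} (h : FullyConvexOfOrder F α R)
    (hFG : Set.EqOn F G (ball 0 R)) : FullyConvexOfOrder G α R := by
  refine ⟨fun z hz => ?_, fun r hr0 hrR => ?_⟩
  · exact (harmonicAt_congr_nhds (eventuallyEq_of_mem (isOpen_ball.mem_nhds hz) hFG)).mp (h.1 z hz)
  · have hs : Set.EqOn F G (sphere 0 r) :=
      hFG.mono (sphere_subset_closedBall.trans (closedBall_subset_ball hrR))
    obtain ⟨h1, h2, h3⟩ := h.2 r hr0 hrR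
    have hc : (fun θ : ℝ => F ((r : ℂ) * cexp (I * (θ : ℂ)))) =
        fun θ : ℝ => G ((r : ℂ) * cexp (I * (θ : ℂ))) := by
      funext θ
      apply hs
      rw [mem_sphere_zero_iff_norm, norm_mul, mul_comm I, norm_exp_ofReal_mul_I, norm_real,
        Real.norm_of_nonneg hr0.le, mul_one]
    exact ⟨h1.congr hs, by rwa [← hs.image_eq], by rwa [← hc]⟩

/-- Coefficients multiply under convolution, so the bounds for f and g give the squared bounds of
`convexSeries_of_norm_le`. -/
theorem IsKH0.conv_fullyConvexOfOrder {f g : ℂ → ℂ} (hf : IsKH0 f) (hg : IsKH0 g) {α s : ℝ}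
    (hα0 : 0 ≤ α) (hα1 : α < 1) (hs : s ∈ Set.Ioo (0 : ℝ) 1) (hroot : radiusPoly α s = 0) :
    Set.InjOn (conv f g) (ball 0 s) ∧ FullyConvexOfOrder (conv f g) α s := by
  obtain ⟨hf1, hfb⟩ := hf.norm_coeff_le
  obtain ⟨hg1, hgb⟩ := hg.norm_coeff_le
  -- The entry at 0 is zero since `seriesMap` carries the term z separately, and the product of the
  -- leading coefficients is 1.
  set c : ℕ → ℂ := fun n =>
    if n = 0 then 0 else analyticCoeff f (n + 1) * analyticCoeff g (n + 1) with hc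
  set d : ℕ → ℂ := fun n => coanalyticCoeff f (n + 1) * coanalyticCoeff g (n + 1) with hd
  have hcb : ∀ n, ‖c n‖ ≤ (((n : ℝ) + 2) / 2) ^ 2 := fun n => by
    simp only [hc]
    split_ifs with h
    · simp only [norm_zero]
      positivity
    · rw [norm_mul, sq]
      exact mul_le_mul (hfb n).1 (hgb n).1 (norm_nonneg _) (by positivity)
  have S : ConvexSeries c d α s := convexSeries_of_norm_le hα0 hα1 hs hroot (by simp [hc]) hcb
    fun n => by
      rw [norm_mul, sq]
      exact mul_le_mul (hfb n).2 (hgb n).2 (norm_nonneg _) (by positivity)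
  have heq : Set.EqOn (seriesMap c d) (conv f g) (ball 0 s) := by
    intro z hz
    have hz1 : ‖z‖ < 1 := (mem_ball_zero_iff.mp hz).trans hs.2
    simp only [seriesMap, conv]
    congr 1
    have hsum : Summable fun n => c n * z ^ (n + 1) := by
      simpa only [pow_succ, mul_assoc] using (S.c_poly.summable hz1).mul_right z
    have h1 := hsum.hasSum.add (hasSum_ite_eq (0 : ℕ) z)
    rw [powerSum, add_comm z, ← h1.tsum_eq]
    congr 1 with n
    by_cases hn : n = 0
    · subst hn
      simp [hc, hf1, hg1]
    · simp [hc, hn]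
  exact ⟨S.injOn.congr heq, S.fullyConvexOfOrder.congr heq⟩

end HarmonicMapping

end

theorem corollary4p5 :
    ∃ s₀ : ℝ → ℝ,
      (∀ α : ℝ, 0 ≤ α → α < 1 →
        (∀ r : ℝ, (r ∈ Set.Ioo (0 : ℝ) 1 ∧
            2 * (1 - α) * (1 - r) ^ 5 + α * (1 + r) * (1 - r) ^ 2
              - (1 + r) * (r ^ 2 + 4 * r + 1) = 0) ↔ r = s₀ α) ∧
        ∀ f g : ℂ → ℂ, HarmonicMapping.IsKH0 f → HarmonicMapping.IsKH0 g →
          Set.InjOn (HarmonicMapping.conv f g) (Metric.ball 0 (s₀ α)) ∧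
          HarmonicMapping.FullyConvexOfOrder (HarmonicMapping.conv f g) α (s₀ α)) ∧
      (0.0712543 < s₀ 0 ∧ s₀ 0 < 0.07125435) ∧
      ∀ f g : ℂ → ℂ, HarmonicMapping.IsKH0 f → HarmonicMapping.IsKH0 g →
        Set.InjOn (HarmonicMapping.conv f g) (Metric.ball 0 (s₀ 0)) ∧
        HarmonicMapping.FullyConvex (HarmonicMapping.conv f g) (s₀ 0) := by
  choose! s₀ hs hroot using fun (α : ℝ) (h : α < 1) => HarmonicMapping.exists_radiusPoly_root h
  refine ⟨s₀, fun α h0 h1 => ⟨fun r => ⟨?_, ?_⟩, fun f g hf hg =>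
    hf.conv_fullyConvexOfOrder hg h0 h1 (hs α h1) (hroot α h1)⟩, ⟨?_, ?_⟩, fun f g hf hg =>
    hf.conv_fullyConvexOfOrder hg le_rfl one_pos (hs 0 one_pos) (hroot 0 one_pos)⟩
  · rintro ⟨hr, hr0⟩
    change HarmonicMapping.radiusPoly α r = 0 at hr0
    have hα := hroot α h1
    rcases lt_trichotomy r (s₀ α) with h | h | h
    · exact absurd (HarmonicMapping.radiusPoly_lt h0 h1 hr.1.le h (hs α h1).2.le)
        (by rw [hr0, hα]; exact lt_irrefl _)
    · exact h
    · exact absurd (HarmonicMapping.radiusPoly_lt h0 h1 (hs α h1).1.le h hr.2.le)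
        (by rw [hr0, hα]; exact lt_irrefl _)
  · rintro rfl
    exact ⟨hs α h1, hroot α h1⟩
  -- Since the polynomial is strictly decreasing, its signs at the two decimal endpoints locate the
  -- root between them.
  · have hp : 0 < HarmonicMapping.radiusPoly 0 0.0712543 := by
      norm_num [HarmonicMapping.radiusPoly]
    by_contra! h
    rcases h.eq_or_lt with h | h
    · rw [← h, hroot 0 one_pos] at hp
      exact lt_irrefl _ hp
    · have := HarmonicMapping.radiusPoly_lt le_rfl one_pos (hs 0 one_pos).1.le h (by norm_num)
      rw [hroot 0 one_pos] at this
      linarith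
  · have hp : HarmonicMapping.radiusPoly 0 0.07125435 < 0 := by
      norm_num [HarmonicMapping.radiusPoly]
    by_contra! h
    rcases h.eq_or_lt with h | h
    · rw [h, hroot 0 one_pos] at hp
      exact lt_irrefl _ hp
    · have := HarmonicMapping.radiusPoly_lt le_rfl one_pos (by norm_num) h (hs 0 one_pos).2.le
      rw [hroot 0 one_pos] at this
      linarith
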